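/- **Setting.** Let $p\ge 1$, $r\ge p$, let $P$ be a probability law on $\mathbb{R}^d$, let $X\sim P$, let $g:\mathbb{R}^d\times\mathbb{R}^p\to\mathbb{R}^r$ and $\theta_0\in\mathbb{R}^p$. Let $(m_n)_{n\ge 0}$ be an arbitrary sequence of positive integers (no restriction: it may be constant or tend to infinity at any rate). For every $n$, write $m=m_n$ and $N=nm$, and let $X_{ij}$, $1\le i\le n$, $1\le j\le m$, be $N$ i.i.d. observations with law $P$, divided into $n$ groups of size $m$. The grouped empirical likelihood (GEL) ratio is $$R_G(\theta)=\sup\Big\{\prod_{i=1}^n (Nq_i)^m \ :\ q_i\ge 0,\ \sum_{i=1}^n q_i=\frac1m,\ \sum_{i=1}^n q_i\sum_{j=1}^m g(X_{ij},\theta)=0\Big\},\qquad \sup\emptyset=0.$$ A GEL estimate is a minimizer $\hat\theta$ of $-2\log R_G(\theta)$, i.e. a maximizer of $R_G(\theta)$, over the ball $\|\theta-\theta_0\|\le N^{-1/3}$. **Conditions.** (1) $\mathbb{E}[g(X,\theta_0)g(X,\theta_0)']$ is positive definite. (2) In a neighborhood $\mathcal N(\theta_0)$ of $\theta_0$, $\partial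 g(x,\theta)/\partial\theta$ and $\partial^2 g(x,\theta)/\partial\theta\,\partial\theta'$ are continuous in $\theta$ for every $x$ (and $g(\cdot,\theta)$ is measurable). (3) There is a function $H$ with $\mathbb{E}|H(X)|<\infty$ such that $\|\partial g(x,\theta)/\partial\theta\|$, $\|\partial^2 g(x,\theta)/\partial\theta\,\partial\theta'\|$ and $\|g(x,\theta)\|^3$ are at most $H(x)$ for all $x$ and all $\theta\in\mathcal N(\theta_0)$. (4) The matrix $\mathbb{E}[\partial g(X,\theta_0)/\partial\theta]$ has rank $p$. **Theorem 2.** Assume Conditions (1)–(4) and $H_0$: $\theta_0$ is the true parameter value, i.e. $\mathbb{E}[g(X,\theta_0)]=0$. Then, as $n\to\infty$: - $\Pr(R_G(\theta_0)>0)\to 1$. - (Just-identified case.) If $r=p$, then $-2\log R_G(\theta_0)/m\xrightarrow{d}\chi^2_p$. - (Over-identified case $r>p$, and also $r=p$.) For all sufficiently large $n$ a GEL estimate $\hat\theta$ exists for every realization of the data, and for every choice of $\hat\theta$ the likelihood ratio statistic for $H_0$ satisfies $$\frac1m\Big\{-2\log R_G(\theta_0)+2\log R_G(\hat\theta)\Big\}=-\frac2m\log\frac{R_G(\theta_0)}{R_G(\hat\theta)}\xrightarrow{d}\chi^2_p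 .$$ (On the event $R_G(\theta_0)=0$, whose probability tends to $0$, the statistics may be given any fixed finite value.) -/

import Mathlib

open MeasureTheory ProbabilityTheory Filter Topology

/-- The chi-squared distribution with `p` degrees of freedom: the law of the sum of the squares of
`p` independent standard normal random variables. -/
noncomputable def chiSquared (p : ℕ) : Measure ℝ :=
  (Measure.pi (fun _ : Fin p => gaussianReal 0 1)).map (fun z => ∑ i, z i ^ 2)

instance chiSquared_isProbabilityMeasure (p : ℕ) : IsProbabilityMeasure (chiSquared p) := by
  unfold chiSquared
  exact Measure.isProbabilityMeasure_map
    (Finset.measurable_sum _ fun i _ => (measurable_pi_apply i).pow_const 2).aemeasurable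

/-- The grouped empirical likelihood ratio `R_G(θ)` of the data `x i j` (`n` groups of size `m`,
`N = n * m`): the supremum of `∏ i, (N * q i) ^ m` over the weights `q` with `q i ≥ 0`,
`∑ i, q i = 1 / m` and `∑ i, q i * ∑ j, g (x i j) θ = 0`. It is `0` if there are no such weights. -/
noncomputable def gelRatio {d p r n m : ℕ}
    (g : EuclideanSpace ℝ (Fin d) → EuclideanSpace ℝ (Fin p) → EuclideanSpace ℝ (Fin r))
    (x : Fin n → Fin m → EuclideanSpace ℝ (Fin d)) (θ : EuclideanSpace ℝ (Fin p)) : ℝ :=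
  sSup {L : ℝ | ∃ q : Fin n → ℝ, (∀ i, 0 ≤ q i) ∧ ∑ i, q i = 1 / (m : ℝ) ∧
    ∑ i, q i • ∑ j, g (x i j) θ = 0 ∧ L = ∏ i, ((n : ℝ) * (m : ℝ) * q i) ^ m}

/-- The closed ball `‖θ - θ₀‖ ≤ N ^ (-1/3)`, with `N = n * m`. -/
noncomputable def gelBall {p : ℕ} (n m : ℕ) (θ₀ : EuclideanSpace ℝ (Fin p)) :
    Set (EuclideanSpace ℝ (Fin p)) :=
  Metric.closedBall θ₀ (((n : ℝ) * (m : ℝ)) ^ (-(1 / 3) : ℝ))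

/-- `θ` is a grouped empirical likelihood estimate for the data `x`: it maximizes `R_G`
(that is, it minimizes `-2 log R_G`) over the ball `‖θ - θ₀‖ ≤ N ^ (-1/3)`. -/
def IsGELEstimate {d p r n m : ℕ}
    (g : EuclideanSpace ℝ (Fin d) → EuclideanSpace ℝ (Fin p) → EuclideanSpace ℝ (Fin r))
    (x : Fin n → Fin m → EuclideanSpace ℝ (Fin d)) (θ₀ θ : EuclideanSpace ℝ (Fin p)) : Prop :=
  θ ∈ gelBall n m θ₀ ∧ IsMaxOn (gelRatio g x) (gelBall n m θ₀) θ

/-- The regularity conditions on the estimating function `g` at `θ₀`, for observations with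
law `P`. -/
structure GELConditions {d p r : ℕ} (P : Measure (EuclideanSpace ℝ (Fin d)))
    (g : EuclideanSpace ℝ (Fin d) → EuclideanSpace ℝ (Fin p) → EuclideanSpace ℝ (Fin r))
    (θ₀ : EuclideanSpace ℝ (Fin p)) : Prop where
  /-- The matrix `E[g(X, θ₀) g(X, θ₀)']` is positive definite. -/
  posDef : (Matrix.of fun a b : Fin r => ∫ x, g x θ₀ a * g x θ₀ b ∂P).PosDef
  /-- On some open neighborhood `U` of `θ₀`, the function `g(x, ·)` has continuous first and second
  derivatives for every `x`, and these derivatives and `‖g‖ ^ 3` are bounded by an integrable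
  function `H` of `x`. (Also, `g(·, θ)` is measurable for `θ` in `U`.) -/
  smooth_dominated : ∃ U : Set (EuclideanSpace ℝ (Fin p)), IsOpen U ∧ θ₀ ∈ U ∧
    (∀ θ ∈ U, Measurable fun x => g x θ) ∧
    (∀ x, ContDiffOn ℝ 2 (g x) U) ∧
    ∃ H : EuclideanSpace ℝ (Fin d) → ℝ, Integrable H P ∧
      ∀ x, ∀ θ ∈ U, ‖fderiv ℝ (g x) θ‖ ≤ H x ∧ ‖fderiv ℝ (fderiv ℝ (g x)) θ‖ ≤ H x ∧
        ‖g x θ‖ ^ 3 ≤ H x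
  /-- The `r × p` matrix `E[∂g(X, θ₀)/∂θ]` has rank `p`. -/
  rank_eq : (Matrix.of fun (a : Fin r) (b : Fin p) =>
    ∫ x, fderiv ℝ (g x) θ₀ (EuclideanSpace.single b 1) a ∂P).rank = p

/-! Substituting `u = N q` shows that `R_G(θ)` is the `m`-th power of the ordinary empirical
likelihood ratio of the `n` group sums (`gelRatio_eq_pow`). That ratio depends only on which weights
annihilate the data, so it is unchanged by injective linear maps. Hence `g` may be whitened to have
second moment matrix `I` at `θ₀`, and each group sum divided by `√m`. The factor `1/m` in the
statistic cancels the power, and the group size matters only through moment bounds uniform in `m`.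

The analytic core is deterministic. If an array satisfies `max ‖y k‖ = o(√n)`, has empirical second
moment tending to `I`, and has bounded normalized sum `G`, then `-2 log EL = ‖G‖² + o(1)`
(`IsELRegular.tendsto_elRatio`). No Lagrange multiplier equation is solved: the lower bound is weak
duality at the trial multiplier `G/√n`, and the upper bound comes from explicit, nearly optimal
weights.

With `θ = θ₀ + t/√N` the ball becomes `‖t‖ ≤ N^(1/6)`. For bounded `t` the array stays regular and
the statistic is `‖G + D t‖² + o(1)`, where `D` is the mean derivative. Maximizers have bounded `t`
(`IsELRegular.exists_bound`): a bounded statistic forces weights close to `1` in `ℓ²`, which bounds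
`G + D t` up to a small multiple of `‖t‖`, while `D` is bounded below. Thus the log ratio is `‖G‖² -
min ‖G + D t‖² + o(1)`, the squared length of the projection of `G` onto the range of `D`
(`IsELRegular.tendsto_log_ratio`). The central limit theorem makes this `χ²_p`, since `D` is
injective.

Probability enters through the filter `inProb` on pairs `(n, ω)`, along which convergence in
probability is an ordinary limit. Intersecting it with the events `‖G‖² ≤ K` is harmless by
tightness, so the deterministic theorems apply verbatim. Their hypotheses follow from limit theorems
for the array, proved by approximating with bounded functions whose normalized group sums have
fourth moments bounded independently of `m`. -/

open scoped RealInnerProductSpace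

/-! ### Finite-sample bounds for the empirical likelihood ratio -/

section EmpiricalLikelihood

variable {V : Type*} [NormedAddCommGroup V] [InnerProductSpace ℝ V] {n : ℕ}

/-- The weights `u` (normalized to have mean `1`) under which the weighted mean of `y` vanishes. -/
def elWeights (y : Fin n → V) : Set (Fin n → ℝ) :=
  {u | (∀ i, 0 ≤ u i) ∧ ∑ i, u i = n ∧ ∑ i, u i • y i = 0}

/-- The empirical likelihood ratio for the hypothesis that `y` is a sample with mean zero. -/
noncomputable def elRatio (y : Fin n → V) : ℝ :=
  sSup ((fun u => ∏ i, u i) '' elWeights y)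

lemma isCompact_elWeights (y : Fin n → V) : IsCompact (elWeights y) := by
  refine (isCompact_Icc (a := (0 : Fin n → ℝ)) (b := fun _ => (n : ℝ))).of_isClosed_subset ?_ ?_
  · have h1 : IsClosed {u : Fin n → ℝ | ∀ i, 0 ≤ u i} := by
      simp only [Set.ofPred_forall]
      exact isClosed_iInter fun i => isClosed_le continuous_const (continuous_apply i)
    have h2 : IsClosed {u : Fin n → ℝ | ∑ i, u i = n} :=
      isClosed_eq (by fun_prop) continuous_const
    have h3 : IsClosed {u : Fin n → ℝ | ∑ i, u i • y i = 0} :=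
      isClosed_eq (by fun_prop) continuous_const
    exact h1.inter (h2.inter h3)
  · rintro u ⟨h0, h1, -⟩
    refine ⟨h0, fun i => ?_⟩
    change u i ≤ n
    rw [← h1]
    exact Finset.single_le_sum (fun j _ => h0 j) (Finset.mem_univ i)

/-- Weak duality. Bound each factor by `x ≤ exp (x - 1)`; the exponents add up to zero because of
the two linear constraints on `u`. -/
lemma prod_mul_prod_le_one {y : Fin n → V} {u : Fin n → ℝ} (hu : u ∈ elWeights y) {v : V}
    (hv : ∀ i, 0 < 1 + ⟪v, y i⟫) : (∏ i, u i) * ∏ i, (1 + ⟪v, y i⟫) ≤ 1 := by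
  obtain ⟨h0, h1, h2⟩ := hu
  rw [← Finset.prod_mul_distrib]
  calc ∏ i, u i * (1 + ⟪v, y i⟫) ≤ ∏ i, Real.exp (u i * (1 + ⟪v, y i⟫) - 1) := by
        refine Finset.prod_le_prod (fun i _ => mul_nonneg (h0 i) (hv i).le) fun i _ => ?_
        linarith [Real.add_one_le_exp (u i * (1 + ⟪v, y i⟫) - 1)]
    _ = 1 := by
        rw [← Real.exp_sum, Real.exp_eq_one_iff]
        have h3 : ⟪v, ∑ i, u i • y i⟫ = 0 := by rw [h2, inner_zero_right]
        rw [inner_sum] at h3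
        simp only [inner_smul_right] at h3
        simp only [mul_add, mul_one, Finset.sum_sub_distrib, Finset.sum_add_distrib, h1, h3]
        simp

lemma prod_le_one_of_mem_elWeights {y : Fin n → V} {u : Fin n → ℝ} (hu : u ∈ elWeights y) :
    ∏ i, u i ≤ 1 := by
  simpa using prod_mul_prod_le_one hu (v := 0) (by simp)

lemma bddAbove_elWeights (y : Fin n → V) : BddAbove ((fun u => ∏ i, u i) '' elWeights y) :=
  ⟨1, by rintro _ ⟨u, hu, rfl⟩; exact prod_le_one_of_mem_elWeights hu⟩

lemma prod_le_elRatio {y : Fin n → V} {u : Fin n → ℝ} (hu : u ∈ elWeights y) :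
    ∏ i, u i ≤ elRatio y :=
  le_csSup (bddAbove_elWeights y) ⟨u, hu, rfl⟩

lemma exists_isMaxOn_elWeights {y : Fin n → V} (h : (elWeights y).Nonempty) :
    ∃ u ∈ elWeights y, IsMaxOn (fun u => ∏ i, u i) (elWeights y) u ∧ ∏ i, u i = elRatio y := by
  obtain ⟨u, hu, hmax⟩ := (isCompact_elWeights y).exists_isMaxOn h
    (f := fun u => ∏ i, u i) (by fun_prop)
  refine ⟨u, hu, hmax, le_antisymm (prod_le_elRatio hu) (csSup_le (h.image _) ?_)⟩
  rintro _ ⟨w, hw, rfl⟩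
  exact hmax hw

lemma elRatio_nonneg (y : Fin n → V) : 0 ≤ elRatio y :=
  Real.sSup_nonneg (by rintro _ ⟨u, hu, rfl⟩; exact Finset.prod_nonneg fun i _ => hu.1 i)

lemma exists_prod_eq_elRatio {y : Fin n → V} (h : 0 < elRatio y) :
    ∃ u ∈ elWeights y, ∏ i, u i = elRatio y := by
  rcases (elWeights y).eq_empty_or_nonempty with he | hne
  · simp [elRatio, he] at h
  · obtain ⟨u, hu, -, h⟩ := exists_isMaxOn_elWeights hne
    exact ⟨u, hu, h⟩

lemma sum_log_le_neg_log_elRatio {y : Fin n → V} (h : 0 < elRatio y) {v : V}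
    (hv : ∀ i, 0 < 1 + ⟪v, y i⟫) : ∑ i, Real.log (1 + ⟪v, y i⟫) ≤ -Real.log (elRatio y) := by
  obtain ⟨u, hu, hue⟩ := exists_prod_eq_elRatio h
  have h1 := prod_mul_prod_le_one hu hv
  rw [hue] at h1
  have h2 := Real.log_le_log (mul_pos h (Finset.prod_pos fun i _ => hv i)) h1
  rw [Real.log_mul h.ne' (Finset.prod_pos fun i _ => hv i).ne', Real.log_one,
    Real.log_prod (fun i _ => (hv i).ne')] at h2
  linarith

lemma abs_log_one_add_sub_le {x : ℝ} (hx : |x| ≤ 1 / 2) :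
    |Real.log (1 + x) - x + x ^ 2 / 2| ≤ 2 * |x| ^ 3 := by
  have h := Real.abs_log_sub_add_sum_range_le (x := -x) (by rw [abs_neg]; linarith) 2
  simp only [Finset.sum_range_succ, Finset.sum_range_zero, abs_neg] at h
  have h1 : |x| ^ (2 + 1) / (1 - |x|) ≤ 2 * |x| ^ 3 := by
    rw [div_le_iff₀ (by linarith)]
    have h2 := mul_nonneg (pow_nonneg (abs_nonneg x) 3) (sub_nonneg.2 hx)
    norm_num at h2 ⊢
    linarith
  refine le_trans (le_of_eq ?_) (h.trans h1)
  congr 1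
  norm_num
  ring

/-- The lower bound for the empirical likelihood statistic. -/
lemma le_neg_two_log_elRatio (hn : 0 < n) {y : Fin n → V} {δ η K : ℝ} {G : V}
    (hδ : ∀ i, ‖y i‖ ≤ δ * √n)
    (hquad : ∀ v, (n : ℝ)⁻¹ * ∑ i, ⟪v, y i⟫ ^ 2 ≤ (1 + η) * ‖v‖ ^ 2)
    (hGdef : G = (√n)⁻¹ • ∑ i, y i) (hG : ‖G‖ ≤ K) (hK : K * δ ≤ 1 / 4)
    (hpos : 0 < elRatio y) :
    2 * ‖G‖ ^ 2 - (1 + 4 * (K * δ)) * ((1 + η) * ‖G‖ ^ 2) ≤ -2 * Real.log (elRatio y) := by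
  have hn' : (0 : ℝ) < n := by exact_mod_cast hn
  have hsn : 0 < √(n : ℝ) := Real.sqrt_pos.2 hn'
  have hss : √(n : ℝ) * √n = n := Real.mul_self_sqrt hn'.le
  have hK0 : 0 ≤ K := (norm_nonneg G).trans hG
  -- This maximizes the quadratic approximation `√n ⟪v, G⟫ - n ‖v‖² / 2` of the dual objective when
  -- the second moment is the identity.
  set v : V := (√n)⁻¹ • G with hv
  have hvy : ∀ i, |⟪v, y i⟫| ≤ K * δ := fun i => by
    refine (abs_real_inner_le_norm _ _).trans ?_
    rw [hv, norm_smul, norm_inv, Real.norm_of_nonneg hsn.le]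
    calc (√(n : ℝ))⁻¹ * ‖G‖ * ‖y i‖ ≤ (√(n : ℝ))⁻¹ * K * (δ * √n) := by
          gcongr
          exact hδ i
      _ = K * δ := by field_simp
  have hKδ : 0 ≤ K * δ := (abs_nonneg _).trans (hvy ⟨0, hn⟩)
  have hterm : ∀ i, 2 * ⟪v, y i⟫ - (1 + 4 * (K * δ)) * ⟪v, y i⟫ ^ 2 ≤
      2 * Real.log (1 + ⟪v, y i⟫) := fun i => by
    have h1 := neg_le_of_abs_le (abs_log_one_add_sub_le ((hvy i).trans (by linarith)))
    have h2 : |⟪v, y i⟫| ^ 3 ≤ K * δ * ⟪v, y i⟫ ^ 2 := by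
      rw [← sq_abs ⟪v, y i⟫]
      calc |⟪v, y i⟫| ^ 3 = |⟪v, y i⟫| * |⟪v, y i⟫| ^ 2 := by ring
        _ ≤ _ := by gcongr; exact hvy i
    nlinarith
  have hlog := sum_log_le_neg_log_elRatio hpos (v := v) fun i => by
    linarith [neg_le_of_abs_le (hvy i)]
  have hsum := Finset.sum_le_sum fun i (_ : i ∈ Finset.univ) => hterm i
  rw [Finset.sum_sub_distrib, ← Finset.mul_sum, ← Finset.mul_sum, ← Finset.mul_sum,
    ← inner_sum] at hsum
  have hsumy : ∑ i, y i = √(n : ℝ) • G := by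
    rw [hGdef, smul_smul, mul_inv_cancel₀ hsn.ne', one_smul]
  have h1 : ⟪v, ∑ i, y i⟫ = ‖G‖ ^ 2 := by
    rw [hsumy, hv, real_inner_smul_left, real_inner_smul_right, real_inner_self_eq_norm_sq]
    field_simp
  have h2 : ∑ i, ⟪v, y i⟫ ^ 2 ≤ (1 + η) * ‖G‖ ^ 2 := by
    have := hquad G
    have h3 : ∀ i, ⟪v, y i⟫ ^ 2 = (n : ℝ)⁻¹ * ⟪G, y i⟫ ^ 2 := fun i => by
      rw [hv, real_inner_smul_left, mul_pow, inv_pow, sq (√(n : ℝ)), hss]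
    simpa only [h3, ← Finset.mul_sum] using this
  rw [h1] at hsum
  have := mul_le_mul_of_nonneg_left h2 (by linarith : 0 ≤ 1 + 4 * (K * δ))
  linarith

/-- The upper bound for the empirical likelihood statistic. -/
lemma neg_two_log_elRatio_le [FiniteDimensional ℝ V] (hn : 0 < n) {y : Fin n → V}
    {δ η K : ℝ} {G : V}
    (hδ : ∀ i, ‖y i‖ ≤ δ * √n)
    (hquad : ∀ v, (1 - η) * ‖v‖ ^ 2 ≤ (n : ℝ)⁻¹ * ∑ i, ⟪v, y i⟫ ^ 2)
    (hGdef : G = (√n)⁻¹ • ∑ i, y i) (hG : ‖G‖ ≤ K) (hK : K * δ ≤ 1 / 16)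
    (hη : 1 / 2 ≤ 1 - η - K ^ 2 / n) :
    0 < elRatio y ∧
      -2 * Real.log (elRatio y) ≤ (1 + 16 * (K * δ)) * (‖G‖ ^ 2 / (1 - η - K ^ 2 / n)) := by
  have hn' : (0 : ℝ) < n := by exact_mod_cast hn
  have hsn : 0 < √(n : ℝ) := Real.sqrt_pos.2 hn'
  have hss : √(n : ℝ) * √n = n := Real.mul_self_sqrt hn'.le
  have hK0 : 0 ≤ K := (norm_nonneg G).trans hG
  have hδ0 : 0 ≤ δ := by
    by_contra! h
    nlinarith [norm_nonneg (y ⟨0, hn⟩), hδ ⟨0, hn⟩]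
  -- A lower bound for the centered second moment: subtracting the mean `b` costs at most `‖b‖² ≤ K²
  -- / n`.
  set κ := 1 - η - K ^ 2 / n with hκ
  set b : V := (√n)⁻¹ • G with hb
  have hsumy : ∑ i, y i = (n : ℝ) • b := by
    rw [hb, hGdef, smul_smul, smul_smul, mul_assoc, ← mul_inv, hss,
      mul_inv_cancel₀ hn'.ne', one_smul]
  have hbn : ‖b‖ = (√(n : ℝ))⁻¹ * ‖G‖ := by
    rw [hb, norm_smul, norm_inv, Real.norm_of_nonneg hsn.le]
  have hbδ : ‖b‖ ≤ δ * √n := by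
    have h1 : ‖∑ i, y i‖ ≤ n * (δ * √n) := by
      refine (norm_sum_le_of_le _ fun i _ => hδ i).trans ?_
      simp
    rw [hsumy, norm_smul, Real.norm_of_nonneg hn'.le] at h1
    exact le_of_mul_le_mul_left h1 hn'
  let c : Fin n → V := fun i => y i - b
  have hcsum : ∑ i, c i = 0 := by
    simp only [c, Finset.sum_sub_distrib, hsumy, Finset.sum_const, Finset.card_univ,
      Fintype.card_fin, ← Nat.cast_smul_eq_nsmul ℝ, sub_self]
  have hcn : ∀ i, ‖c i‖ ≤ 2 * (δ * √n) := fun i => by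
    have := norm_sub_le (y i) b
    linarith [hδ i]
  -- The centered second moment operator. Once `M w = b`, the weights `1 - ⟪w, c i⟫` give `∑ u i • y
  -- i = n b - n M w = 0`, because the `c i` sum to zero; they are a linearization of the optimal
  -- weights.
  let M : V →ₗ[ℝ] V :=
    { toFun := fun v => (n : ℝ)⁻¹ • ∑ i, ⟪v, c i⟫ • c i
      map_add' := fun v w => by
        simp only [inner_add_left, add_smul, Finset.sum_add_distrib, smul_add]
      map_smul' := fun a v => by
        simp only [real_inner_smul_left, mul_smul, ← Finset.smul_sum, RingHom.id_apply]
        rw [smul_comm] }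
  have hMdef : ∀ v, M v = (n : ℝ)⁻¹ • ∑ i, ⟪v, c i⟫ • c i := fun v => rfl
  have hMq : ∀ v, ⟪v, M v⟫ = (n : ℝ)⁻¹ * ∑ i, ⟪v, c i⟫ ^ 2 := fun v => by
    rw [hMdef, real_inner_smul_right, inner_sum]
    simp only [real_inner_smul_right, sq]
  have hMlow : ∀ v, κ * ‖v‖ ^ 2 ≤ ⟪v, M v⟫ := fun v => by
    have h1 : ∑ i, ⟪v, c i⟫ ^ 2 = ∑ i, ⟪v, y i⟫ ^ 2 - n * ⟪v, b⟫ ^ 2 := by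
      have h2 : ∑ i, ⟪v, y i⟫ = n * ⟪v, b⟫ := by
        rw [← inner_sum, hsumy, real_inner_smul_right]
      have h3 : ∀ i, ⟪v, c i⟫ ^ 2 = ⟪v, y i⟫ ^ 2 - 2 * ⟪v, b⟫ * ⟪v, y i⟫ + ⟪v, b⟫ ^ 2 :=
        fun i => by simp only [c, inner_sub_right]; ring
      simp only [h3, Finset.sum_add_distrib, Finset.sum_sub_distrib, ← Finset.mul_sum, h2]
      simp
      ring
    rw [hMq, h1, mul_sub, ← mul_assoc, inv_mul_cancel₀ hn'.ne', one_mul]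
    have h4 : ⟪v, b⟫ ^ 2 ≤ ‖v‖ ^ 2 * (K ^ 2 / n) := by
      have h5 : |⟪v, b⟫| ≤ ‖v‖ * ‖b‖ := abs_real_inner_le_norm v b
      have h6 : ‖b‖ ^ 2 ≤ K ^ 2 / n := by
        rw [hbn, mul_pow, inv_pow, sq (√(n : ℝ)), hss, inv_mul_eq_div]
        gcongr
      calc ⟪v, b⟫ ^ 2 = |⟪v, b⟫| ^ 2 := (sq_abs _).symm
        _ ≤ (‖v‖ * ‖b‖) ^ 2 := by gcongr
        _ = ‖v‖ ^ 2 * ‖b‖ ^ 2 := by ring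
        _ ≤ _ := by gcongr
    have := hquad v
    rw [hκ]
    linarith
  have hκ0 : 0 < κ := by linarith
  have hMinj : Function.Injective M := by
    rw [← LinearMap.ker_eq_bot, LinearMap.ker_eq_bot']
    intro v hv
    have h1 := hMlow v
    rw [hv, inner_zero_right] at h1
    have h2 : ‖v‖ ^ 2 = 0 := le_antisymm (by nlinarith) (sq_nonneg _)
    simpa using h2
  obtain ⟨w, hw⟩ := LinearMap.injective_iff_surjective.1 hMinj b
  have hwn : ‖w‖ ≤ ‖b‖ / κ := by
    rw [le_div_iff₀ hκ0]
    rcases (norm_nonneg w).eq_or_lt with h0 | h0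
    · rw [← h0, zero_mul]; exact norm_nonneg b
    · have h1 := hMlow w
      rw [hw] at h1
      have h2 := real_inner_le_norm w b
      nlinarith
  -- From `‖w‖ ≤ 2 K / √n`, as `κ ≥ 1/2`, and `‖c i‖ ≤ 2 δ √n`. With `K δ ≤ 1/16` all weights are
  -- positive.
  have hac : ∀ i, |⟪w, c i⟫| ≤ 4 * (K * δ) := fun i => by
    refine (abs_real_inner_le_norm _ _).trans ?_
    have h1 : ‖w‖ ≤ 2 * ((√(n : ℝ))⁻¹ * K) := by
      refine hwn.trans ?_
      rw [div_le_iff₀ hκ0, hbn]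
      have h2 : (√(n : ℝ))⁻¹ * ‖G‖ ≤ (√(n : ℝ))⁻¹ * K := by gcongr
      have h3 : 0 ≤ (√(n : ℝ))⁻¹ * K := by positivity
      nlinarith
    calc ‖w‖ * ‖c i‖ ≤ 2 * ((√(n : ℝ))⁻¹ * K) * (2 * (δ * √n)) := by
          gcongr
          exact hcn i
      _ = 4 * (K * δ) := by field_simp; ring
  have hKδ : 0 ≤ K * δ := mul_nonneg hK0 hδ0
  let u : Fin n → ℝ := fun i => 1 - ⟪w, c i⟫
  have hupos : ∀ i, 0 < u i := fun i => by
    have := le_of_abs_le (hac i)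
    simp only [u]; linarith
  have hwc : ∑ i, ⟪w, c i⟫ = 0 := by rw [← inner_sum, hcsum, inner_zero_right]
  have hMw : ∑ i, ⟪w, c i⟫ • c i = (n : ℝ) • b := by
    rw [← hw, hMdef, smul_smul, mul_inv_cancel₀ hn'.ne', one_smul]
  have hu : u ∈ elWeights y := by
    refine ⟨fun i => (hupos i).le, ?_, ?_⟩
    · simp only [u, Finset.sum_sub_distrib, hwc]
      simp
    · have h1 : ∀ i, u i • y i = y i - ⟪w, c i⟫ • c i - ⟪w, c i⟫ • b := fun i => by
        simp only [u, c, sub_smul, one_smul, smul_sub]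
        abel
      simp only [h1, Finset.sum_sub_distrib, hMw, hsumy, ← Finset.sum_smul, hwc]
      simp
  have hup : 0 < ∏ i, u i := Finset.prod_pos fun i _ => hupos i
  have hpos : 0 < elRatio y := hup.trans_le (prod_le_elRatio hu)
  refine ⟨hpos, ?_⟩
  have hlog : Real.log (∏ i, u i) ≤ Real.log (elRatio y) :=
    Real.log_le_log hup (prod_le_elRatio hu)
  rw [Real.log_prod (fun i _ => (hupos i).ne')] at hlog
  have hterm : ∀ i, -(2 * Real.log (u i)) ≤
      2 * ⟪w, c i⟫ + (1 + 16 * (K * δ)) * ⟪w, c i⟫ ^ 2 := fun i => by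
    have h1 := neg_le_of_abs_le (abs_log_one_add_sub_le (x := -⟪w, c i⟫)
      (by rw [abs_neg]; exact (hac i).trans (by linarith)))
    rw [abs_neg, ← sub_eq_add_neg] at h1
    have h2 : |⟪w, c i⟫| ^ 3 ≤ 4 * (K * δ) * ⟪w, c i⟫ ^ 2 := by
      rw [← sq_abs ⟪w, c i⟫]
      calc |⟪w, c i⟫| ^ 3 = |⟪w, c i⟫| * |⟪w, c i⟫| ^ 2 := by ring
        _ ≤ _ := by gcongr; exact hac i
    simp only [u]
    nlinarith
  have hsum := Finset.sum_le_sum fun i (_ : i ∈ Finset.univ) => hterm i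
  rw [Finset.sum_neg_distrib, Finset.sum_add_distrib, ← Finset.mul_sum, ← Finset.mul_sum,
    ← Finset.mul_sum, hwc] at hsum
  -- The sum equals `n ⟪w, M w⟫ = n ⟪w, b⟫`, and `‖w‖ ≤ ‖b‖ / κ` with `n ‖b‖² = ‖G‖²`.
  have h1 : ∑ i, ⟪w, c i⟫ ^ 2 ≤ ‖G‖ ^ 2 / κ := by
    have h2 : ∑ i, ⟪w, c i⟫ ^ 2 = n * ⟪w, b⟫ := by
      have := hMq w
      rw [hw] at this
      rw [this, ← mul_assoc, mul_inv_cancel₀ hn'.ne', one_mul]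
    rw [h2]
    calc (n : ℝ) * ⟪w, b⟫ ≤ n * (‖b‖ / κ * ‖b‖) := by
          gcongr
          exact (real_inner_le_norm w b).trans (by gcongr)
      _ = n * (√n * √n)⁻¹ * (‖G‖ ^ 2 / κ) := by rw [hbn]; field_simp
      _ = _ := by rw [hss, mul_inv_cancel₀ hn'.ne', one_mul]
  have h2 := mul_le_mul_of_nonneg_left h1 (by linarith : 0 ≤ 1 + 16 * (K * δ))
  linarith

end EmpiricalLikelihood

/-! ### Deterministic asymptotics along a filter -/

section Asymptotics

variable {V : Type*} [NormedAddCommGroup V] [InnerProductSpace ℝ V]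
  {T : Type*} [NormedAddCommGroup T] [InnerProductSpace ℝ T]
  {ι : Type*} {l : Filter ι} {n : ι → ℕ}

/-- The conditions on an array of vectors under which its empirical likelihood statistic is
asymptotically quadratic: the entries are of smaller order than the square root of the sample size,
and the empirical second moment matrix tends to the identity. -/
structure IsELRegular (l : Filter ι) (n : ι → ℕ) (y : ∀ i, Fin (n i) → V) : Prop where
  tendsto_size : Tendsto n l atTop
  small : ∀ ε > 0, ∀ᶠ i in l, ∀ k, ‖y i k‖ ≤ ε * √(n i)
  quad : ∀ ε > 0, ∀ᶠ i in l, ∀ v, |(n i : ℝ)⁻¹ * ∑ k, ⟪v, y i k⟫ ^ 2 - ‖v‖ ^ 2| ≤ ε * ‖v‖ ^ 2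

lemma IsELRegular.mono {y : ∀ i, Fin (n i) → V} (h : IsELRegular l n y) {l' : Filter ι}
    (hl : l' ≤ l) : IsELRegular l' n y where
  tendsto_size := h.tendsto_size.mono_left hl
  small ε hε := hl (h.small ε hε)
  quad ε hε := hl (h.quad ε hε)

/-- The normalized sum of a finite family of vectors. -/
noncomputable def normSum {n : ℕ} (y : Fin n → V) : V := (√n)⁻¹ • ∑ k, y k

/-- The two finite-sample bounds are used with `δ = η = ε`; their gap from `‖G‖²` is at most an
explicit function of `ε`, continuous and zero at `ε = 0`. -/
theorem IsELRegular.tendsto_elRatio [FiniteDimensional ℝ V] {y : ∀ i, Fin (n i) → V}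
    (h : IsELRegular l n y) {K : ℝ} (hG : ∀ᶠ i in l, ‖normSum (y i)‖ ≤ K) :
    (∀ᶠ i in l, 0 < elRatio (y i)) ∧
      Tendsto (fun i => -2 * Real.log (elRatio (y i)) - ‖normSum (y i)‖ ^ 2) l (𝓝 0) := by
  have key : ∀ ε > 0, K * ε ≤ 1 / 16 → ε ≤ 1 / 4 → ∀ᶠ i in l, 0 < elRatio (y i) ∧
      |-2 * Real.log (elRatio (y i)) - ‖normSum (y i)‖ ^ 2| ≤
        K ^ 2 * ((1 + 4 * (K * ε)) * (1 + ε) - 1 + ((1 + 16 * (K * ε)) / (1 - 2 * ε) - 1)) := by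
    intro ε hε hKε hε4
    have hKn : ∀ᶠ i in l, K ^ 2 / (n i : ℝ) ≤ ε :=
      ((tendsto_const_nhds.div_atTop tendsto_natCast_atTop_atTop).comp
        h.tendsto_size).eventually_le_const hε
    filter_upwards [h.small ε hε, h.quad ε hε, hG, hKn, h.tendsto_size.eventually_gt_atTop 0]
      with i h1 h2 h3 h4 h5
    have hK0 : 0 ≤ K := (norm_nonneg _).trans h3
    have hKε0 : 0 ≤ K * ε := mul_nonneg hK0 hε.le
    obtain ⟨hpos, hup⟩ := neg_two_log_elRatio_le (η := ε) h5 h1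
      (fun v => by linarith [neg_le_of_abs_le (h2 v)]) rfl h3 hKε (by linarith)
    have hlow := le_neg_two_log_elRatio (η := ε) h5 h1
      (fun v => by linarith [le_of_abs_le (h2 v)]) rfl h3 (by linarith) hpos
    refine ⟨hpos, ?_⟩
    change _ ≤ (1 + 16 * (K * ε)) * (‖normSum (y i)‖ ^ 2 / _) at hup
    change 2 * ‖normSum (y i)‖ ^ 2 - _ * (_ * ‖normSum (y i)‖ ^ 2) ≤ _ at hlow
    set g := ‖normSum (y i)‖ ^ 2 with hg
    have hg0 : 0 ≤ g := sq_nonneg _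
    have hgK : g ≤ K ^ 2 := by rw [hg]; gcongr
    have hA : 0 ≤ (1 + 4 * (K * ε)) * (1 + ε) - 1 := by nlinarith
    have hB : 0 ≤ (1 + 16 * (K * ε)) / (1 - 2 * ε) - 1 := by
      rw [sub_nonneg, le_div_iff₀ (by linarith)]; linarith
    have h6 : g / (1 - ε - K ^ 2 / (n i : ℝ)) ≤ g / (1 - 2 * ε) :=
      div_le_div_of_nonneg_left hg0 (by linarith) (by linarith)
    have h7 : -2 * Real.log (elRatio (y i)) - g ≤
        g * ((1 + 16 * (K * ε)) / (1 - 2 * ε) - 1) := by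
      have := hup.trans (mul_le_mul_of_nonneg_left h6 (by linarith))
      calc _ ≤ (1 + 16 * (K * ε)) * (g / (1 - 2 * ε)) - g := by linarith
        _ = _ := by ring
    have h8 := mul_le_mul_of_nonneg_right hgK hA
    have h9 := mul_le_mul_of_nonneg_right hgK hB
    have hKA := mul_nonneg (sq_nonneg K) hA
    have hKB := mul_nonneg (sq_nonneg K) hB
    rw [abs_le]
    constructor <;> nlinarith
  have hcont : ContinuousAt (fun ε : ℝ => K ^ 2 * ((1 + 4 * (K * ε)) * (1 + ε) - 1 +
      ((1 + 16 * (K * ε)) / (1 - 2 * ε) - 1))) 0 := by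
    have : ContinuousAt (fun ε : ℝ => (1 + 16 * (K * ε)) / (1 - 2 * ε)) 0 :=
      ContinuousAt.div (by fun_prop) (by fun_prop) (by norm_num)
    fun_prop
  have ev (r : ℝ) (hr : 0 < r) : ∀ᶠ ε in 𝓝[>] (0 : ℝ), 0 < ε ∧ K * ε ≤ 1 / 16 ∧ ε ≤ 1 / 4 ∧
      K ^ 2 * ((1 + 4 * (K * ε)) * (1 + ε) - 1 +
      ((1 + 16 * (K * ε)) / (1 - 2 * ε) - 1)) ≤ r := by
    have e1 : ∀ᶠ ε in 𝓝 (0 : ℝ), K * ε ≤ 1 / 16 :=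
      ((continuous_const.mul continuous_id).tendsto' (0 : ℝ) 0 (by simp)).eventually_le_const
        (by norm_num)
    have e2 : ∀ᶠ ε in 𝓝 (0 : ℝ), ε ≤ 1 / 4 :=
      tendsto_id.eventually_le_const (by norm_num)
    have e3 := hcont.tendsto.eventually_le_const (u := r) (by norm_num [hr])
    filter_upwards [self_mem_nhdsWithin, nhdsWithin_le_nhds e1, nhdsWithin_le_nhds e2,
      nhdsWithin_le_nhds e3] with ε h1 h2 h3 h4 using ⟨h1, h2, h3, h4⟩
  refine ⟨?_, ?_⟩
  · obtain ⟨ε, h1, h2, h3, -⟩ := (ev 1 one_pos).exists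
    exact (key ε h1 h2 h3).mono fun i hi => hi.1
  · rw [Metric.tendsto_nhds]
    intro r hr
    obtain ⟨ε, h1, h2, h3, h4⟩ := (ev (r / 2) (half_pos hr)).exists
    filter_upwards [key ε h1 h2 h3] with i hi
    rw [Real.dist_eq, sub_zero]
    linarith [hi.2]

/-- A perturbation that vanishes in mean square does not affect the limiting second moment: the
cross term is absorbed by a weighted arithmetic-geometric mean inequality. -/
lemma IsELRegular.add {y e : ∀ i, Fin (n i) → V} (h : IsELRegular l n y)
    (he : ∀ ε > 0, ∀ᶠ i in l, ∀ k, ‖e i k‖ ≤ ε * √(n i))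
    (he2 : ∀ ε > 0, ∀ᶠ i in l, (n i : ℝ)⁻¹ * ∑ k, ‖e i k‖ ^ 2 ≤ ε) :
    IsELRegular l n (fun i k => y i k + e i k) where
  tendsto_size := h.tendsto_size
  small ε hε := by
    filter_upwards [h.small (ε / 2) (half_pos hε), he (ε / 2) (half_pos hε)] with i h1 h2 k
    refine (norm_add_le _ _).trans ?_
    linarith [h1 k, h2 k]
  quad ε hε := by
    -- The errors, relative to `‖v‖²`, are `s` from `A`, `s² ≤ s` from `B` and `3 s` from the cross
    -- term `C`, in total `5 s`.
    set s := min (ε / 5) 1 with hs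
    have hs0 : 0 < s := lt_min (by linarith) one_pos
    have hs1 : s ≤ 1 := min_le_right _ _
    have hs2 : 5 * s ≤ ε := by linarith [min_le_left (ε / 5) 1]
    filter_upwards [h.quad s hs0, he2 (s ^ 2) (by positivity)] with i h1 h2 v
    have hn0 : (0 : ℝ) ≤ (n i : ℝ)⁻¹ := by positivity
    set A := (n i : ℝ)⁻¹ * ∑ k, ⟪v, y i k⟫ ^ 2 with hA
    set B := (n i : ℝ)⁻¹ * ∑ k, ⟪v, e i k⟫ ^ 2 with hB
    set C := (n i : ℝ)⁻¹ * ∑ k, 2 * (⟪v, y i k⟫ * ⟪v, e i k⟫) with hC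
    have hABC : (n i : ℝ)⁻¹ * ∑ k, ⟪v, y i k + e i k⟫ ^ 2 = A + B + C := by
      rw [hA, hB, hC, ← mul_add, ← mul_add, ← Finset.sum_add_distrib, ← Finset.sum_add_distrib]
      congr 1
      refine Finset.sum_congr rfl fun k _ => ?_
      rw [inner_add_right]; ring
    have hBle : B ≤ s ^ 2 * ‖v‖ ^ 2 := by
      calc B ≤ (n i : ℝ)⁻¹ * ∑ k, ‖v‖ ^ 2 * ‖e i k‖ ^ 2 := by
            rw [hB]
            gcongr with k
            rw [← mul_pow, ← sq_abs]
            gcongr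
            exact abs_real_inner_le_norm _ _
        _ = ((n i : ℝ)⁻¹ * ∑ k, ‖e i k‖ ^ 2) * ‖v‖ ^ 2 := by rw [← Finset.mul_sum]; ring
        _ ≤ _ := by gcongr
    have hB0 : 0 ≤ B := mul_nonneg hn0 (Finset.sum_nonneg fun k _ => sq_nonneg _)
    have hCle : s * |C| ≤ s ^ 2 * A + B := by
      have h3 : |C| ≤ (n i : ℝ)⁻¹ * ∑ k, |2 * (⟪v, y i k⟫ * ⟪v, e i k⟫)| := by
        rw [hC, abs_mul, abs_of_nonneg hn0]
        gcongr
        exact Finset.abs_sum_le_sum_abs _ _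
      calc s * |C| ≤ s * ((n i : ℝ)⁻¹ * ∑ k, |2 * (⟪v, y i k⟫ * ⟪v, e i k⟫)|) := by gcongr
        _ = (n i : ℝ)⁻¹ * ∑ k, s * |2 * (⟪v, y i k⟫ * ⟪v, e i k⟫)| := by
            rw [← Finset.mul_sum]; ring
        _ ≤ (n i : ℝ)⁻¹ * ∑ k, (s ^ 2 * ⟪v, y i k⟫ ^ 2 + ⟪v, e i k⟫ ^ 2) := by
            gcongr with k
            have h4 := two_mul_le_add_sq (s * |⟪v, y i k⟫|) |⟪v, e i k⟫|
            rw [mul_pow, sq_abs, sq_abs] at h4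
            rw [abs_mul, abs_mul, abs_two]
            linarith
        _ = _ := by rw [Finset.sum_add_distrib, ← Finset.mul_sum, mul_add, hA, hB]; ring
    have hA1 := h1 v
    have hAle : A ≤ 2 * ‖v‖ ^ 2 := by
      have := le_of_abs_le hA1
      nlinarith [sq_nonneg ‖v‖]
    have hC2 : |C| ≤ 3 * s * ‖v‖ ^ 2 := by
      refine le_of_mul_le_mul_left (hCle.trans ?_) hs0
      nlinarith [mul_le_mul_of_nonneg_left hAle (sq_nonneg s)]
    rw [hABC]
    have hv0 := sq_nonneg ‖v‖
    have h5 : s ^ 2 * ‖v‖ ^ 2 ≤ s * ‖v‖ ^ 2 := by gcongr; nlinarith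
    have h6 : 5 * s * ‖v‖ ^ 2 ≤ ε * ‖v‖ ^ 2 := by gcongr
    have h7 := abs_le.1 hA1
    have h8 := abs_le.1 hC2
    rw [abs_le]
    constructor <;> linarith [h7.1, h7.2, h8.1, h8.2]

/-- A family of perturbations `e i t`, for `t` in the ball of radius `ρ i`, that is uniformly
asymptotically linear in `t` with derivative `D` and dominated by `h i k * ‖t‖`. -/
structure IsELPerturbation (l : Filter ι) (n : ι → ℕ) (e : ∀ i, T → Fin (n i) → V)
    (h : ∀ i, Fin (n i) → ℝ) (D : T →L[ℝ] V) (ρ : ι → ℝ) : Prop where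
  norm_le : ∀ᶠ i in l, ∀ t, ‖t‖ ≤ ρ i → ∀ k, ‖e i t k‖ ≤ h i k * ‖t‖
  nonneg : ∀ᶠ i in l, ∀ k, 0 ≤ h i k
  small : ∀ ε > 0, ∀ᶠ i in l, ∀ k, h i k ≤ ε * n i
  mean_le : ∃ C, ∀ᶠ i in l, (n i : ℝ)⁻¹ * ∑ k, h i k ≤ C
  linear : ∀ ε > 0, ∀ᶠ i in l, ∀ t, ‖t‖ ≤ ρ i →
    ‖(n i : ℝ)⁻¹ • ∑ k, e i t k - D t‖ ≤ ε * ‖t‖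
  tendsto_radius : Tendsto ρ l atTop

lemma IsELPerturbation.mono {e : ∀ i, T → Fin (n i) → V} {h : ∀ i, Fin (n i) → ℝ}
    {D : T →L[ℝ] V} {ρ : ι → ℝ} (H : IsELPerturbation l n e h D ρ) {l' : Filter ι}
    (hl : l' ≤ l) : IsELPerturbation l' n e h D ρ where
  norm_le := hl H.norm_le
  nonneg := hl H.nonneg
  small ε hε := hl (H.small ε hε)
  mean_le := H.mean_le.imp fun _ h => hl h
  linear ε hε := hl (H.linear ε hε)
  tendsto_radius := H.tendsto_radius.mono_left hl

/-- The array `y` perturbed by `e` at the local parameter `t`. -/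
noncomputable def elPerturb {S : Type*} {n : ℕ} (y : Fin n → V) (e : S → Fin n → V)
    (t : S) : Fin n → V :=
  fun k => y k + (√n)⁻¹ • e t k

lemma normSum_elPerturb {S : Type*} {n : ℕ} (y : Fin n → V) (e : S → Fin n → V) (t : S) :
    normSum (elPerturb y e t) = normSum y + (n : ℝ)⁻¹ • ∑ k, e t k := by
  simp only [normSum, elPerturb, Finset.sum_add_distrib, smul_add, ← Finset.smul_sum, smul_smul]
  rw [← mul_inv, Real.mul_self_sqrt (Nat.cast_nonneg n)]

lemma sum_sq_le_mul_sum {n : ℕ} {a : Fin n → ℝ} {b : ℝ} (h0 : ∀ k, 0 ≤ a k) (hb : ∀ k, a k ≤ b) :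
    ∑ k, a k ^ 2 ≤ b * ∑ k, a k := by
  rw [Finset.mul_sum]
  refine Finset.sum_le_sum fun k _ => ?_
  rw [sq]
  exact mul_le_mul_of_nonneg_right (hb k) (h0 k)

section Perturbation

variable {e : ∀ i, T → Fin (n i) → V} {h : ∀ i, Fin (n i) → ℝ} {D : T →L[ℝ] V} {ρ : ι → ℝ}
  {y : ∀ i, Fin (n i) → V}

/-- Only a first-moment bound on `h` is available; a maximum of order `o(n)` times a sum of order
`O(n)` supplies the missing second moment. -/
lemma IsELPerturbation.sum_sq_le (H : IsELPerturbation l n e h D ρ) (hn : Tendsto n l atTop) :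
    ∀ ε > 0, ∀ᶠ i in l, ∑ k, h i k ^ 2 ≤ ε * (n i : ℝ) ^ 2 := by
  intro ε hε
  obtain ⟨C, hC⟩ := H.mean_le
  set s := ε / (|C| + 1) with hs
  have hs0 : 0 < s := by positivity
  filter_upwards [H.nonneg, H.small s hs0, hC, hn.eventually_gt_atTop 0] with i h1 h2 h3 h4
  have hn0 : (0 : ℝ) < n i := by exact_mod_cast h4
  have h5 : ∑ k, h i k ≤ C * n i := by
    rwa [inv_mul_le_iff₀ hn0, mul_comm] at h3
  calc ∑ k, h i k ^ 2 ≤ s * n i * ∑ k, h i k := sum_sq_le_mul_sum h1 h2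
    _ ≤ s * n i * ((|C| + 1) * n i) := by
        gcongr
        refine h5.trans ?_
        gcongr
        linarith [le_abs_self C]
    _ = ε * (n i : ℝ) ^ 2 := by rw [hs]; field_simp

/-- For bounded `t` the added terms are at most a constant times `h / √n`: their maximum is `o(√n)`,
and their mean square is of order `n⁻² ∑ h² = o(1)`. -/
lemma IsELRegular.perturb (hy : IsELRegular l n y) (H : IsELPerturbation l n e h D ρ) {t : ι → T}
    {B : ℝ} (htρ : ∀ᶠ i in l, ‖t i‖ ≤ ρ i) (htB : ∀ᶠ i in l, ‖t i‖ ≤ B) :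
    IsELRegular l n (fun i => elPerturb (y i) (e i) (t i)) := by
  have hB1 : 0 < |B| + 1 := by positivity
  have hle : ∀ᶠ i in l, ∀ k, ‖(√(n i : ℝ))⁻¹ • e i (t i) k‖ ≤
      (√(n i : ℝ))⁻¹ * (h i k * (|B| + 1)) := by
    filter_upwards [H.norm_le, htρ, htB, H.nonneg] with i h1 h2 h3 h4 k
    rw [norm_smul, Real.norm_of_nonneg (by positivity)]
    gcongr
    refine (h1 _ h2 k).trans ?_
    have := h4 k
    gcongr
    linarith [le_abs_self B]
  refine hy.add (fun ε hε => ?_) (fun ε hε => ?_)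
  · filter_upwards [hle, H.small (ε / (|B| + 1)) (by positivity),
      hy.tendsto_size.eventually_gt_atTop 0] with i h1 h2 h3 k
    have hn0 : (0 : ℝ) < n i := by exact_mod_cast h3
    have hsn : 0 < √(n i : ℝ) := Real.sqrt_pos.2 hn0
    refine (h1 k).trans ?_
    calc (√(n i : ℝ))⁻¹ * (h i k * (|B| + 1))
        ≤ (√(n i : ℝ))⁻¹ * (ε / (|B| + 1) * (√(n i : ℝ) * √(n i : ℝ)) * (|B| + 1)) := by
          rw [Real.mul_self_sqrt hn0.le]
          gcongr
          exact h2 k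
      _ = ε * √(n i) := by field_simp
  · filter_upwards [hle, H.sum_sq_le hy.tendsto_size (ε / (|B| + 1) ^ 2) (by positivity),
      hy.tendsto_size.eventually_gt_atTop 0, H.nonneg] with i h1 h2 h3 h4
    have hn0 : (0 : ℝ) < n i := by exact_mod_cast h3
    calc (n i : ℝ)⁻¹ * ∑ k, ‖(√(n i : ℝ))⁻¹ • e i (t i) k‖ ^ 2
        ≤ (n i : ℝ)⁻¹ * ∑ k, ((√(n i : ℝ))⁻¹ * (h i k * (|B| + 1))) ^ 2 := by
          gcongr with k
          exact h1 k
      _ = (n i : ℝ)⁻¹ * ((n i : ℝ)⁻¹ * (|B| + 1) ^ 2 * ∑ k, h i k ^ 2) := by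
          congr 1
          rw [Finset.mul_sum]
          refine Finset.sum_congr rfl fun k _ => ?_
          rw [mul_pow, mul_pow, inv_pow, Real.sq_sqrt hn0.le]
          ring
      _ ≤ (n i : ℝ)⁻¹ * ((n i : ℝ)⁻¹ * (|B| + 1) ^ 2 * (ε / (|B| + 1) ^ 2 * (n i : ℝ) ^ 2)) := by
          gcongr
      _ = ε := by field_simp

/-- The perturbed array is again regular, and for bounded `t` its normalized sum differs from `G + D
t` by `o(1)`; both are bounded, so their squared norms also agree up to `o(1)`. -/
lemma IsELRegular.tendsto_elRatio_perturb [FiniteDimensional ℝ V] (hy : IsELRegular l n y)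
    (H : IsELPerturbation l n e h D ρ) {t : ι → T} {B K : ℝ} (htρ : ∀ᶠ i in l, ‖t i‖ ≤ ρ i)
    (htB : ∀ᶠ i in l, ‖t i‖ ≤ B) (hG : ∀ᶠ i in l, ‖normSum (y i)‖ ≤ K) :
    (∀ᶠ i in l, 0 < elRatio (elPerturb (y i) (e i) (t i))) ∧
      Tendsto (fun i => -2 * Real.log (elRatio (elPerturb (y i) (e i) (t i))) -
        ‖normSum (y i) + D (t i)‖ ^ 2) l (𝓝 0) := by
  have hdiff : Tendsto (fun i => normSum (elPerturb (y i) (e i) (t i)) -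
      (normSum (y i) + D (t i))) l (𝓝 0) := by
    rw [Metric.tendsto_nhds]
    intro ε hε
    filter_upwards [H.linear (ε / (2 * (|B| + 1))) (by positivity), htρ, htB] with i h1 h2 h3
    rw [dist_zero_right, normSum_elPerturb, add_sub_add_left_eq_sub]
    refine (h1 _ h2).trans_lt ?_
    calc ε / (2 * (|B| + 1)) * ‖t i‖ ≤ ε / (2 * (|B| + 1)) * (|B| + 1) := by
          gcongr
          linarith [le_abs_self B]
      _ = ε / 2 := by field_simp
      _ < ε := half_lt_self hε
  have hbd : ∀ᶠ i in l, ‖normSum (y i) + D (t i)‖ ≤ K + ‖D‖ * |B| := by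
    filter_upwards [htB, hG] with i h1 h2
    refine (norm_add_le _ _).trans (add_le_add h2 ((D.le_opNorm _).trans ?_))
    gcongr
    exact h1.trans (le_abs_self B)
  set K' := K + ‖D‖ * |B| with hK'
  have hnd := hdiff.norm
  rw [norm_zero] at hnd
  have hbd2 : ∀ᶠ i in l, ‖normSum (elPerturb (y i) (e i) (t i))‖ ≤ K' + 1 := by
    filter_upwards [hbd, hnd.eventually_le_const one_pos] with i h1 h2
    have := norm_add_le (normSum (y i) + D (t i))
      (normSum (elPerturb (y i) (e i) (t i)) - (normSum (y i) + D (t i)))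
    rw [add_sub_cancel] at this
    linarith
  obtain ⟨hpos, hlim⟩ := (hy.perturb H htρ htB).tendsto_elRatio hbd2
  refine ⟨hpos, ?_⟩
  have hsq : Tendsto (fun i => ‖normSum (elPerturb (y i) (e i) (t i))‖ ^ 2 -
      ‖normSum (y i) + D (t i)‖ ^ 2) l (𝓝 0) := by
    have h0 : Tendsto (fun i => ‖normSum (elPerturb (y i) (e i) (t i)) -
        (normSum (y i) + D (t i))‖ * (2 * K' + 1)) l (𝓝 0) := by
      simpa using hnd.mul_const (2 * K' + 1)
    refine squeeze_zero_norm' ?_ h0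
    filter_upwards [hbd, hbd2] with i h1 h2
    have h3 := abs_norm_sub_norm_le (normSum (elPerturb (y i) (e i) (t i)))
      (normSum (y i) + D (t i))
    rw [sq_sub_sq, Real.norm_eq_abs, abs_mul, mul_comm]
    have h4 : |‖normSum (elPerturb (y i) (e i) (t i))‖ + ‖normSum (y i) + D (t i)‖| ≤
        2 * K' + 1 := by
      rw [abs_of_nonneg (by positivity)]; linarith
    gcongr
  simpa using hlim.add hsq

/-- Weights with a bounded empirical likelihood statistic are close to `1` in `ℓ²`. -/
lemma sum_sub_one_sq_le {m : ℕ} {u : Fin m → ℝ} {B : ℝ} (hu : ∀ k, 0 ≤ u k)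
    (hsum : ∑ k, u k = m) (hpos : 0 < ∏ k, u k) (hB : -2 * Real.log (∏ k, u k) ≤ 2 * B ^ 2)
    (hB0 : 0 ≤ B) : ∑ k, (u k - 1) ^ 2 ≤ ((2 + B) * B) ^ 2 := by
  have hup : ∀ k, 0 < u k := fun k =>
    (hu k).lt_of_ne' (Finset.prod_ne_zero_iff.1 hpos.ne' k (Finset.mem_univ k))
  rw [Real.log_prod (fun k _ => (hup k).ne')] at hB
  have h1 : ∑ k, (√(u k) - 1) ^ 2 ≤ B ^ 2 := by
    -- Equivalent to `log √u ≤ √u - 1`. Summed over `k`, the linear terms cancel and a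
    -- Hellinger-type distance is bounded by the statistic.
    have h2 : ∀ k, (√(u k) - 1) ^ 2 ≤ u k - 1 - Real.log (u k) := fun k => by
      have h3 := Real.log_le_sub_one_of_pos (Real.sqrt_pos.2 (hup k))
      rw [Real.log_sqrt (hu k)] at h3
      have h4 := Real.sq_sqrt (hu k)
      nlinarith
    have h5 := Finset.sum_le_sum fun k (_ : k ∈ Finset.univ) => h2 k
    rw [Finset.sum_sub_distrib, Finset.sum_sub_distrib, hsum] at h5
    simp only [Finset.sum_const, Finset.card_univ, Fintype.card_fin, nsmul_eq_mul, mul_one,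
      sub_self] at h5
    linarith
  have h6 : ∀ k, √(u k) + 1 ≤ 2 + B := fun k => by
    have h7 : (√(u k) - 1) ^ 2 ≤ B ^ 2 :=
      (Finset.single_le_sum (f := fun k => (√(u k) - 1) ^ 2) (fun j _ => sq_nonneg _)
        (Finset.mem_univ k)).trans h1
    linarith [abs_le_of_sq_le_sq' h7 hB0 |>.2]
  calc ∑ k, (u k - 1) ^ 2 ≤ ∑ k, (2 + B) ^ 2 * (√(u k) - 1) ^ 2 := by
        refine Finset.sum_le_sum fun k _ => ?_
        have h8 : u k - 1 = (√(u k) + 1) * (√(u k) - 1) := by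
          have := Real.sq_sqrt (hu k); linarith
        rw [h8, mul_pow]
        exact mul_le_mul_of_nonneg_right (pow_le_pow_left₀ (by positivity) (h6 k) 2)
          (sq_nonneg _)
    _ ≤ (2 + B) ^ 2 * B ^ 2 := by rw [← Finset.mul_sum]; gcongr
    _ = _ := by ring

/-- Local parameters whose empirical likelihood statistic stays bounded are bounded. -/
lemma IsELRegular.exists_bound (hy : IsELRegular l n y) (H : IsELPerturbation l n e h D ρ)
    {c : ℝ} (hc : 0 < c) (hD : ∀ t, c * ‖t‖ ≤ ‖D t‖) {t : ι → T} {B K : ℝ}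
    (htρ : ∀ᶠ i in l, ‖t i‖ ≤ ρ i) (hG : ∀ᶠ i in l, ‖normSum (y i)‖ ≤ K)
    (hpos : ∀ᶠ i in l, 0 < elRatio (elPerturb (y i) (e i) (t i)))
    (hB : ∀ᶠ i in l, -2 * Real.log (elRatio (elPerturb (y i) (e i) (t i))) ≤ B) :
    ∃ B', ∀ᶠ i in l, ‖t i‖ ≤ B' := by
  set b := √(|B| / 2) with hb
  have hb0 : 0 ≤ b := Real.sqrt_nonneg _
  have hbB : B ≤ 2 * b ^ 2 := by
    rw [hb, Real.sq_sqrt (by positivity)]; linarith [le_abs_self B]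
  set A := (2 + b) * b with hA
  have hA0 : 0 ≤ A := by positivity
  -- Chosen so that Cauchy–Schwarz with `∑ h² ≤ s n²` produces the factor `A c / (4 (A + 1)) ≤ c /
  -- 4`.
  set s := (c / (4 * (A + 1))) ^ 2 with hs
  have hs0 : 0 < s := by positivity
  refine ⟨(K + 2 * A) * (2 / c), ?_⟩
  filter_upwards [htρ, hG, hpos, hB, hy.quad 1 one_pos, H.norm_le, H.linear (c / 4) (by positivity),
    H.sum_sq_le hy.tendsto_size s hs0, hy.tendsto_size.eventually_gt_atTop 0, H.nonneg]
    with i h1 h2 h3 h4 h5 h6 h7 h8 h9 h10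
  have hn0 : (0 : ℝ) < n i := by exact_mod_cast h9
  have hsn : 0 < √(n i : ℝ) := Real.sqrt_pos.2 hn0
  have hss : √(n i : ℝ) * √(n i : ℝ) = n i := Real.mul_self_sqrt hn0.le
  obtain ⟨u, hu, hue⟩ := exists_prod_eq_elRatio h3
  have ha := sum_sub_one_sq_le hu.1 hu.2.1 (hue ▸ h3) (by rw [hue]; exact h4.trans hbB) hb0
  rw [← hA] at ha
  -- Because the weighted sum vanishes, the unweighted one is carried entirely by the deviations `u
  -- k - 1`, which are bounded in `ℓ²`.
  have hzero : normSum (elPerturb (y i) (e i) (t i)) =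
      -(√(n i : ℝ))⁻¹ • ∑ k, (u k - 1) • elPerturb (y i) (e i) (t i) k := by
    simp only [sub_smul, one_smul, Finset.sum_sub_distrib, hu.2.2, normSum]
    simp
  have hsumle : ‖∑ k, (u k - 1) • elPerturb (y i) (e i) (t i) k‖ ≤
      2 * A * √(n i) + √(n i) * (c / 4 * ‖t i‖) := by
    have hp : ∀ k, (u k - 1) • elPerturb (y i) (e i) (t i) k =
        (u k - 1) • y i k + (√(n i : ℝ))⁻¹ • ((u k - 1) • e i (t i) k) := fun k => by
      simp only [elPerturb, smul_add]
      rw [smul_comm]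
    simp only [hp, Finset.sum_add_distrib, ← Finset.smul_sum]
    refine (norm_add_le _ _).trans (add_le_add ?_ ?_)
    · set w := ∑ k, (u k - 1) • y i k with hw
      rcases (norm_nonneg w).eq_or_lt with h0 | h0
      · rw [← h0]; positivity
      have hww : ‖w‖ ^ 2 ≤ A * (2 * √(n i) * ‖w‖) := by
        rw [← real_inner_self_eq_norm_sq]
        nth_rewrite 2 [hw]
        rw [inner_sum]
        simp only [real_inner_smul_right]
        refine (Real.sum_mul_le_sqrt_mul_sqrt _ _ _).trans ?_
        gcongr
        · exact Real.sqrt_le_iff.2 ⟨hA0, ha⟩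
        · refine Real.sqrt_le_iff.2 ⟨by positivity, ?_⟩
          have h11 := le_of_abs_le (h5 w)
          have h12 : (n i : ℝ)⁻¹ * ∑ k, ⟪w, y i k⟫ ^ 2 ≤ 4 * ‖w‖ ^ 2 := by nlinarith
          rw [inv_mul_le_iff₀ hn0] at h12
          rw [mul_pow, mul_pow, sq (√(n i : ℝ)), hss]
          linarith
      rw [sq] at hww
      have : ‖w‖ * ‖w‖ ≤ 2 * A * √(n i) * ‖w‖ := by linarith
      exact le_of_mul_le_mul_right this h0
    · rw [norm_smul, Real.norm_of_nonneg (by positivity)]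
      have h11 : ‖∑ k, (u k - 1) • e i (t i) k‖ ≤ n i * (c / 4) * ‖t i‖ := by
        calc ‖∑ k, (u k - 1) • e i (t i) k‖ ≤ ∑ k, |u k - 1| * (h i k * ‖t i‖) := by
              refine norm_sum_le_of_le _ fun k _ => ?_
              rw [norm_smul, Real.norm_eq_abs]
              gcongr
              exact h6 _ h1 k
          _ = (∑ k, |u k - 1| * h i k) * ‖t i‖ := by
              rw [Finset.sum_mul]
              exact Finset.sum_congr rfl fun k _ => by ring
          _ ≤ (A * (c / (4 * (A + 1)) * n i)) * ‖t i‖ := by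
              gcongr
              refine (Real.sum_mul_le_sqrt_mul_sqrt _ _ _).trans ?_
              gcongr
              · refine Real.sqrt_le_iff.2 ⟨hA0, ?_⟩
                simpa only [sq_abs] using ha
              · refine Real.sqrt_le_iff.2 ⟨by positivity, ?_⟩
                rw [mul_pow]; exact h8
          _ ≤ _ := by
              have h12 : A * (c / (4 * (A + 1))) ≤ c / 4 := by
                rw [mul_div_assoc', div_le_div_iff₀ (by positivity) (by positivity)]
                nlinarith
              refine mul_le_mul_of_nonneg_right ?_ (norm_nonneg _)
              nlinarith
      calc (√(n i : ℝ))⁻¹ * ‖∑ k, (u k - 1) • e i (t i) k‖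
          ≤ (√(n i : ℝ))⁻¹ * (√(n i : ℝ) * √(n i : ℝ) * (c / 4) * ‖t i‖) := by
            rw [hss]; gcongr
        _ = _ := by field_simp
  have h13 : ‖normSum (elPerturb (y i) (e i) (t i))‖ ≤ 2 * A + c / 4 * ‖t i‖ := by
    rw [hzero, norm_smul, norm_neg, norm_inv, Real.norm_of_nonneg hsn.le, inv_mul_le_iff₀ hsn]
    linarith
  rw [normSum_elPerturb] at h13
  have h14 := h7 _ h1
  have h15 := hD (t i)
  have h16 : ‖D (t i)‖ ≤ ‖normSum (y i) + (n i : ℝ)⁻¹ • ∑ k, e i (t i) k‖ + ‖normSum (y i)‖ +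
      ‖(n i : ℝ)⁻¹ • ∑ k, e i (t i) k - D (t i)‖ := by
    have : D (t i) = (normSum (y i) + (n i : ℝ)⁻¹ • ∑ k, e i (t i) k) - normSum (y i) -
      ((n i : ℝ)⁻¹ • ∑ k, e i (t i) k - D (t i)) := by abel
    nth_rewrite 1 [this]
    exact (norm_sub_le _ _).trans (add_le_add_left (norm_sub_le _ _) _)
  -- Of the lower bound `c ‖t‖`, one quarter is lost to the weighted perturbation and one quarter to
  -- the linearization error; half survives.
  have h17 : c / 2 * ‖t i‖ ≤ K + 2 * A := by linarith
  calc ‖t i‖ = c / 2 * ‖t i‖ * (2 / c) := by field_simp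
    _ ≤ _ := by gcongr

/-- The empirical likelihood ratio statistic for the local parameter `0` is asymptotically the
squared length of the projection of the normalized sum onto the range of the derivative. -/
theorem IsELRegular.tendsto_log_ratio [FiniteDimensional ℝ V] [FiniteDimensional ℝ T]
    (hy : IsELRegular l n y) (H : IsELPerturbation l n e h D ρ)
    (hD : Function.Injective D) {t : ι → T} {K : ℝ}
    (htρ : ∀ᶠ i in l, ‖t i‖ ≤ ρ i) (hG : ∀ᶠ i in l, ‖normSum (y i)‖ ≤ K)
    (hmax : ∀ᶠ i in l, ∀ s, ‖s‖ ≤ ρ i →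
      elRatio (elPerturb (y i) (e i) s) ≤ elRatio (elPerturb (y i) (e i) (t i))) :
    Tendsto (fun i => -2 * Real.log (elRatio (y i) /
      elRatio (elPerturb (y i) (e i) (t i))) -
        ‖D.range.starProjection (normSum (y i))‖ ^ 2) l (𝓝 0) := by
  obtain ⟨C, hC0, hC⟩ := D.toLinearMap.exists_antilipschitzWith (LinearMap.ker_eq_bot.2 hD)
  have hC0' : (0 : ℝ) < C := by exact_mod_cast hC0
  have hDc : ∀ t, (C : ℝ)⁻¹ * ‖t‖ ≤ ‖D t‖ := fun s => by
    rw [inv_mul_le_iff₀ hC0']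
    have := hC.le_mul_dist s 0
    simpa using this
  obtain ⟨hpos0, hlim0⟩ := hy.tendsto_elRatio hG
  have hy0 : ∀ᶠ i in l, elRatio (y i) ≤ elRatio (elPerturb (y i) (e i) (t i)) := by
    filter_upwards [hmax, H.norm_le, H.tendsto_radius.eventually_ge_atTop 0] with i h1 h2 h3
    have h4 : elPerturb (y i) (e i) 0 = y i := by
      funext k
      have : e i 0 k = 0 := by simpa using h2 0 (by simpa using h3) k
      simp [elPerturb, this]
    have := h1 0 (by simpa using h3)
    rwa [h4] at this
  have hpos : ∀ᶠ i in l, 0 < elRatio (elPerturb (y i) (e i) (t i)) := by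
    filter_upwards [hpos0, hy0] with i h1 h2 using h1.trans_le h2
  obtain ⟨B, htB⟩ := hy.exists_bound H (B := K ^ 2 + 1) (inv_pos.2 hC0') hDc htρ hG hpos (by
    filter_upwards [hpos0, hy0, hlim0.eventually_le_const one_pos, hG] with i h1 h2 h3 h4
    have h5 := Real.log_le_log h1 h2
    have h6 : ‖normSum (y i)‖ ^ 2 ≤ K ^ 2 := by gcongr
    linarith)
  obtain ⟨-, hlim1⟩ := hy.tendsto_elRatio_perturb H htρ htB hG
  set S := D.range with hS
  -- The competitor `s` minimizes `‖G + D s‖`; injectivity of `D` keeps it bounded, hence eventually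
  -- inside the growing ball.
  have hex : ∀ i, ∃ s, D s = -S.starProjection (normSum (y i)) := fun i =>
    S.neg_mem (S.starProjection_apply_mem (normSum (y i)))
  choose s hs using hex
  have hsB : ∀ᶠ i in l, ‖s i‖ ≤ C * K := by
    filter_upwards [hG] with i h1
    have h2 := hDc (s i)
    rw [inv_mul_le_iff₀ hC0', hs, norm_neg] at h2
    refine h2.trans ?_
    gcongr
    exact (S.norm_starProjection_apply_le _).trans h1
  have hsρ : ∀ᶠ i in l, ‖s i‖ ≤ ρ i := by
    filter_upwards [hsB, H.tendsto_radius.eventually_ge_atTop (C * K)] with i h1 h2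
      using h1.trans h2
  obtain ⟨hpos2, hlim2⟩ := hy.tendsto_elRatio_perturb H hsρ hsB hG
  have hpyth : ∀ i, ‖normSum (y i)‖ ^ 2 = ‖S.starProjection (normSum (y i))‖ ^ 2 +
      ‖normSum (y i) - S.starProjection (normSum (y i))‖ ^ 2 := fun i => by
    have h1 : ⟪S.starProjection (normSum (y i)),
        normSum (y i) - S.starProjection (normSum (y i))⟫ = 0 :=
      S.inner_right_of_mem_orthogonal (S.starProjection_apply_mem _)
        (S.sub_starProjection_mem_orthogonal _)
    have h2 := norm_add_sq_real (S.starProjection (normSum (y i)))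
      (normSum (y i) - S.starProjection (normSum (y i)))
    rw [h1, add_sub_cancel] at h2
    linarith
  have hlow : ∀ i, ‖normSum (y i) - S.starProjection (normSum (y i))‖ ^ 2 ≤
      ‖normSum (y i) + D (t i)‖ ^ 2 := fun i => by
    have h1 : ⟪S.starProjection (normSum (y i)) + D (t i),
        normSum (y i) - S.starProjection (normSum (y i))⟫ = 0 :=
      S.inner_right_of_mem_orthogonal
        (S.add_mem (S.starProjection_apply_mem _) (LinearMap.mem_range_self D.toLinearMap (t i)))
        (S.sub_starProjection_mem_orthogonal _)
    have h2 := norm_add_sq_real (S.starProjection (normSum (y i)) + D (t i))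
      (normSum (y i) - S.starProjection (normSum (y i)))
    rw [h1] at h2
    have h3 : S.starProjection (normSum (y i)) + D (t i) +
      (normSum (y i) - S.starProjection (normSum (y i))) = normSum (y i) + D (t i) := by abel
    rw [h3] at h2
    nlinarith [sq_nonneg ‖S.starProjection (normSum (y i)) + D (t i)‖]
  -- Maximality against `s` gives the lower bound `hL` for the log ratio; the distance from `G` to
  -- the range of `D` turns `hU` into the upper bound.
  have hU := hlim0.sub hlim1
  have hL := hlim0.sub hlim2
  rw [sub_zero] at hU hL
  refine tendsto_of_tendsto_of_tendsto_of_le_of_le' hL hU ?_ ?_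
  · filter_upwards [hpos0, hpos, hpos2, hmax, hsρ] with i h1 h2 h3 h4 h5
    have h6 := Real.log_le_log h3 (h4 _ h5)
    rw [Real.log_div h1.ne' h2.ne', hs, ← sub_eq_add_neg]
    linarith [hpyth i]
  · filter_upwards [hpos0, hpos] with i h1 h2
    rw [Real.log_div h1.ne' h2.ne']
    linarith [hpyth i, hlow i]

end Perturbation

end Asymptotics

/-! ### Convergence in probability as convergence along a filter -/

section InProbability

variable {Ω : Type*} [MeasurableSpace Ω]

/-- The filter of the sets of pairs `(n, ω)` whose section at `n` has probability tending to one.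
Convergence in probability is convergence along this filter. -/
def inProb (μ : Measure Ω) : Filter (ℕ × Ω) where
  sets := {s | Tendsto (fun n => μ {ω | (n, ω) ∉ s}) atTop (𝓝 0)}
  univ_sets := by simp
  sets_of_superset {s t} hs hst := by
    refine tendsto_of_tendsto_of_tendsto_of_le_of_le tendsto_const_nhds hs
      (fun n => zero_le) (fun n => measure_mono fun ω hω h => hω (hst h))
  inter_sets {s t} hs ht := by
    have h := Tendsto.add hs ht
    rw [add_zero] at h
    refine tendsto_of_tendsto_of_tendsto_of_le_of_le tendsto_const_nhds h
      (fun n => zero_le) (fun n => ?_)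
    refine (measure_mono fun ω hω => ?_).trans (measure_union_le _ _)
    by_contra hc
    simp only [Set.mem_union, Set.mem_ofPred_eq, not_or, not_not] at hc
    exact hω hc

variable {μ : Measure Ω}

lemma eventually_inProb {p : ℕ × Ω → Prop} :
    (∀ᶠ x in inProb μ, p x) ↔ Tendsto (fun n => μ {ω | ¬ p (n, ω)}) atTop (𝓝 0) := Iff.rfl

lemma eventually_inProb_of_real_le [IsFiniteMeasure μ] {p : ℕ × Ω → Prop}
    (h : ∀ δ > 0, ∀ᶠ n in atTop, μ.real {ω | ¬ p (n, ω)} ≤ δ) : ∀ᶠ x in inProb μ, p x := by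
  rw [eventually_inProb]
  have h0 : Tendsto (fun n => μ.real {ω | ¬ p (n, ω)}) atTop (𝓝 0) := by
    rw [Metric.tendsto_nhds]
    intro ε hε
    filter_upwards [h (ε / 2) (half_pos hε)] with n hn
    rw [Real.dist_eq, sub_zero, abs_of_nonneg measureReal_nonneg]
    linarith
  have h1 := ENNReal.tendsto_ofReal h0
  rw [ENNReal.ofReal_zero] at h1
  exact h1.congr fun n => ofReal_measureReal

lemma tendsto_fst_inProb : Tendsto Prod.fst (inProb μ) atTop := by
  rw [tendsto_atTop]
  intro N
  rw [eventually_inProb]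
  refine tendsto_const_nhds.congr' ?_
  filter_upwards [eventually_ge_atTop N] with n hn
  simp [hn]

/-- Markov's inequality for a majorant `W` of the indicator of failure; the event itself need not be
measurable. -/
lemma eventually_inProb_of_integral [IsFiniteMeasure μ] {p : ℕ × Ω → Prop}
    (h : ∀ δ > 0, ∀ᶠ n in atTop, ∃ W : Ω → ℝ, Integrable W μ ∧ (∀ ω, 0 ≤ W ω) ∧
      ∫ ω, W ω ∂μ ≤ δ ∧ ∀ ω, ¬ p (n, ω) → 1 ≤ W ω) : ∀ᶠ x in inProb μ, p x := by
  refine eventually_inProb_of_real_le fun δ hδ => (h δ hδ).mono ?_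
  rintro n ⟨W, hW, hW0, hWδ, hpW⟩
  have h1 := mul_meas_ge_le_integral_of_nonneg (ae_of_all _ hW0) hW 1
  rw [one_mul] at h1
  exact (measureReal_mono (fun ω hω => hpW ω hω)).trans (h1.trans hWδ)

lemma tendsto_inProb_of_integral [IsFiniteMeasure μ] {W : ℕ → Ω → ℝ} {a : ℝ}
    (hW : ∀ᶠ n in atTop, Integrable (fun ω => |W n ω - a|) μ)
    (h : Tendsto (fun n => ∫ ω, |W n ω - a| ∂μ) atTop (𝓝 0)) :
    Tendsto (fun x : ℕ × Ω => W x.1 x.2) (inProb μ) (𝓝 a) := by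
  rw [Metric.tendsto_nhds]
  intro ε hε
  refine eventually_inProb_of_integral fun δ hδ => ?_
  filter_upwards [hW, h.eventually_le_const (mul_pos hδ hε)] with n h1 h2
  refine ⟨fun ω => |W n ω - a| / ε, h1.div_const _, fun ω => by positivity, ?_, fun ω hω => ?_⟩
  · rw [integral_div, div_le_iff₀ hε]; exact h2
  · rw [Real.dist_eq, not_lt] at hω
    rwa [one_le_div hε]

/-- Markov's inequality makes `Y > K` improbable uniformly in large `n`, so it suffices to argue on
`Y ≤ K` for each fixed `K`. This is how deterministic results needing a bounded normalized sum are
applied. -/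
lemma eventually_inProb_of_tight [IsFiniteMeasure μ] {Y : ℕ → Ω → ℝ} {C : ℝ}
    (hY : ∀ᶠ n in atTop, Integrable (Y n) μ) (hY0 : ∀ n ω, 0 ≤ Y n ω)
    (hC : ∀ᶠ n in atTop, ∫ ω, Y n ω ∂μ ≤ C) {p : ℕ × Ω → Prop}
    (h : ∀ K, ∀ᶠ x in inProb μ ⊓ 𝓟 {x | Y x.1 x.2 ≤ K}, p x) : ∀ᶠ x in inProb μ, p x := by
  refine eventually_inProb_of_real_le fun δ hδ => ?_
  set K := (|C| + 1) * (2 / δ) with hK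
  have hK0 : 0 < K := by positivity
  have h1 := h K
  rw [eventually_inf_principal, eventually_inProb] at h1
  have h2 := (ENNReal.tendsto_toReal ENNReal.zero_ne_top).comp h1
  have h3 := h2.eventually_le_const (half_pos hδ)
  filter_upwards [h3, hY, hC] with n h3 h4 h5
  have h6 := mul_meas_ge_le_integral_of_nonneg (ae_of_all _ (hY0 n)) h4 K
  have h7 : μ.real {ω | K ≤ Y n ω} ≤ δ / 2 := by
    have : K * μ.real {ω | K ≤ Y n ω} ≤ K * (δ / 2) := by
      refine (h6.trans (h5.trans (le_abs_self C))).trans ?_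
      rw [hK]; field_simp; linarith
    exact le_of_mul_le_mul_left this hK0
  refine (measureReal_mono (s₂ := {ω | ¬ (Y n ω ≤ K → p (n, ω))} ∪ {ω | K ≤ Y n ω})
    fun ω hω => ?_).trans ((measureReal_union_le _ _).trans (?_ : _ ≤ δ / 2 + δ / 2) |>.trans
      (add_halves δ).le)
  · by_cases hc : Y n ω ≤ K
    · exact Or.inl fun hp => hω (hp hc)
    · exact Or.inr (not_le.1 hc).le
  · exact add_le_add h3 h7

end InProbability

lemma ProbabilityTheory.HasLaw.memLp_comp {Ω 𝓧 E : Type*} [MeasurableSpace Ω] [MeasurableSpace 𝓧]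
    [NormedAddCommGroup E] {μ : Measure Ω} {P : Measure 𝓧} {Z : Ω → 𝓧}
    (hZ : HasLaw Z P μ) {f : 𝓧 → E} {p : ENNReal} (hf : MemLp f p P) :
    MemLp (fun ω => f (Z ω)) p μ := by
  rw [← hZ.map_eq] at hf
  exact hf.comp_of_map hZ.aemeasurable

/-! ### Moment bounds for sums of independent variables -/

section Moments

variable {Ω : Type*} [MeasurableSpace Ω] {μ : Measure Ω} [IsProbabilityMeasure μ]
  {𝓧 : Type*} [MeasurableSpace 𝓧] {P : Measure 𝓧}

/-- Integrates `|Y| ≤ η + Y² / η`; it converts variance bounds into `L¹` bounds. -/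
lemma integral_abs_le_add_div {Y : Ω → ℝ} (hY : MemLp Y 2 μ) {η : ℝ} (hη : 0 < η) :
    ∫ ω, |Y ω| ∂μ ≤ η + (∫ ω, Y ω ^ 2 ∂μ) / η := by
  have h1 : ∫ ω, |Y ω| ∂μ ≤ ∫ ω, (η + Y ω ^ 2 / η) ∂μ := by
    refine integral_mono (hY.integrable one_le_two).abs
      ((integrable_const _).add (hY.integrable_sq.div_const _)) fun ω => ?_
    change |Y ω| ≤ η + Y ω ^ 2 / η
    rw [← sq_abs (Y ω), ← sub_le_iff_le_add', le_div_iff₀ hη]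
    nlinarith [sq_nonneg (|Y ω| - η), abs_nonneg (Y ω), sq_nonneg (|Y ω|)]
  rwa [integral_add (integrable_const _) (hY.integrable_sq.div_const _), integral_div,
    integral_const, probReal_univ, one_smul] at h1

lemma integral_sq_avg_sub_le {κ : Type*} [Fintype κ] [Nonempty κ] {Y : κ → Ω → ℝ}
    (hY : ∀ k, MemLp (Y k) 2 μ) (hi : Pairwise fun k l => IndepFun (Y k) (Y l) μ) {a M : ℝ}
    (ha : ∀ k, ∫ ω, Y k ω ∂μ = a) (hM : ∀ k, ∫ ω, Y k ω ^ 2 ∂μ ≤ M) :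
    ∫ ω, ((Fintype.card κ : ℝ)⁻¹ * ∑ k, Y k ω - a) ^ 2 ∂μ ≤ M / Fintype.card κ := by
  have hc : (0 : ℝ) < Fintype.card κ := by exact_mod_cast Fintype.card_pos
  have hS : MemLp (∑ k, Y k) 2 μ := memLp_finsetSum' _ fun k _ => hY k
  have hS' : MemLp (fun ω => (Fintype.card κ : ℝ)⁻¹ * (∑ k, Y k) ω) 2 μ := hS.const_mul _
  have hmean : ∫ ω, (Fintype.card κ : ℝ)⁻¹ * (∑ k, Y k) ω ∂μ = a := by
    rw [integral_const_mul]
    simp only [Finset.sum_apply]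
    rw [integral_finsetSum _ fun k _ => (hY k).integrable one_le_two]
    simp only [ha, Finset.sum_const, Finset.card_univ, nsmul_eq_mul]
    rw [inv_mul_cancel_left₀ hc.ne']
  have hvar := variance_eq_integral hS'.aemeasurable
  rw [hmean, variance_const_mul, IndepFun.variance_sum (fun k _ => hY k)
    (fun k _ l _ hkl => hi hkl)] at hvar
  simp only [Finset.sum_apply] at hvar
  rw [← hvar]
  have h1 : ∑ k, variance (Y k) μ ≤ Fintype.card κ * M := by
    refine (Finset.sum_le_sum fun k _ =>
      (variance_le_expectation_sq (hY k).aestronglyMeasurable).trans (hM k)).trans ?_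
    simp
  calc ((Fintype.card κ : ℝ)⁻¹) ^ 2 * ∑ k, variance (Y k) μ
      ≤ ((Fintype.card κ : ℝ)⁻¹) ^ 2 * (Fintype.card κ * M) := by gcongr
    _ = _ := by field_simp

variable {κ : Type*} [Fintype κ] {X : κ → Ω → 𝓧}

lemma integral_sq_sum_eq (hX : ∀ k, HasLaw (X k) P μ) (hi : iIndepFun X μ) {f : 𝓧 → ℝ}
    (hf : MemLp f 2 P) (hf0 : ∫ x, f x ∂P = 0) :
    ∫ ω, (∑ k, f (X k ω)) ^ 2 ∂μ = Fintype.card κ * ∫ x, f x ^ 2 ∂P := by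
  have hm : ∀ k, MemLp (f ∘ X k) 2 μ := fun k => (hX k).memLp_comp hf
  have hi' : iIndepFun (fun k => f ∘ X k) μ := hi.comp₀ _ (fun k => (hX k).aemeasurable)
    fun k => by rw [(hX k).map_eq]; exact hf.aestronglyMeasurable.aemeasurable
  have h0 : ∀ k, ∫ ω, (f ∘ X k) ω ∂μ = 0 := fun k => by
    rw [(hX k).integral_comp hf.aestronglyMeasurable, hf0]
  have h1 : MemLp (∑ k, f ∘ X k) 2 μ := memLp_finsetSum' _ fun k _ => hm k
  have hv := variance_of_integral_eq_zero h1.aemeasurable (by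
    simp only [Finset.sum_apply]
    rw [integral_finsetSum _ fun k _ => (hm k).integrable one_le_two]
    simp only [h0, Finset.sum_const_zero])
  rw [IndepFun.variance_sum (fun k _ => hm k) (fun k _ l _ hkl => hi'.indepFun hkl)] at hv
  simp only [Finset.sum_apply, Function.comp_apply] at hv
  rw [← hv]
  have hk : ∀ k, variance (f ∘ X k) μ = ∫ x, f x ^ 2 ∂P := fun k => by
    rw [variance_of_integral_eq_zero (hm k).aemeasurable (h0 k)]
    exact (hX k).integral_comp (f := fun x => f x ^ 2) (hf.aestronglyMeasurable.pow 2)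
  change ∑ k, variance (f ∘ X k) μ = _
  simp [hk]

lemma pow_four_le_exp (x : ℝ) : x ^ 4 ≤ 24 * (Real.exp x + Real.exp (-x)) := by
  have key : ∀ y : ℝ, 0 ≤ y → y ^ 4 ≤ 24 * Real.exp y := fun y hy => by
    have := Real.pow_div_factorial_le_exp y hy 4
    rw [div_le_iff₀ (by positivity)] at this
    norm_num [Nat.factorial] at this
    linarith
  rcases le_total 0 x with h | h
  · linarith [key x h, Real.exp_pos (-x)]
  · have := key (-x) (neg_nonneg.2 h)
    rw [neg_pow] at this
    linarith [Real.exp_pos x]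

lemma memLp_of_forall_abs_le [IsFiniteMeasure P] {f : 𝓧 → ℝ} (hf : Measurable f) {C : ℝ}
    (hC : ∀ x, |f x| ≤ C)
    (p : ENNReal) : MemLp f p P :=
  MemLp.of_bound hf.aestronglyMeasurable C (ae_of_all _ hC)

/-- The fourth moment of a normalized sum of bounded centered variables is bounded independently of
the number of terms. -/
lemma integral_pow_four_normalized_sum_le [Nonempty κ] (hX : ∀ k, HasLaw (X k) P μ)
    (hi : iIndepFun X μ) {f : 𝓧 → ℝ} (hf : Measurable f) (hf0 : ∫ x, f x ∂P = 0) {C : ℝ}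
    (hC : ∀ x, |f x| ≤ C) :
    Integrable (fun ω => ((√(Fintype.card κ))⁻¹ * ∑ k, f (X k ω)) ^ 4) μ ∧
    ∫ ω, ((√(Fintype.card κ))⁻¹ * ∑ k, f (X k ω)) ^ 4 ∂μ ≤ 48 * Real.exp (C ^ 2 / 2) := by
  have hc : (0 : ℝ) < Fintype.card κ := by exact_mod_cast Fintype.card_pos
  have hm : ∀ k, AEMeasurable (f ∘ X k) μ := fun k => hf.comp_aemeasurable (hX k).aemeasurable
  have hi' : iIndepFun (fun k => f ∘ X k) μ := hi.comp _ fun _ => hf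
  have hsub : ∀ k ∈ Finset.univ, HasSubgaussianMGF (f ∘ X k) ((‖C - -C‖₊ / 2) ^ 2) μ :=
    fun k _ => hasSubgaussianMGF_of_mem_Icc_of_integral_eq_zero (hm k)
      (ae_of_all _ fun ω => abs_le.1 (hC _))
      (by rw [(hX k).integral_comp hf.aestronglyMeasurable, hf0])
  have hS := (HasSubgaussianMGF.sum_of_iIndepFun hi' hsub).const_mul (√(Fintype.card κ))⁻¹
  -- Each summand lies in `[-C, C]` and has sub-Gaussian parameter `C²` by Hoeffding's lemma; the
  -- normalization keeps this parameter for any number of terms.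
  obtain ⟨c, hpar, hS⟩ : ∃ c : NNReal, (c : ℝ) = C ^ 2 ∧ HasSubgaussianMGF
      (fun ω => (√(Fintype.card κ))⁻¹ * ∑ k, f (X k ω)) c μ := by
    refine ⟨_, ?_, hS⟩
    refine (NNReal.coe_mul _ _).trans ?_
    change (√(Fintype.card κ))⁻¹ ^ 2 * _ = _
    have h2 : (‖C - -C‖ / 2) ^ 2 = C ^ 2 := by
      rw [sub_neg_eq_add, ← two_mul, norm_mul, Real.norm_two, mul_div_cancel_left₀ _ two_ne_zero,
        Real.norm_eq_abs, sq_abs]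
    simp only [Finset.sum_const, Finset.card_univ, nsmul_eq_mul, NNReal.coe_mul,
      NNReal.coe_natCast, NNReal.coe_pow, NNReal.coe_div, coe_nnnorm, NNReal.coe_ofNat, h2]
    rw [inv_pow, Real.sq_sqrt hc.le, inv_mul_cancel_left₀ hc.ne']
  set Z : Ω → ℝ := fun ω => (√(Fintype.card κ))⁻¹ * ∑ k, f (X k ω) with hZ
  have hS' : HasSubgaussianMGF Z c μ := hS
  have e1 : Integrable (fun ω => Real.exp (Z ω)) μ := by simpa using hS'.integrable_exp_mul 1
  have e2 : Integrable (fun ω => Real.exp (-Z ω)) μ := by simpa using hS'.integrable_exp_mul (-1)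
  have m1 : ∫ ω, Real.exp (Z ω) ∂μ ≤ Real.exp (C ^ 2 / 2) := by
    have := hS'.mgf_le 1
    rw [hpar] at this
    simpa [mgf] using this
  have m2 : ∫ ω, Real.exp (-Z ω) ∂μ ≤ Real.exp (C ^ 2 / 2) := by
    have := hS'.mgf_le (-1)
    rw [hpar] at this
    simpa [mgf] using this
  have hint : Integrable (fun ω => 24 * (Real.exp (Z ω) + Real.exp (-Z ω))) μ :=
    (e1.add e2).const_mul 24
  have h4 : Integrable (fun ω => Z ω ^ 4) μ := by
    refine hint.mono' (hS'.aemeasurable.pow_const 4).aestronglyMeasurable (ae_of_all _ fun ω => ?_)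
    rw [Real.norm_of_nonneg (by positivity)]
    exact pow_four_le_exp _
  refine ⟨h4, (integral_mono h4 hint fun ω => pow_four_le_exp _).trans ?_⟩
  rw [integral_const_mul, integral_add e1 e2]
  linarith

/-- Simple functions are dense in `L²`. Recentering one does not increase the error: as `f` is
centered, the new squared error is the variance of the old difference. -/
lemma exists_bounded_approx [IsProbabilityMeasure P] {f : 𝓧 → ℝ} (hf : MemLp f 2 P)
    (hf0 : ∫ x, f x ∂P = 0) {η : ℝ} (hη : 0 < η) :
    ∃ g : 𝓧 → ℝ, Measurable g ∧ (∃ C, ∀ x, |g x| ≤ C) ∧ ∫ x, g x ∂P = 0 ∧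
      ∫ x, (f x - g x) ^ 2 ∂P ≤ η := by
  obtain ⟨s, hs, hsm⟩ := hf.exists_simpleFunc_eLpNorm_sub_lt ENNReal.ofNat_ne_top
    (ε := ENNReal.ofReal √η) (by simpa using hη)
  obtain ⟨C, hC⟩ := s.exists_forall_norm_le
  have hsi : Integrable s P := hsm.integrable one_le_two
  have hfi : Integrable f P := hf.integrable one_le_two
  refine ⟨fun x => s x - ∫ y, s y ∂P, s.measurable.sub_const _, ⟨C + |∫ y, s y ∂P|, fun x => ?_⟩,
    ?_, ?_⟩
  · exact (abs_sub _ _).trans (by simpa using hC x)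
  · rw [integral_sub hsi (integrable_const _)]; simp
  · have hd : MemLp (f - ⇑s) 2 P := hf.sub hsm
    have h1 := variance_eq_integral hd.aemeasurable
    have h2 : ∫ x, (f - ⇑s) x ∂P = -∫ y, s y ∂P := by
      simp only [Pi.sub_apply]
      rw [integral_sub hfi hsi, hf0, zero_sub]
    rw [h2] at h1
    have h3 : ∀ x, f x - (s x - ∫ y, s y ∂P) = (f - ⇑s) x - -∫ y, s y ∂P := fun x => by
      simp only [Pi.sub_apply]; ring
    simp only [h3]
    rw [← h1]
    refine (variance_le_expectation_sq hd.aestronglyMeasurable).trans ?_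
    have h4 := hd.eLpNorm_eq_integral_rpow_norm two_ne_zero ENNReal.ofNat_ne_top
    rw [h4, ENNReal.ofReal_lt_ofReal_iff (Real.sqrt_pos.2 hη)] at hs
    simp only [ENNReal.toReal_ofNat, Real.rpow_two, Real.norm_eq_abs, sq_abs] at hs
    rw [← one_div, ← Real.sqrt_eq_rpow] at hs
    exact (Real.sqrt_lt_sqrt_iff (integral_nonneg fun x => sq_nonneg _)).1 hs |>.le

end Moments

/-! ### Limit theorems for grouped arrays with arbitrary group sizes -/

section Arrays

variable {Ω : Type*} [MeasurableSpace Ω] {μ : Measure Ω}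
  {𝓧 : Type*} [MeasurableSpace 𝓧] {P : Measure 𝓧}

/-- For every `n`, the `n * m n` variables `X n i j`, in `n` groups of size `m n > 0`, are
independent with law `P`. -/
structure IsIIDArray (m : ℕ → ℕ) (X : (n : ℕ) → Fin n → Fin (m n) → Ω → 𝓧) (P : Measure 𝓧)
    (μ : Measure Ω) : Prop where
  pos : ∀ n, 0 < m n
  hasLaw : ∀ n i j, HasLaw (X n i j) P μ
  indep : ∀ n, iIndepFun (fun ij : Fin n × Fin (m n) => X n ij.1 ij.2) μ

lemma integral_sq_normSum [IsProbabilityMeasure μ] {k : ℕ} (hk : 0 < k) {X : Fin k → Ω → 𝓧}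
    (hX : ∀ j, HasLaw (X j) P μ) (hi : iIndepFun X μ) {f : 𝓧 → ℝ} (hf : MemLp f 2 P)
    (hf0 : ∫ x, f x ∂P = 0) :
    ∫ ω, (normSum fun j => f (X j ω)) ^ 2 ∂μ = ∫ x, f x ^ 2 ∂P := by
  have hk' : (0 : ℝ) < k := by exact_mod_cast hk
  simp only [normSum, smul_eq_mul, mul_pow, inv_pow, Real.sq_sqrt hk'.le]
  rw [integral_const_mul, integral_sq_sum_eq hX hi hf hf0, Fintype.card_fin,
    inv_mul_cancel_left₀ hk'.ne']

lemma memLp_normSum {k : ℕ} {X : Fin k → Ω → 𝓧} (hX : ∀ j, HasLaw (X j) P μ) {f : 𝓧 → ℝ}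
    {p : ENNReal} (hf : MemLp f p P) : MemLp (fun ω => normSum fun j => f (X j ω)) p μ := by
  have h1 : ∀ j, MemLp (fun ω => f (X j ω)) p μ := fun j => (hX j).memLp_comp hf
  have h2 : MemLp (fun ω => ∑ j, f (X j ω)) p μ := memLp_finsetSum _ fun j _ => h1 j
  exact h2.const_mul (√(k : ℝ))⁻¹

variable {m : ℕ → ℕ} {X : (n : ℕ) → Fin n → Fin (m n) → Ω → 𝓧}

lemma IsIIDArray.indep_group (hX : IsIIDArray m X P μ) (n : ℕ) (i : Fin n) :
    iIndepFun (X n i) μ :=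
  (hX.indep n).precomp (g := fun j => (i, j)) fun _ _ h => (Prod.mk.inj h).2

/-- Different groups use disjoint blocks of indices of one independent family. -/
lemma IsIIDArray.indepFun_normSum (hX : IsIIDArray m X P μ) {f : 𝓧 → ℝ} (hf : Measurable f)
    (n : ℕ) : Pairwise fun i i' : Fin n => IndepFun (fun ω => normSum fun j => f (X n i j ω))
      (fun ω => normSum fun j => f (X n i' j ω)) μ := by
  intro i i' hii
  classical
  let S : Fin n → Finset (Fin n × Fin (m n)) := fun i => Finset.univ.filter fun ij => ij.1 = i
  have hmem : ∀ i j, (i, j) ∈ S i := fun i j => by simp [S]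
  have hd : Disjoint (S i) (S i') := by
    rw [Finset.disjoint_left]
    rintro ij h1 h2
    simp only [S, Finset.mem_filter, Finset.mem_univ, true_and] at h1 h2
    exact hii (h1.symm.trans h2)
  have h := (hX.indep n).indepFun_finset₀ (S i) (S i') hd fun ij =>
    (hX.hasLaw n ij.1 ij.2).aemeasurable
  have hφ : ∀ i, Measurable fun z : S i → 𝓧 => normSum fun j => f (z ⟨(i, j), hmem i j⟩) :=
    fun i => (Finset.measurable_sum _ fun j _ =>
      hf.comp (measurable_pi_apply _)).const_mul (√(m n : ℝ))⁻¹
  exact h.comp (hφ i) (hφ i')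

variable [IsProbabilityMeasure μ]

lemma sum_pow_four_bound (hX : IsIIDArray m X P μ) {g : 𝓧 → ℝ} (hg : Measurable g)
    (hg0 : ∫ x, g x ∂P = 0) {C : ℝ} (hC : ∀ x, |g x| ≤ C) (n : ℕ) (i : Fin n) :
    Integrable (fun ω => (normSum fun j => g (X n i j ω)) ^ 4) μ ∧
      ∫ ω, (normSum fun j => g (X n i j ω)) ^ 4 ∂μ ≤ 48 * Real.exp (C ^ 2 / 2) := by
  have : Nonempty (Fin (m n)) := ⟨⟨0, hX.pos n⟩⟩
  simpa only [normSum, smul_eq_mul, Fintype.card_fin] using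
    integral_pow_four_normalized_sum_le (hX.hasLaw n i) (hX.indep_group n i) hg hg0 hC

variable [IsProbabilityMeasure P]

/-- The weak law of large numbers for the array. -/
theorem IsIIDArray.tendsto_avg (hX : IsIIDArray m X P μ) {f : 𝓧 → ℝ} (hf : Integrable f P) :
    Tendsto (fun x : ℕ × Ω => ((x.1 : ℝ) * m x.1)⁻¹ * ∑ i, ∑ j, f (X x.1 i j x.2))
      (inProb μ) (𝓝 (∫ x, f x ∂P)) := by
  have hint : ∀ {g : 𝓧 → ℝ}, Integrable g P → ∀ n : ℕ,
      Integrable (fun ω => ((n : ℝ) * m n)⁻¹ * ∑ i, ∑ j, g (X n i j ω)) μ := fun {g} hg n => by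
    have h1 : ∀ i j, Integrable (fun ω => g (X n i j ω)) μ := fun i j =>
      memLp_one_iff_integrable.1
        ((hX.hasLaw n i j).memLp_comp (memLp_one_iff_integrable.2 hg))
    have h2 : ∀ i, Integrable (fun ω => ∑ j, g (X n i j ω)) μ := fun i =>
      integrable_finsetSum _ fun j _ => h1 i j
    have h3 : Integrable (fun ω => ∑ i, ∑ j, g (X n i j ω)) μ :=
      integrable_finsetSum _ fun i _ => h2 i
    exact h3.const_mul _
  have hint' : ∀ {g : 𝓧 → ℝ}, Integrable g P → ∀ (n : ℕ) (a : ℝ),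
      Integrable (fun ω => |((n : ℝ) * m n)⁻¹ * ∑ i, ∑ j, g (X n i j ω) - a|) μ :=
    fun hg n a => ((hint hg n).sub (integrable_const a)).abs
  refine tendsto_inProb_of_integral (W := fun n ω => ((n : ℝ) * m n)⁻¹ * ∑ i, ∑ j, f (X n i j ω))
    (Eventually.of_forall fun n => hint' hf n _) ?_
  rw [Metric.tendsto_nhds]
  intro ε hε
  -- The `L¹` approximation, the fluctuation of the simple part and the difference of means
  -- contribute `η`, `2 η` and `η`.
  set η := ε / 8 with hη
  have hη0 : 0 < η := by positivity
  obtain ⟨s, hs, hsm⟩ := (memLp_one_iff_integrable.2 hf).exists_simpleFunc_eLpNorm_sub_lt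
    ENNReal.one_ne_top (ε := ENNReal.ofReal η) (by simpa using hη0)
  have hsi : Integrable s P := memLp_one_iff_integrable.1 hsm
  have hfs : Integrable (fun x => |f x - s x|) P := (hf.sub hsi).abs
  have hL1 : ∫ x, |f x - s x| ∂P ≤ η := by
    rw [((memLp_one_iff_integrable.2 hf).sub hsm).eLpNorm_eq_integral_rpow_norm one_ne_zero
      ENNReal.one_ne_top, ENNReal.ofReal_lt_ofReal_iff hη0] at hs
    simpa using hs.le
  obtain ⟨C, hC⟩ := s.exists_forall_norm_le
  have hCη : Tendsto (fun n : ℕ => C ^ 2 / (n : ℝ) / η) atTop (𝓝 0) := by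
    simpa using ((tendsto_const_nhds (x := C ^ 2)).div_atTop
      tendsto_natCast_atTop_atTop).div_const η
  filter_upwards [hCη.eventually_le_const hη0, eventually_gt_atTop 0] with n hn hn0
  rw [Real.dist_eq, sub_zero, abs_of_nonneg (integral_nonneg fun ω => abs_nonneg _)]
  have hn' : (1 : ℝ) ≤ n := by exact_mod_cast hn0
  have hm' : (1 : ℝ) ≤ m n := by exact_mod_cast hX.pos n
  have hN0 : (0 : ℝ) < (n : ℝ) * m n := by positivity
  have : Nonempty (Fin n) := ⟨⟨0, hn0⟩⟩
  have : Nonempty (Fin (m n)) := ⟨⟨0, hX.pos n⟩⟩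
  have hmean : ∫ ω, ((n : ℝ) * m n)⁻¹ * ∑ i, ∑ j, |f (X n i j ω) - s (X n i j ω)| ∂μ =
      ∫ x, |f x - s x| ∂P := by
    have h1 : ∀ i j, ∫ ω, |f (X n i j ω) - s (X n i j ω)| ∂μ = ∫ x, |f x - s x| ∂P :=
      fun i j => (hX.hasLaw n i j).integral_comp (f := fun x => |f x - s x|)
        hfs.aestronglyMeasurable
    have h2 : ∀ i j, Integrable (fun ω => |f (X n i j ω) - s (X n i j ω)|) μ := fun i j =>
      memLp_one_iff_integrable.1 ((hX.hasLaw n i j).memLp_comp (memLp_one_iff_integrable.2 hfs))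
    rw [integral_const_mul,
      integral_finsetSum _ fun i _ => integrable_finsetSum _ fun j _ => h2 i j]
    simp only [integral_finsetSum _ fun j _ => h2 _ j, h1]
    simp only [Finset.sum_const, Finset.card_univ, Fintype.card_fin, nsmul_eq_mul]
    field_simp
  have hs2 : ∫ ω, |((n : ℝ) * m n)⁻¹ * ∑ i, ∑ j, s (X n i j ω) - ∫ x, s x ∂P| ∂μ ≤ 2 * η := by
    have hY : ∀ ij : Fin n × Fin (m n), MemLp (s ∘ X n ij.1 ij.2) 2 μ := fun ij =>
      (hX.hasLaw n ij.1 ij.2).memLp_comp (memLp_of_forall_abs_le s.measurable hC 2)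
    have h1 := integral_sq_avg_sub_le (a := ∫ x, s x ∂P) (M := C ^ 2) hY
      (fun ij ij' h => ((hX.indep n).comp (fun _ => s) fun _ => s.measurable).indepFun h)
      (fun ij => (hX.hasLaw n ij.1 ij.2).integral_comp s.measurable.aestronglyMeasurable)
      (fun ij => by
        refine (integral_mono (hY ij).integrable_sq (integrable_const (C ^ 2)) fun ω => ?_).trans
          (by simp)
        rw [← sq_abs]
        exact pow_le_pow_left₀ (abs_nonneg _) (hC _) 2)
    simp only [Fintype.card_prod, Fintype.card_fin, Nat.cast_mul, Fintype.sum_prod_type,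
      Function.comp_apply] at h1
    have hmem : MemLp (fun ω => ((n : ℝ) * m n)⁻¹ * ∑ i, ∑ j, s (X n i j ω) - ∫ x, s x ∂P) 2 μ :=
      ((memLp_finsetSum _ fun i _ => memLp_finsetSum _ fun j _ => hY (i, j)).const_mul _).sub
        (memLp_const _)
    refine (integral_abs_le_add_div hmem hη0).trans ?_
    have h2 : C ^ 2 / ((n : ℝ) * m n) ≤ C ^ 2 / n := by
      gcongr
      exact le_mul_of_one_le_right (by linarith) hm'
    have h3 := (div_le_div_of_nonneg_right (h1.trans h2) hη0.le).trans hn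
    linarith
  have hdiff : |∫ x, s x ∂P - ∫ x, f x ∂P| ≤ η := by
    rw [abs_sub_comm, ← integral_sub hf hsi]
    exact (abs_integral_le_integral_abs).trans hL1
  have hpt : ∀ ω, |((n : ℝ) * m n)⁻¹ * ∑ i, ∑ j, f (X n i j ω) - ∫ x, f x ∂P| ≤
      ((n : ℝ) * m n)⁻¹ * ∑ i, ∑ j, |f (X n i j ω) - s (X n i j ω)| +
      |((n : ℝ) * m n)⁻¹ * ∑ i, ∑ j, s (X n i j ω) - ∫ x, s x ∂P| + η := fun ω => by
    have h1 : |((n : ℝ) * m n)⁻¹ * ∑ i, ∑ j, (f (X n i j ω) - s (X n i j ω))| ≤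
        ((n : ℝ) * m n)⁻¹ * ∑ i, ∑ j, |f (X n i j ω) - s (X n i j ω)| := by
      rw [abs_mul, abs_of_nonneg (inv_nonneg.2 hN0.le)]
      gcongr
      exact (Finset.abs_sum_le_sum_abs _ _).trans
        (Finset.sum_le_sum fun i _ => Finset.abs_sum_le_sum_abs _ _)
    have h2 : ((n : ℝ) * m n)⁻¹ * ∑ i, ∑ j, f (X n i j ω) - ∫ x, f x ∂P =
        ((n : ℝ) * m n)⁻¹ * ∑ i, ∑ j, (f (X n i j ω) - s (X n i j ω)) +
        (((n : ℝ) * m n)⁻¹ * ∑ i, ∑ j, s (X n i j ω) - ∫ x, s x ∂P) +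
        (∫ x, s x ∂P - ∫ x, f x ∂P) := by
      simp only [Finset.sum_sub_distrib, mul_sub]
      ring
    rw [h2]
    refine (abs_add_three _ _ _).trans ?_
    gcongr
  have hfin : ∫ ω, |((n : ℝ) * m n)⁻¹ * ∑ i, ∑ j, f (X n i j ω) - ∫ x, f x ∂P| ∂μ ≤
      η + 2 * η + η := by
    refine (integral_mono (hint' hf n _) (((hint hfs n).add (hint' hsi n _)).add
      (integrable_const η)) hpt).trans ?_
    have hs' := hint' hsi n (∫ x, s x ∂P)
    rw [integral_add' ((hint hfs n).add hs') (integrable_const _),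
      integral_add' (hint hfs n) hs', hmean, integral_const, probReal_univ, one_smul]
    gcongr
  linarith

/-- The empirical second moment of the normalized group sums is consistent. -/
theorem IsIIDArray.tendsto_avg_sq (hX : IsIIDArray m X P μ) {f : 𝓧 → ℝ} (hf : MemLp f 2 P)
    (hf0 : ∫ x, f x ∂P = 0) :
    Tendsto (fun x : ℕ × Ω => (x.1 : ℝ)⁻¹ * ∑ i, (normSum fun j => f (X x.1 i j x.2)) ^ 2)
      (inProb μ) (𝓝 (∫ x, f x ^ 2 ∂P)) := by
  have hmem : ∀ {g : 𝓧 → ℝ}, MemLp g 2 P → ∀ (n : ℕ) (i : Fin n),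
      MemLp (fun ω => normSum fun j => g (X n i j ω)) 2 μ :=
    fun hg n i => memLp_normSum (hX.hasLaw n i) hg
  have hint : ∀ {g : 𝓧 → ℝ}, MemLp g 2 P → ∀ n : ℕ,
      Integrable (fun ω => (n : ℝ)⁻¹ * ∑ i, (normSum fun j => g (X n i j ω)) ^ 2) μ :=
    fun hg n => (integrable_finsetSum _ fun i _ => (hmem hg n i).integrable_sq).const_mul _
  have hint' : ∀ {g : 𝓧 → ℝ}, MemLp g 2 P → ∀ (n : ℕ) (a : ℝ),
      Integrable (fun ω => |(n : ℝ)⁻¹ * ∑ i, (normSum fun j => g (X n i j ω)) ^ 2 - a|) μ :=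
    fun hg n a => ((hint hg n).sub (integrable_const a)).abs
  refine tendsto_inProb_of_integral
    (W := fun n ω => (n : ℝ)⁻¹ * ∑ i, (normSum fun j => f (X n i j ω)) ^ 2)
    (Eventually.of_forall fun n => hint' hf n _) ?_
  rw [Metric.tendsto_nhds]
  intro ε hε
  set v := ∫ x, f x ^ 2 ∂P with hv
  have hv0 : 0 ≤ v := integral_nonneg fun x => sq_nonneg _
  -- Replacing `f` by `g` costs `η v + 2 η` in the average and again in the mean; the fluctuation
  -- for `g` costs `2 η`.
  set η := min 1 (ε / (2 * (2 * v + 6))) with hη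
  have hη0 : 0 < η := lt_min one_pos (by positivity)
  have hη1 : η ≤ 1 := min_le_left _ _
  have hηε : η * (2 * v + 6) ≤ ε / 2 := by
    have : η ≤ ε / (2 * (2 * v + 6)) := min_le_right _ _
    rw [le_div_iff₀ (by positivity)] at this
    linarith
  -- The law of a group sum varies with `m`, so approximation is done on `f` rather than on the
  -- sums: the sums of `f - g` are small in `L²` for every `m`, and those of `g` have uniformly
  -- bounded fourth moments, which permits Chebyshev.
  obtain ⟨g, hg, ⟨C, hC⟩, hg0, hfg⟩ := exists_bounded_approx hf hf0 (pow_pos hη0 2)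
  have hgm : MemLp g 2 P := memLp_of_forall_abs_le hg hC 2
  have hbm : MemLp (fun x => f x - g x) 2 P := hf.sub hgm
  have hb0 : ∫ x, (f x - g x) ∂P = 0 := by
    rw [integral_sub (hf.integrable one_le_two) (hgm.integrable one_le_two), hf0, hg0, sub_zero]
  set M := 48 * Real.exp (C ^ 2 / 2) with hM
  have hMη : Tendsto (fun n : ℕ => M / (n : ℝ) / η) atTop (𝓝 0) := by
    simpa using ((tendsto_const_nhds (x := M)).div_atTop
      tendsto_natCast_atTop_atTop).div_const η
  filter_upwards [hMη.eventually_le_const hη0, eventually_gt_atTop 0] with n hn hn0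
  rw [Real.dist_eq, sub_zero, abs_of_nonneg (integral_nonneg fun ω => abs_nonneg _)]
  have hn' : (0 : ℝ) < n := by exact_mod_cast hn0
  have : Nonempty (Fin n) := ⟨⟨0, hn0⟩⟩
  have hZ : ∀ i : Fin n, ∫ ω, (normSum fun j => f (X n i j ω)) ^ 2 ∂μ = v := fun i =>
    integral_sq_normSum (hX.pos n) (hX.hasLaw n i) (hX.indep_group n i) hf hf0
  have hA : ∀ i : Fin n, ∫ ω, (normSum fun j => g (X n i j ω)) ^ 2 ∂μ = ∫ x, g x ^ 2 ∂P :=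
    fun i => integral_sq_normSum (hX.pos n) (hX.hasLaw n i) (hX.indep_group n i) hgm hg0
  have hB : ∀ i : Fin n, ∫ ω, (normSum fun j => f (X n i j ω) - g (X n i j ω)) ^ 2 ∂μ ≤ η ^ 2 :=
    fun i => (integral_sq_normSum (hX.pos n) (hX.hasLaw n i) (hX.indep_group n i) hbm hb0).trans_le
      hfg
  have hsub : ∀ (i : Fin n) ω, (normSum fun j => f (X n i j ω) - g (X n i j ω)) =
      (normSum fun j => f (X n i j ω)) - normSum fun j => g (X n i j ω) := fun i ω => by
    simp only [normSum, Finset.sum_sub_distrib, smul_sub]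
  have hZA : ∀ i : Fin n, ∫ ω, |(normSum fun j => f (X n i j ω)) ^ 2 -
      (normSum fun j => g (X n i j ω)) ^ 2| ∂μ ≤ η * v + η + η := fun i => by
    have hBm := hmem hbm n i
    have h1 : ∫ ω, |(normSum fun j => f (X n i j ω)) ^ 2 -
        (normSum fun j => g (X n i j ω)) ^ 2| ∂μ ≤
        ∫ ω, (η * (normSum fun j => f (X n i j ω)) ^ 2 + (1 / η + 1) *
          (normSum fun j => f (X n i j ω) - g (X n i j ω)) ^ 2) ∂μ := by
      refine integral_mono ((hmem hf n i).integrable_sq.sub (hmem hgm n i).integrable_sq).abs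
        (((hmem hf n i).integrable_sq.const_mul _).add (hBm.integrable_sq.const_mul _)) fun ω => ?_
      change |_| ≤ _ + _
      rw [hsub]
      set z : ℝ := normSum fun j => f (X n i j ω)
      set a : ℝ := normSum fun j => g (X n i j ω)
      have h2 : |z ^ 2 - a ^ 2| ≤ 2 * (|z| * |z - a|) + (z - a) ^ 2 := by
        have : z ^ 2 - a ^ 2 = 2 * (z * (z - a)) - (z - a) ^ 2 := by ring
        rw [this]
        refine (abs_sub _ _).trans ?_
        rw [abs_mul, abs_mul, abs_two, abs_of_nonneg (sq_nonneg (z - a))]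
      have h3 : 2 * (|z| * |z - a|) ≤ η * z ^ 2 + 1 / η * (z - a) ^ 2 := by
        rw [← sq_abs z, ← sq_abs (z - a)]
        have h4 : η * |z| ^ 2 + 1 / η * |z - a| ^ 2 - 2 * (|z| * |z - a|) =
            (η * |z| - |z - a|) ^ 2 / η := by field_simp; ring
        have h5 : 0 ≤ (η * |z| - |z - a|) ^ 2 / η := by positivity
        linarith
      linarith
    refine h1.trans ?_
    rw [integral_add ((hmem hf n i).integrable_sq.const_mul _) (hBm.integrable_sq.const_mul _),
      integral_const_mul, integral_const_mul, hZ]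
    have h2 : (1 / η + 1) * ∫ ω, (normSum fun j => f (X n i j ω) - g (X n i j ω)) ^ 2 ∂μ ≤
        (1 / η + 1) * η ^ 2 := by gcongr; exact hB i
    have h3 : (1 / η + 1) * η ^ 2 = η + η * η := by field_simp
    nlinarith
  have hva : |∫ x, g x ^ 2 ∂P - v| ≤ η * v + η + η := by
    rw [abs_sub_comm, ← hA ⟨0, hn0⟩, ← hZ ⟨0, hn0⟩,
      ← integral_sub (hmem hf n _).integrable_sq (hmem hgm n _).integrable_sq, hZ]
    exact abs_integral_le_integral_abs.trans (hZA _)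
  have hAvg : ∫ ω, |(n : ℝ)⁻¹ * ∑ i, (normSum fun j => g (X n i j ω)) ^ 2 - ∫ x, g x ^ 2 ∂P| ∂μ ≤
      2 * η := by
    have h4 := fun i : Fin n => sum_pow_four_bound hX hg hg0 hC n i
    have hY : ∀ i : Fin n, MemLp (fun ω => (normSum fun j => g (X n i j ω)) ^ 2) 2 μ := fun i => by
      refine (memLp_two_iff_integrable_sq ((hmem hgm n i).aestronglyMeasurable.pow 2)).2 ?_
      simpa only [Pi.pow_apply, ← pow_mul] using (h4 i).1
    have h1 := integral_sq_avg_sub_le (M := M) hY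
      (fun i i' h => ((hX.indepFun_normSum hg n) h).comp (measurable_id.pow_const 2)
        (measurable_id.pow_const 2)) hA
      (fun i => by simpa only [← pow_mul] using (h4 i).2)
    simp only [Fintype.card_fin] at h1
    have hmm : MemLp (fun ω => (n : ℝ)⁻¹ * ∑ i, (normSum fun j => g (X n i j ω)) ^ 2 -
        ∫ x, g x ^ 2 ∂P) 2 μ :=
      ((memLp_finsetSum _ fun i _ => hY i).const_mul _).sub (memLp_const _)
    refine (integral_abs_le_add_div hmm hη0).trans ?_
    have h3 := (div_le_div_of_nonneg_right h1 hη0.le).trans hn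
    linarith
  have hpt : ∀ ω, |(n : ℝ)⁻¹ * ∑ i, (normSum fun j => f (X n i j ω)) ^ 2 - v| ≤
      (n : ℝ)⁻¹ * ∑ i, |(normSum fun j => f (X n i j ω)) ^ 2 -
        (normSum fun j => g (X n i j ω)) ^ 2| +
      |(n : ℝ)⁻¹ * ∑ i, (normSum fun j => g (X n i j ω)) ^ 2 - ∫ x, g x ^ 2 ∂P| +
      (η * v + η + η) := fun ω => by
    have h1 : |(n : ℝ)⁻¹ * ∑ i, ((normSum fun j => f (X n i j ω)) ^ 2 -
        (normSum fun j => g (X n i j ω)) ^ 2)| ≤ (n : ℝ)⁻¹ * ∑ i,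
        |(normSum fun j => f (X n i j ω)) ^ 2 - (normSum fun j => g (X n i j ω)) ^ 2| := by
      rw [abs_mul, abs_of_nonneg (inv_nonneg.2 hn'.le)]
      gcongr
      exact Finset.abs_sum_le_sum_abs _ _
    have h2 : (n : ℝ)⁻¹ * ∑ i, (normSum fun j => f (X n i j ω)) ^ 2 - v =
        (n : ℝ)⁻¹ * ∑ i, ((normSum fun j => f (X n i j ω)) ^ 2 -
          (normSum fun j => g (X n i j ω)) ^ 2) +
        ((n : ℝ)⁻¹ * ∑ i, (normSum fun j => g (X n i j ω)) ^ 2 - ∫ x, g x ^ 2 ∂P) +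
        (∫ x, g x ^ 2 ∂P - v) := by
      rw [Finset.sum_sub_distrib, mul_sub]
      ring
    rw [h2]
    refine (abs_add_three _ _ _).trans ?_
    gcongr
  have hI : ∀ i : Fin n, Integrable (fun ω => |(normSum fun j => f (X n i j ω)) ^ 2 -
      (normSum fun j => g (X n i j ω)) ^ 2|) μ := fun i =>
    ((hmem hf n i).integrable_sq.sub (hmem hgm n i).integrable_sq).abs
  have hI' : Integrable (fun ω => (n : ℝ)⁻¹ * ∑ i, |(normSum fun j => f (X n i j ω)) ^ 2 -
      (normSum fun j => g (X n i j ω)) ^ 2|) μ :=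
    (integrable_finsetSum _ fun i _ => hI i).const_mul _
  have hfirst : ∫ ω, (n : ℝ)⁻¹ * ∑ i, |(normSum fun j => f (X n i j ω)) ^ 2 -
      (normSum fun j => g (X n i j ω)) ^ 2| ∂μ ≤ η * v + η + η := by
    rw [integral_const_mul, integral_finsetSum _ fun i _ => hI i, inv_mul_le_iff₀ hn']
    refine (Finset.sum_le_sum fun i _ => hZA i).trans_eq ?_
    simp only [Finset.sum_const, Finset.card_univ, Fintype.card_fin, nsmul_eq_mul]
  have hfin : ∫ ω, |(n : ℝ)⁻¹ * ∑ i, (normSum fun j => f (X n i j ω)) ^ 2 - v| ∂μ ≤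
      (η * v + η + η) + 2 * η + (η * v + η + η) := by
    refine (integral_mono (hint' hf n _) ((hI'.add (hint' hgm n _)).add
      (integrable_const _)) hpt).trans ?_
    have hg' := hint' hgm n (∫ x, g x ^ 2 ∂P)
    rw [integral_add' (hI'.add hg') (integrable_const _),
      integral_add' hI' hg', integral_const, probReal_univ, one_smul]
    gcongr
  nlinarith

/-- The normalized group sums are uniformly of smaller order than the square root of the number of
groups. -/
theorem IsIIDArray.eventually_normSum_le (hX : IsIIDArray m X P μ) {f : 𝓧 → ℝ} (hf : MemLp f 2 P)
    (hf0 : ∫ x, f x ∂P = 0) {ε : ℝ} (hε : 0 < ε) :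
    ∀ᶠ x : ℕ × Ω in inProb μ, ∀ i, |normSum fun j => f (X x.1 i j x.2)| ≤ ε * √x.1 := by
  refine eventually_inProb_of_integral fun δ hδ => ?_
  obtain ⟨g, hg, ⟨C, hC⟩, hg0, hfg⟩ := exists_bounded_approx hf hf0
    (η := δ / 2 * (ε / 2) ^ 2) (by positivity)
  have hgm : MemLp g 2 P := memLp_of_forall_abs_le hg hC 2
  have hbm : MemLp (fun x => f x - g x) 2 P := hf.sub hgm
  have hb0 : ∫ x, (f x - g x) ∂P = 0 := by
    rw [integral_sub (hf.integrable one_le_two) (hgm.integrable one_le_two), hf0, hg0, sub_zero]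
  set M := 48 * Real.exp (C ^ 2 / 2) with hM
  have hMn : Tendsto (fun n : ℕ => M / (n : ℝ) / (ε / 2) ^ 4) atTop (𝓝 0) := by
    simpa using ((tendsto_const_nhds (x := M)).div_atTop
      tendsto_natCast_atTop_atTop).div_const ((ε / 2) ^ 4)
  filter_upwards [hMn.eventually_le_const (half_pos hδ), eventually_gt_atTop 0] with n hn hn0
  have hn' : (0 : ℝ) < n := by exact_mod_cast hn0
  have h4 := fun i : Fin n => sum_pow_four_bound hX hg hg0 hC n i
  have h2 : ∀ i : Fin n,
      Integrable (fun ω => (normSum fun j => f (X n i j ω) - g (X n i j ω)) ^ 2) μ :=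
    fun i => (memLp_normSum (hX.hasLaw n i) hbm).integrable_sq
  have hB : ∀ i : Fin n, ∫ ω, (normSum fun j => f (X n i j ω) - g (X n i j ω)) ^ 2 ∂μ ≤
      δ / 2 * (ε / 2) ^ 2 :=
    fun i => (integral_sq_normSum (hX.pos n) (hX.hasLaw n i) (hX.indep_group n i) hbm hb0).trans_le
      hfg
  have i2 : Integrable (fun ω => ((ε / 2) ^ 2 * n)⁻¹ *
      ∑ i, (normSum fun j => f (X n i j ω) - g (X n i j ω)) ^ 2) μ :=
    (integrable_finsetSum _ fun i _ => h2 i).const_mul _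
  have i4 : Integrable (fun ω => ((ε / 2) ^ 4 * (n : ℝ) ^ 2)⁻¹ *
      ∑ i, (normSum fun j => g (X n i j ω)) ^ 4) μ :=
    (integrable_finsetSum _ fun i _ => (h4 i).1).const_mul _
  -- A union bound as a Markov majorant: a large group sum forces either its `f - g` part or its `g`
  -- part above half the threshold. The former is paid for by second moments, the latter by fourth
  -- moments, which gain a factor `1/n`.
  refine ⟨_, i2.add i4, fun ω => ?_, ?_, fun ω hω => ?_⟩
  · have : ∀ i, 0 ≤ (normSum fun j => g (X n i j ω)) ^ 4 := fun i => by positivity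
    exact add_nonneg (mul_nonneg (by positivity) (Finset.sum_nonneg fun i _ => sq_nonneg _))
      (mul_nonneg (by positivity) (Finset.sum_nonneg fun i _ => this i))
  · have e2 : ∫ ω, ((ε / 2) ^ 2 * n)⁻¹ *
        ∑ i, (normSum fun j => f (X n i j ω) - g (X n i j ω)) ^ 2 ∂μ ≤ δ / 2 := by
      rw [integral_const_mul, integral_finsetSum _ fun i _ => h2 i,
        inv_mul_le_iff₀ (by positivity)]
      refine (Finset.sum_le_sum fun i _ => hB i).trans_eq ?_
      simp
      ring
    have e4 : ∫ ω, ((ε / 2) ^ 4 * (n : ℝ) ^ 2)⁻¹ *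
        ∑ i, (normSum fun j => g (X n i j ω)) ^ 4 ∂μ ≤ δ / 2 := by
      rw [integral_const_mul, integral_finsetSum _ fun i _ => (h4 i).1]
      calc ((ε / 2) ^ 4 * (n : ℝ) ^ 2)⁻¹ * ∑ i, ∫ ω, (normSum fun j => g (X n i j ω)) ^ 4 ∂μ
          ≤ ((ε / 2) ^ 4 * (n : ℝ) ^ 2)⁻¹ * ∑ _i : Fin n, M := by
            gcongr with i
            exact (h4 i).2
        _ = M / (n : ℝ) / (ε / 2) ^ 4 := by
            simp only [Finset.sum_const, Finset.card_univ, Fintype.card_fin, nsmul_eq_mul]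
            field_simp
        _ ≤ _ := hn
    simp only [Pi.add_apply]
    rw [integral_add i2 i4]
    linarith
  · simp only [not_forall, not_le] at hω
    obtain ⟨i, hi⟩ := hω
    have hsq : ∀ c : ℝ, 0 ≤ c → ∀ z : ℝ, c * √n ≤ |z| → c ^ 2 * n ≤ z ^ 2 := fun c hc z hz => by
      rw [← Real.sq_sqrt hn'.le, ← mul_pow, ← sq_abs z]
      exact pow_le_pow_left₀ (by positivity) hz 2
    have hsplit : ε / 2 * √n ≤ |normSum fun j => f (X n i j ω) - g (X n i j ω)| ∨
        ε / 2 * √n ≤ |normSum fun j => g (X n i j ω)| := by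
      by_contra! hc
      have hsub : (normSum fun j => f (X n i j ω)) = (normSum fun j => f (X n i j ω) -
          g (X n i j ω)) + normSum fun j => g (X n i j ω) := by
        simp only [normSum, Finset.sum_sub_distrib, smul_sub, sub_add_cancel]
      rw [hsub] at hi
      have := abs_add_le (normSum fun j => f (X n i j ω) - g (X n i j ω))
        (normSum fun j => g (X n i j ω))
      linarith [hc.1, hc.2]
    have p2 : 0 ≤ ((ε / 2) ^ 2 * n)⁻¹ *
        ∑ i, (normSum fun j => f (X n i j ω) - g (X n i j ω)) ^ 2 :=
      mul_nonneg (by positivity) (Finset.sum_nonneg fun i _ => sq_nonneg _)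
    have p4' : ∀ i, 0 ≤ (normSum fun j => g (X n i j ω)) ^ 4 := fun i => by positivity
    have p4 : 0 ≤ ((ε / 2) ^ 4 * (n : ℝ) ^ 2)⁻¹ * ∑ i, (normSum fun j => g (X n i j ω)) ^ 4 :=
      mul_nonneg (by positivity) (Finset.sum_nonneg fun i _ => p4' i)
    change (1 : ℝ) ≤ _ + _
    rcases hsplit with h | h
    · have h5 := hsq _ (by positivity) _ h
      have h6 := Finset.single_le_sum
        (f := fun i => (normSum fun j => f (X n i j ω) - g (X n i j ω)) ^ 2)
        (fun i _ => sq_nonneg _) (Finset.mem_univ i)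
      have h7 : 1 ≤ ((ε / 2) ^ 2 * n)⁻¹ *
          ∑ i, (normSum fun j => f (X n i j ω) - g (X n i j ω)) ^ 2 := by
        rw [le_inv_mul_iff₀ (by positivity), mul_one]
        exact h5.trans h6
      linarith
    · have h5 := pow_le_pow_left₀ (by positivity) (hsq _ (by positivity) _ h) 2
      rw [mul_pow, ← pow_mul, ← pow_mul] at h5
      have h6 := Finset.single_le_sum (f := fun i => (normSum fun j => g (X n i j ω)) ^ 4)
        (fun i _ => p4' i) (Finset.mem_univ i)
      have h7 : 1 ≤ ((ε / 2) ^ 4 * (n : ℝ) ^ 2)⁻¹ *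
          ∑ i, (normSum fun j => g (X n i j ω)) ^ 4 := by
        rw [le_inv_mul_iff₀ (by positivity), mul_one]
        exact h5.trans h6
      linarith

end Arrays

/-! ### From single directions to uniform statements -/

section FiniteDimensional

variable {V : Type*} [NormedAddCommGroup V] [InnerProductSpace ℝ V]
  {T : Type*} [NormedAddCommGroup T] [InnerProductSpace ℝ T] [FiniteDimensional ℝ T]
  {ι : Type*} {l : Filter ι} {n : ι → ℕ}

lemma norm_le_sum_abs_inner {κ : Type*} [Fintype κ] (b : OrthonormalBasis κ ℝ V) (v : V) :
    ‖v‖ ≤ ∑ a, |⟪b a, v⟫| := by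
  nth_rewrite 1 [← b.sum_repr' v]
  refine (norm_sum_le _ _).trans_eq (Finset.sum_congr rfl fun a _ => ?_)
  rw [norm_smul, b.norm_eq_one, mul_one, Real.norm_eq_abs]

variable [FiniteDimensional ℝ V]

/-- Polarization turns convergence of the quadratic form in each direction into convergence of its
finitely many matrix entries, and hence into convergence uniform in `v`. -/
lemma IsELRegular.of_forall_inner {y : ∀ i, Fin (n i) → V} (hn : Tendsto n l atTop)
    (hsmall : ∀ v, ∀ ε > 0, ∀ᶠ i in l, ∀ k, |⟪v, y i k⟫| ≤ ε * √(n i))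
    (hquad : ∀ v, Tendsto (fun i => (n i : ℝ)⁻¹ * ∑ k, ⟪v, y i k⟫ ^ 2) l (𝓝 (‖v‖ ^ 2))) :
    IsELRegular l n y where
  tendsto_size := hn
  small ε hε := by
    set b := stdOrthonormalBasis ℝ V
    set d := Module.finrank ℝ V
    have h1 : ∀ᶠ i in l, ∀ a, ∀ k, |⟪b a, y i k⟫| ≤ ε / (d + 1) * √(n i) :=
      eventually_all.2 fun a => hsmall (b a) _ (by positivity)
    filter_upwards [h1] with i h1 k
    refine (norm_le_sum_abs_inner b _).trans ((Finset.sum_le_sum fun a _ => h1 a k).trans ?_)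
    rw [Finset.sum_const, Finset.card_univ, Fintype.card_fin, nsmul_eq_mul, ← mul_assoc]
    gcongr
    rw [mul_div_assoc', div_le_iff₀ (by positivity)]
    nlinarith
  quad ε hε := by
    set b := stdOrthonormalBasis ℝ V with hb
    set M : ι → Fin (Module.finrank ℝ V) → Fin (Module.finrank ℝ V) → ℝ :=
      fun i a c => (n i : ℝ)⁻¹ * ∑ k, ⟪b a, y i k⟫ * ⟪b c, y i k⟫ with hM
    have hMt : ∀ a c, Tendsto (fun i => M i a c - ⟪b a, b c⟫) l (𝓝 0) := fun a c => by
      have h1 := (((hquad (b a + b c)).sub (hquad (b a))).sub (hquad (b c))).div_const 2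
      have h2 : (‖b a + b c‖ ^ 2 - ‖b a‖ ^ 2 - ‖b c‖ ^ 2) / 2 = ⟪b a, b c⟫ := by
        rw [norm_add_sq_real]; ring
      rw [h2] at h1
      refine (tendsto_sub_nhds_zero_iff.2 h1).congr fun i => ?_
      congr 1
      rw [hM, ← mul_sub, ← mul_sub, ← Finset.sum_sub_distrib, ← Finset.sum_sub_distrib,
        mul_div_assoc, Finset.sum_div]
      congr 1
      refine Finset.sum_congr rfl fun k _ => ?_
      rw [inner_add_left]; ring
    have hsum : Tendsto (fun i => ∑ a, ∑ c, |M i a c - ⟪b a, b c⟫|) l (𝓝 0) := by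
      simpa using tendsto_finsetSum Finset.univ fun a _ =>
        tendsto_finsetSum Finset.univ fun c _ => (hMt a c).abs
    filter_upwards [hsum.eventually_le_const hε] with i hi v
    have hexp : ∀ z, ⟪v, z⟫ ^ 2 = ∑ a, ∑ c, ⟪v, b a⟫ * ⟪v, b c⟫ * (⟪b a, z⟫ * ⟪b c, z⟫) :=
      fun z => by
        rw [sq, ← b.sum_inner_mul_inner v z, Finset.sum_mul_sum]
        exact Finset.sum_congr rfl fun a _ => Finset.sum_congr rfl fun c _ => by ring
    have hv : ‖v‖ ^ 2 = ∑ a, ∑ c, ⟪v, b a⟫ * ⟪v, b c⟫ * ⟪b a, b c⟫ := by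
      simp only [orthonormal_iff_ite.1 b.orthonormal, mul_ite, mul_one, mul_zero,
        Finset.sum_ite_eq, Finset.mem_univ, if_true, ← sq]
      exact (b.sum_sq_inner_left v).symm
    have hMv : (n i : ℝ)⁻¹ * ∑ k, ⟪v, y i k⟫ ^ 2 =
        ∑ a, ∑ c, ⟪v, b a⟫ * ⟪v, b c⟫ * M i a c := by
      simp only [hexp, hM]
      rw [Finset.sum_comm, Finset.mul_sum]
      refine Finset.sum_congr rfl fun a _ => ?_
      rw [Finset.sum_comm, Finset.mul_sum]
      refine Finset.sum_congr rfl fun c _ => ?_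
      rw [← Finset.mul_sum]
      ring
    have hvb : ∀ a, |⟪v, b a⟫| ≤ ‖v‖ := fun a => by
      simpa using abs_real_inner_le_norm v (b a)
    have hdiff : ∑ a, ∑ c, ⟪v, b a⟫ * ⟪v, b c⟫ * M i a c - ‖v‖ ^ 2 =
        ∑ a, ∑ c, ⟪v, b a⟫ * ⟪v, b c⟫ * (M i a c - ⟪b a, b c⟫) := by
      rw [hv]
      simp only [← Finset.sum_sub_distrib, ← mul_sub]
    rw [hMv, hdiff]
    calc |∑ a, ∑ c, ⟪v, b a⟫ * ⟪v, b c⟫ * (M i a c - ⟪b a, b c⟫)|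
        ≤ ∑ a, ∑ c, |⟪v, b a⟫ * ⟪v, b c⟫ * (M i a c - ⟪b a, b c⟫)| :=
          (Finset.abs_sum_le_sum_abs _ _).trans
            (Finset.sum_le_sum fun a _ => Finset.abs_sum_le_sum_abs _ _)
      _ ≤ ∑ a, ∑ c, ‖v‖ ^ 2 * |M i a c - ⟪b a, b c⟫| := by
          refine Finset.sum_le_sum fun a _ => Finset.sum_le_sum fun c _ => ?_
          rw [abs_mul, abs_mul, sq]
          gcongr
          · exact hvb a
          · exact hvb c
      _ ≤ ε * ‖v‖ ^ 2 := by
          simp only [← Finset.mul_sum]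
          rw [mul_comm]
          gcongr

lemma eventually_norm_apply_le {A : ι → T →L[ℝ] V}
    (hA : ∀ v t, Tendsto (fun i => ⟪v, A i t⟫) l (𝓝 0)) {ε : ℝ} (hε : 0 < ε) :
    ∀ᶠ i in l, ∀ t, ‖A i t‖ ≤ ε * ‖t‖ := by
  set b := stdOrthonormalBasis ℝ V
  set c := stdOrthonormalBasis ℝ T
  have hsum : Tendsto (fun i => ∑ k, ∑ a, |⟪b a, A i (c k)⟫|) l (𝓝 0) := by
    simpa using tendsto_finsetSum Finset.univ fun k _ =>
      tendsto_finsetSum Finset.univ fun a _ => (hA (b a) (c k)).abs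
  filter_upwards [hsum.eventually_le_const hε] with i hi t
  nth_rewrite 1 [← c.sum_repr' t]
  rw [map_sum]
  calc ‖∑ k, A i (⟪c k, t⟫ • c k)‖ ≤ ∑ k, ‖t‖ * ∑ a, |⟪b a, A i (c k)⟫| := by
        refine norm_sum_le_of_le _ fun k _ => ?_
        rw [map_smul, norm_smul]
        gcongr
        · simpa using abs_real_inner_le_norm (c k) t
        · exact norm_le_sum_abs_inner b _
    _ ≤ ε * ‖t‖ := by
        rw [← Finset.mul_sum, mul_comm]
        gcongr

end FiniteDimensional

/-! ### Regularity and the central limit theorem for standardized data -/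

section Limits

variable {Ω : Type*} [MeasurableSpace Ω] {μ : Measure Ω} [IsProbabilityMeasure μ]
  {𝓧 : Type*} [MeasurableSpace 𝓧] {P : Measure 𝓧}
  {m : ℕ → ℕ} {X : (n : ℕ) → Fin n → Fin (m n) → Ω → 𝓧}
  {V : Type*} [NormedAddCommGroup V] [InnerProductSpace ℝ V]

lemma inner_normSum {k : ℕ} (v : V) (y : Fin k → V) :
    ⟪v, normSum y⟫ = normSum fun j => ⟪v, y j⟫ := by
  rw [normSum, real_inner_smul_right, inner_sum]; rfl

lemma normSum_normSum {n k : ℕ} (y : Fin n → Fin k → V) :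
    (normSum fun i => normSum (y i)) = (√((n : ℝ) * k))⁻¹ • ∑ i, ∑ j, y i j := by
  simp only [normSum]
  rw [← Finset.smul_sum, smul_smul, Real.sqrt_mul (Nat.cast_nonneg n), mul_inv]

variable [FiniteDimensional ℝ V]

/-- A centered square integrable function whose second moment matrix is the identity. -/
structure IsStandardized (h : 𝓧 → V) (P : Measure 𝓧) : Prop where
  memLp : ∀ v, MemLp (fun x => ⟪v, h x⟫) 2 P
  integral_eq : ∀ v, ∫ x, ⟪v, h x⟫ ∂P = 0
  integral_sq_eq : ∀ v, ∫ x, ⟪v, h x⟫ ^ 2 ∂P = ‖v‖ ^ 2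

theorem IsIIDArray.isELRegular [IsProbabilityMeasure P] (hX : IsIIDArray m X P μ) {h : 𝓧 → V}
    (hh : IsStandardized h P) :
    IsELRegular (inProb μ) Prod.fst
      (fun x i => normSum fun j => h (X x.1 i j x.2)) := by
  refine IsELRegular.of_forall_inner tendsto_fst_inProb (fun v ε hε => ?_) fun v => ?_
  · simpa only [inner_normSum] using hX.eventually_normSum_le (hh.memLp v) (hh.integral_eq v) hε
  · have h1 := hX.tendsto_avg_sq (hh.memLp v) (hh.integral_eq v)
    rw [hh.integral_sq_eq] at h1
    simpa only [inner_normSum] using h1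

/-- The trace of the identity covariance, summed over an orthonormal basis. It supplies the
tightness of the normalized sum. -/
lemma IsIIDArray.integral_sq_norm_normSum (hX : IsIIDArray m X P μ) {h : 𝓧 → V}
    (hh : IsStandardized h P) {n : ℕ} (hn : 0 < n) :
    Integrable (fun ω => ‖normSum fun i => normSum fun j => h (X n i j ω)‖ ^ 2) μ ∧
    ∫ ω, ‖normSum fun i => normSum fun j => h (X n i j ω)‖ ^ 2 ∂μ = Module.finrank ℝ V := by
  have hN : (0 : ℝ) < (n : ℝ) * m n := by
    have := hX.pos n
    positivity
  have hscal : ∀ (v : V) ω, ⟪v, normSum fun i => normSum fun j => h (X n i j ω)⟫ =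
      (√((n : ℝ) * m n))⁻¹ * ∑ ij : Fin n × Fin (m n), ⟪v, h (X n ij.1 ij.2 ω)⟫ := fun v ω => by
    rw [normSum_normSum, real_inner_smul_right, inner_sum, Fintype.sum_prod_type]
    simp only [inner_sum]
  have hexp : ∀ ω, ‖normSum fun i => normSum fun j => h (X n i j ω)‖ ^ 2 =
      ∑ a, ((√((n : ℝ) * m n))⁻¹ * ∑ ij : Fin n × Fin (m n),
        ⟪stdOrthonormalBasis ℝ V a, h (X n ij.1 ij.2 ω)⟫) ^ 2 := fun ω =>
    ((stdOrthonormalBasis ℝ V).sum_sq_inner_right _).symm.trans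
      (Finset.sum_congr rfl fun a _ => by rw [hscal])
  have hmem : ∀ v : V, MemLp (fun ω => (√((n : ℝ) * m n))⁻¹ * ∑ ij : Fin n × Fin (m n),
      ⟪v, h (X n ij.1 ij.2 ω)⟫) 2 μ := fun v => by
    have h1 : ∀ ij : Fin n × Fin (m n), MemLp (fun ω => ⟪v, h (X n ij.1 ij.2 ω)⟫) 2 μ :=
      fun ij => (hX.hasLaw n ij.1 ij.2).memLp_comp (hh.memLp v)
    have h2 : MemLp (fun ω => ∑ ij : Fin n × Fin (m n), ⟪v, h (X n ij.1 ij.2 ω)⟫) 2 μ :=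
      memLp_finsetSum _ fun ij _ => h1 ij
    exact h2.const_mul _
  have hval : ∀ v : V, ∫ ω, ((√((n : ℝ) * m n))⁻¹ * ∑ ij : Fin n × Fin (m n),
      ⟪v, h (X n ij.1 ij.2 ω)⟫) ^ 2 ∂μ = ‖v‖ ^ 2 := fun v => by
    have h1 := integral_sq_sum_eq (fun ij : Fin n × Fin (m n) => hX.hasLaw n ij.1 ij.2)
      (hX.indep n) (hh.memLp v) (hh.integral_eq v)
    simp only [mul_pow]
    rw [integral_const_mul, h1, inv_pow, Real.sq_sqrt hN.le, Fintype.card_prod, Fintype.card_fin,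
      Fintype.card_fin, Nat.cast_mul, inv_mul_cancel_left₀ hN.ne', hh.integral_sq_eq]
  simp only [hexp]
  refine ⟨integrable_finsetSum _ fun a _ => (hmem _).integrable_sq, ?_⟩
  rw [integral_finsetSum _ fun a _ => (hmem _).integrable_sq]
  simp only [hval, OrthonormalBasis.norm_eq_one, one_pow, Finset.sum_const, Finset.card_univ,
    Fintype.card_fin, nsmul_eq_mul, mul_one]

/-- The multivariate central limit theorem for the array. -/
theorem IsIIDArray.tendstoInDistribution_normSum [MeasurableSpace V] [BorelSpace V]
    (hX : IsIIDArray m X P μ) {h : 𝓧 → V} (hm : AEMeasurable h P) (hh : IsStandardized h P) :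
    TendstoInDistribution (fun n ω => normSum fun i => normSum fun j => h (X n i j ω)) atTop id
      (fun _ => μ) (stdGaussian V) := by
  have hcomp : ∀ n i j, AEMeasurable (fun ω => h (X n i j ω)) μ := fun n i j =>
    AEMeasurable.comp_aemeasurable (by rw [(hX.hasLaw n i j).map_eq]; exact hm)
      (hX.hasLaw n i j).aemeasurable
  have hsum : ∀ n, AEMeasurable (fun ω => ∑ ij : Fin n × Fin (m n), h (X n ij.1 ij.2 ω)) μ :=
    fun n => Finset.aemeasurable_fun_sum _ fun ij _ => hcomp n ij.1 ij.2
  have heq : ∀ n ω, (normSum fun i => normSum fun j => h (X n i j ω)) =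
      (√((n * m n : ℕ) : ℝ))⁻¹ • ∑ ij : Fin n × Fin (m n), h (X n ij.1 ij.2 ω) := fun n ω => by
    rw [normSum_normSum, Fintype.sum_prod_type, Nat.cast_mul]
  have hae : ∀ n, AEMeasurable (fun ω => normSum fun i => normSum fun j => h (X n i j ω)) μ :=
    fun n => by
      simp only [heq]
      exact (hsum n).const_smul _
  refine ⟨hae, aemeasurable_id, ProbabilityMeasure.tendsto_of_tendsto_charFun fun t => ?_⟩
  simp only [ProbabilityMeasure.coe_mk, Measure.map_id, charFun_stdGaussian]
  have hcf : ∀ n, charFun (μ.map fun ω => normSum fun i => normSum fun j => h (X n i j ω)) t =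
      charFun (P.map h) ((√((n * m n : ℕ) : ℝ))⁻¹ • t) ^ (n * m n) := fun n => by
    simp only [heq]
    have hmk : ∀ ij : Fin n × Fin (m n), AEMeasurable (h ∘ X n ij.1 ij.2) μ :=
      fun ij => hcomp n ij.1 ij.2
    have hind : iIndepFun (fun ij : Fin n × Fin (m n) => h ∘ X n ij.1 ij.2) μ :=
      (hX.indep n).comp₀ _ (fun ij => (hX.hasLaw n ij.1 ij.2).aemeasurable)
        fun ij => by rw [(hX.hasLaw n ij.1 ij.2).map_eq]; exact hm
    have hlaw : ∀ ij : Fin n × Fin (m n), μ.map (h ∘ X n ij.1 ij.2) = P.map h := fun ij => by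
      rw [← AEMeasurable.map_map_of_aemeasurable (by rw [(hX.hasLaw n ij.1 ij.2).map_eq]; exact hm)
        (hX.hasLaw n ij.1 ij.2).aemeasurable, (hX.hasLaw n ij.1 ij.2).map_eq]
    have h1 := hind.charFun_map_fun_sum_eq_prod hmk
    rw [charFun_map_smul_comp (hsum n)]
    simp only [Function.comp_apply] at h1
    rw [h1]
    simp [hlaw]
  simp only [hcf]
  have hNt : Tendsto (fun n => n * m n) atTop atTop :=
    tendsto_atTop_mono (fun n => Nat.le_mul_of_pos_right n (hX.pos n)) tendsto_id
  -- The characteristic function depends on `n` and `m n` only through `N = n * m n`, which tends to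
  -- infinity for any group sizes.
  suffices hs : Tendsto (fun N : ℕ => charFun (P.map h) ((√(N : ℝ))⁻¹ • t) ^ N) atTop
      (𝓝 (Complex.exp (-‖t‖ ^ 2 / 2))) from hs.comp hNt
  have : IsProbabilityMeasure P := by
    have := hX.hasLaw 1 0 ⟨0, hX.pos 1⟩
    exact this.isProbabilityMeasure_iff.1 inferInstance
  have : IsProbabilityMeasure (P.map h) := Measure.isProbabilityMeasure_map hm
  rcases eq_or_ne t 0 with rfl | ht
  · simp
  have ht0 : ‖t‖ ≠ 0 := norm_ne_zero_iff.2 ht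
  set u := ‖t‖⁻¹ • t with hu
  have hun : ‖u‖ = 1 := by rw [hu, norm_smul, norm_inv, norm_norm, inv_mul_cancel₀ ht0]
  have htu : t = ‖t‖ • u := by rw [hu, smul_smul, mul_inv_cancel₀ ht0, one_smul]
  have hcf1 : ∀ s : ℝ, charFun (P.map fun x => ⟪u, h x⟫) s = charFun (P.map h) (s • u) :=
    fun s => by
      rw [charFun_apply_real, charFun_apply, integral_map (hh.memLp u).aemeasurable
        (by fun_prop), integral_map hm (by fun_prop)]
      simp only [real_inner_smul_right, real_inner_comm u, Complex.ofReal_mul]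
  have hlim := tendsto_charFun_inv_sqrt_mul_pow (hh.memLp u).aemeasurable (hh.integral_eq u)
    (by simpa [hun] using hh.integral_sq_eq u) ‖t‖
  simp only [hcf1, mul_smul, ← htu] at hlim
  simpa using hlim

lemma chiSquared_eq_map (p : ℕ) :
    chiSquared p = (stdGaussian (EuclideanSpace ℝ (Fin p))).map fun z => ‖z‖ ^ 2 := by
  rw [← map_pi_eq_stdGaussian, Measure.map_map (by fun_prop) (by fun_prop), chiSquared]
  congr 1
  funext z
  simp [EuclideanSpace.real_norm_sq_eq]

/-- The squared length of the projection of the normalized sum onto a subspace of dimension `p`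
is asymptotically chi-squared. -/
theorem IsIIDArray.tendstoInDistribution_sq_norm_proj [MeasurableSpace V] [BorelSpace V]
    (hX : IsIIDArray m X P μ) {h : 𝓧 → V}
    (hm : AEMeasurable h P) (hh : IsStandardized h P) (S : Submodule ℝ V) {p : ℕ}
    (hS : Module.finrank ℝ S = p) :
    TendstoInDistribution (fun n ω =>
      ‖S.starProjection (normSum fun i => normSum fun j => h (X n i j ω))‖ ^ 2) atTop id
      (fun _ => μ) (chiSquared p) := by
  let b := (stdOrthonormalBasis ℝ S).reindex (finCongr hS)
  -- Orthonormal coordinates of the projection onto `S`: `L` preserves the projected length, and `L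
  -- ∘ h` is standardized in dimension `p`.
  let L : V →L[ℝ] EuclideanSpace ℝ (Fin p) :=
    b.repr.toContinuousLinearEquiv.toContinuousLinearMap ∘L S.orthogonalProjectionOnto
  have hL : ∀ v, L v = b.repr (S.orthogonalProjectionOnto v) := fun v => rfl
  have hLn : ∀ v, ‖L v‖ = ‖S.starProjection v‖ := fun v => by
    rw [hL, LinearIsometryEquiv.norm_map]; rfl
  have hLi : ∀ t v, ⟪t, L v⟫ = ⟪((b.repr.symm t : S) : V), v⟫ := fun t v => by
    rw [hL, ← S.inner_orthogonalProjectionOnto_eq_of_mem_left, ← b.repr.inner_map_map]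
    simp
  have hst : IsStandardized (fun x => L (h x)) P :=
    { memLp := fun t => by simpa only [hLi] using hh.memLp _
      integral_eq := fun t => by simpa only [hLi] using hh.integral_eq _
      integral_sq_eq := fun t => by
        simp only [hLi, hh.integral_sq_eq]
        rw [← Submodule.coe_norm, LinearIsometryEquiv.norm_map] }
  have h1 := hX.tendstoInDistribution_normSum (L.continuous.measurable.comp_aemeasurable hm) hst
  have h2 := h1.continuous_comp (g := fun z => ‖z‖ ^ 2) (by fun_prop)
  have heq : ∀ n ω, ((fun z => ‖z‖ ^ 2) ∘ fun ω => normSum fun i => normSum fun j =>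
      L (h (X n i j ω))) ω =
      ‖S.starProjection (normSum fun i => normSum fun j => h (X n i j ω))‖ ^ 2 := fun n ω => by
    rw [Function.comp_apply, ← hLn]
    simp only [normSum, map_smul, map_sum]
  have h3 := h2.congr (fun n => ae_of_all _ (heq n)) (ae_eq_refl _)
  refine ⟨h3.forall_aemeasurable, aemeasurable_id, ?_⟩
  convert! h3.tendsto using 2
  refine congrArg 𝓝 (Subtype.ext ?_)
  change Measure.map id (chiSquared p) = _
  rw [Measure.map_id, chiSquared_eq_map]
  rfl

end Limits

/-! ### Increments at the local scale -/

section LocalIncrement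

variable {𝓧 T V : Type*} [NormedAddCommGroup T] [NormedSpace ℝ T]
  [NormedAddCommGroup V] [NormedSpace ℝ V] {n k : ℕ}

/-- The change of the (rescaled) normalized group sums of `h` at the data `x` when the parameter
moves from `θ₀` to `θ₀ + t / √N`. -/
noncomputable def localIncrement (h : 𝓧 → T → V) (θ₀ : T) (x : Fin n → Fin k → 𝓧) (t : T) :
    Fin n → V :=
  fun i => √n • ((√k)⁻¹ • ∑ j, (h (x i j) (θ₀ + (√((n : ℝ) * k))⁻¹ • t) - h (x i j) θ₀))

variable {h : 𝓧 → T → V} {h' : 𝓧 → T →L[ℝ] V} {H : 𝓧 → ℝ} {θ₀ t : T} {x : Fin n → Fin k → 𝓧}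

/-- The scalings combine to `√n · (√k)⁻¹ · (√(n k))⁻¹ = k⁻¹`, so the Lipschitz constant is the group
average of `H`. -/
lemma norm_localIncrement_le (hn : 0 < n) (hk : 0 < k)
    (hH : ∀ z, ‖h z (θ₀ + (√((n : ℝ) * k))⁻¹ • t) - h z θ₀‖ ≤ H z * ‖(√((n : ℝ) * k))⁻¹ • t‖)
    (i : Fin n) :
    ‖localIncrement h θ₀ x t i‖ ≤ ((k : ℝ)⁻¹ * ∑ j, H (x i j)) * ‖t‖ := by
  have hn' : (0 : ℝ) < √n := Real.sqrt_pos.2 (by exact_mod_cast hn)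
  have hk' : (0 : ℝ) < √k := Real.sqrt_pos.2 (by exact_mod_cast hk)
  have hk2 : (k : ℝ) = √k * √k := (Real.mul_self_sqrt (Nat.cast_nonneg k)).symm
  have h1 : ∀ j, ‖h (x i j) (θ₀ + (√((n : ℝ) * k))⁻¹ • t) - h (x i j) θ₀‖ ≤
      H (x i j) * ((√n * √k)⁻¹ * ‖t‖) := fun j => by
    refine (hH (x i j)).trans_eq ?_
    rw [norm_smul, Real.sqrt_mul (Nat.cast_nonneg n), Real.norm_of_nonneg (by positivity)]
  rw [localIncrement, norm_smul, norm_smul, Real.norm_of_nonneg hn'.le,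
    Real.norm_of_nonneg (inv_nonneg.2 hk'.le)]
  calc √n * ((√k)⁻¹ * ‖∑ j, (h (x i j) (θ₀ + (√((n : ℝ) * k))⁻¹ • t) - h (x i j) θ₀)‖)
      ≤ √n * ((√k)⁻¹ * ∑ j, H (x i j) * ((√n * √k)⁻¹ * ‖t‖)) := by
        gcongr
        exact norm_sum_le_of_le _ fun j _ => h1 j
    _ = _ := by
        rw [← Finset.sum_mul]
        nth_rewrite 3 [hk2]
        field_simp

lemma norm_avg_localIncrement_sub_le (hn : 0 < n) (hk : 0 < k)
    (hH : ∀ z, ‖h z (θ₀ + (√((n : ℝ) * k))⁻¹ • t) - h z θ₀ - h' z ((√((n : ℝ) * k))⁻¹ • t)‖ ≤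
      H z * ‖(√((n : ℝ) * k))⁻¹ • t‖ ^ 2) :
    ‖(n : ℝ)⁻¹ • ∑ i, localIncrement h θ₀ x t i - ((n : ℝ) * k)⁻¹ • ∑ i, ∑ j, h' (x i j) t‖ ≤
      (((n : ℝ) * k)⁻¹ * ∑ i, ∑ j, H (x i j)) * ((√((n : ℝ) * k))⁻¹ * ‖t‖) * ‖t‖ := by
  have hn0 : (0 : ℝ) < n := by exact_mod_cast hn
  have hk0 : (0 : ℝ) < k := by exact_mod_cast hk
  set s := √((n : ℝ) * k) with hs
  have hs0 : 0 < s := Real.sqrt_pos.2 (by positivity)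
  have hs2 : (n : ℝ) * k = s * s := (Real.mul_self_sqrt (by positivity)).symm
  have h1 : (n : ℝ)⁻¹ • ∑ i, localIncrement h θ₀ x t i =
      s⁻¹ • ∑ i, ∑ j, (h (x i j) (θ₀ + s⁻¹ • t) - h (x i j) θ₀) := by
    simp only [localIncrement, ← Finset.smul_sum, smul_smul, ← hs]
    congr 1
    rw [hs, Real.sqrt_mul hn0.le, mul_inv]
    have : (n : ℝ)⁻¹ * √n = (√n)⁻¹ := by
      nth_rewrite 1 [← Real.mul_self_sqrt hn0.le]
      have : √(n : ℝ) ≠ 0 := (Real.sqrt_pos.2 hn0).ne'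
      field_simp
    rw [← mul_assoc, this]
  have h2 : ((n : ℝ) * k)⁻¹ • ∑ i, ∑ j, h' (x i j) t =
      s⁻¹ • ∑ i, ∑ j, h' (x i j) (s⁻¹ • t) := by
    simp only [map_smul, ← Finset.smul_sum, smul_smul]
    rw [hs2, mul_inv]
  rw [h1, h2, ← smul_sub, ← Finset.sum_sub_distrib, norm_smul, Real.norm_of_nonneg
    (inv_nonneg.2 hs0.le)]
  simp only [← Finset.sum_sub_distrib]
  calc s⁻¹ * ‖∑ i, ∑ j, (h (x i j) (θ₀ + s⁻¹ • t) - h (x i j) θ₀ - h' (x i j) (s⁻¹ • t))‖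
      ≤ s⁻¹ * ∑ i, ∑ j, H (x i j) * ‖s⁻¹ • t‖ ^ 2 := by
        gcongr
        exact norm_sum_le_of_le _ fun i _ => norm_sum_le_of_le _ fun j _ => hH _
    _ = _ := by
        simp only [← Finset.sum_mul]
        rw [norm_smul, Real.norm_of_nonneg (inv_nonneg.2 hs0.le), hs2]
        ring

end LocalIncrement

section Perturbation

variable {Ω : Type*} [MeasurableSpace Ω] {μ : Measure Ω} [IsProbabilityMeasure μ]
  {𝓧 : Type*} [MeasurableSpace 𝓧] {P : Measure 𝓧} [IsProbabilityMeasure P]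
  {m : ℕ → ℕ} {X : (n : ℕ) → Fin n → Fin (m n) → Ω → 𝓧}

lemma tendsto_integral_sub_max_zero {H : 𝓧 → ℝ} (hH : Integrable H P) :
    Tendsto (fun L : ℕ => ∫ x, max (H x - L) 0 ∂P) atTop (𝓝 0) := by
  suffices h : Tendsto (fun L : ℕ => ∫ x, max (H x - L) 0 ∂P) atTop (𝓝 (∫ _, (0 : ℝ) ∂P)) by
    simpa using h
  refine tendsto_integral_of_dominated_convergence (fun x => |H x|) (fun L => ?_) hH.abs
    (fun L => ae_of_all _ fun x => ?_) (ae_of_all _ fun x => ?_)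
  · exact ((hH.sub (integrable_const (L : ℝ))).pos_part).aestronglyMeasurable
  · rw [Real.norm_of_nonneg (le_max_right _ _)]
    have : (0 : ℝ) ≤ L := Nat.cast_nonneg L
    exact max_le (by linarith [le_abs_self (H x)]) (abs_nonneg _)
  · refine tendsto_const_nhds.congr' ?_
    obtain ⟨K, hK⟩ := exists_nat_ge (H x)
    filter_upwards [eventually_ge_atTop K] with L hL
    have : (K : ℝ) ≤ L := by exact_mod_cast hL
    rw [max_eq_right (by linarith)]

/-- Truncate: `H ≤ L + (H - L)⁺`. The constant is eventually below `ε n / 2`, and a group average of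
the excess is at most `n` times its overall average, whose limit is below `ε / 2`. -/
lemma IsIIDArray.eventually_group_avg_le (hX : IsIIDArray m X P μ) {H : 𝓧 → ℝ}
    (hH : Integrable H P) {ε : ℝ} (hε : 0 < ε) :
    ∀ᶠ x : ℕ × Ω in inProb μ, ∀ i, (m x.1 : ℝ)⁻¹ * ∑ j, H (X x.1 i j x.2) ≤ ε * x.1 := by
  obtain ⟨L, hL⟩ := ((tendsto_integral_sub_max_zero hH).eventually_lt_const (half_pos hε)).exists
  have h1 := hX.tendsto_avg ((hH.sub (integrable_const (L : ℝ))).pos_part)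
  have h2 := h1.eventually_lt_const hL
  have h3 : ∀ᶠ x : ℕ × Ω in inProb μ, (L : ℝ) / (ε / 2) ≤ x.1 :=
    (tendsto_natCast_atTop_atTop.comp tendsto_fst_inProb).eventually_ge_atTop _
  filter_upwards [h2, h3, tendsto_fst_inProb.eventually_gt_atTop 0] with x h2 h3 h4 i
  have hn : (0 : ℝ) < x.1 := by exact_mod_cast h4
  have hm : (0 : ℝ) < m x.1 := by exact_mod_cast hX.pos x.1
  rw [div_le_iff₀ (half_pos hε)] at h3
  simp only [Pi.sub_apply] at h2
  have h5 : ∑ j, H (X x.1 i j x.2) ≤ m x.1 * L + ∑ j, max (H (X x.1 i j x.2) - L) 0 := by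
    calc ∑ j, H (X x.1 i j x.2) ≤ ∑ j, (L + max (H (X x.1 i j x.2) - L) 0) :=
          Finset.sum_le_sum fun j _ => by linarith [le_max_left (H (X x.1 i j x.2) - L) 0]
      _ = _ := by simp [Finset.sum_add_distrib]
  have h6 : ∑ j, max (H (X x.1 i j x.2) - L) 0 ≤
      ∑ i, ∑ j, max (H (X x.1 i j x.2) - L) 0 :=
    Finset.single_le_sum (f := fun i => ∑ j, max (H (X x.1 i j x.2) - L) 0)
      (fun i _ => Finset.sum_nonneg fun j _ => le_max_right _ _) (Finset.mem_univ i)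
  rw [inv_mul_lt_iff₀ (by positivity)] at h2
  rw [inv_mul_le_iff₀ hm]
  nlinarith [mul_le_mul_of_nonneg_left h3 hm.le]

variable {T V : Type*} [NormedAddCommGroup T] [InnerProductSpace ℝ T] [FiniteDimensional ℝ T]
  [NormedAddCommGroup V] [InnerProductSpace ℝ V] [FiniteDimensional ℝ V]

/-- For `‖t‖ ≤ N^(1/6)` the actual displacement is at most `N^(-1/3)`, eventually less than `r₀`.
The Taylor remainder is then at most the average of `H` times `N^(-1/3) ‖t‖`, and the linear part
converges by the law of large numbers. -/
theorem IsIIDArray.isELPerturbation (hX : IsIIDArray m X P μ) {h : 𝓧 → T → V} {θ₀ : T}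
    {h' : 𝓧 → T →L[ℝ] V} {H : 𝓧 → ℝ} (hH0 : ∀ z, 0 ≤ H z) (hH : Integrable H P) {r₀ : ℝ}
    (hr₀ : 0 < r₀) (h1 : ∀ z s, ‖s‖ ≤ r₀ → ‖h z (θ₀ + s) - h z θ₀‖ ≤ H z * ‖s‖)
    (h2 : ∀ z s, ‖s‖ ≤ r₀ → ‖h z (θ₀ + s) - h z θ₀ - h' z s‖ ≤ H z * ‖s‖ ^ 2)
    {D : T →L[ℝ] V} (hint : ∀ v t, Integrable (fun z => ⟪v, h' z t⟫) P)
    (hD : ∀ v t, ∫ z, ⟪v, h' z t⟫ ∂P = ⟪v, D t⟫) :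
    IsELPerturbation (inProb μ) Prod.fst
      (fun x : ℕ × Ω => localIncrement h θ₀ fun i j => X x.1 i j x.2)
      (fun x i => (m x.1 : ℝ)⁻¹ * ∑ j, H (X x.1 i j x.2)) D
      (fun x => ((x.1 : ℝ) * m x.1) ^ (1 / 6 : ℝ)) := by
  have hN : Tendsto (fun x : ℕ × Ω => (x.1 : ℝ) * m x.1) (inProb μ) atTop := by
    refine tendsto_atTop_mono (fun x => ?_)
      (tendsto_natCast_atTop_atTop.comp (tendsto_fst_inProb (μ := μ)))
    exact le_mul_of_one_le_right (Nat.cast_nonneg _) (by exact_mod_cast hX.pos x.1)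
  have hrad : ∀ N : ℝ, 0 < N → (√N)⁻¹ * N ^ (1 / 6 : ℝ) = N ^ (-(1 / 3) : ℝ) := fun N hN => by
    rw [Real.sqrt_eq_rpow, ← Real.rpow_neg hN.le, ← Real.rpow_add hN]
    norm_num
  have hlim : Tendsto (fun x : ℕ × Ω => ((x.1 : ℝ) * m x.1) ^ (-(1 / 3) : ℝ)) (inProb μ) (𝓝 0) :=
    (tendsto_rpow_neg_atTop (by norm_num)).comp hN
  have hball : ∀ N : ℝ, 0 < N → ∀ t : T, ‖t‖ ≤ N ^ (1 / 6 : ℝ) →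
      ‖(√N)⁻¹ • t‖ ≤ N ^ (-(1 / 3) : ℝ) := fun N hN t ht => by
    rw [norm_smul, Real.norm_of_nonneg (by positivity), ← hrad N hN]
    gcongr
  constructor
  · filter_upwards [tendsto_fst_inProb.eventually_gt_atTop 0, hN.eventually_gt_atTop 0,
      hlim.eventually_le_const hr₀] with x hn hN0 hr t ht i
    exact norm_localIncrement_le hn (hX.pos x.1)
      (fun z => h1 z _ ((hball _ hN0 t ht).trans hr)) i
  · exact Eventually.of_forall fun x i =>
      mul_nonneg (by positivity) (Finset.sum_nonneg fun j _ => hH0 _)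
  · exact fun ε hε => hX.eventually_group_avg_le hH hε
  · refine ⟨∫ z, H z ∂P + 1, ?_⟩
    filter_upwards [(hX.tendsto_avg hH).eventually_le_const (lt_add_one _)] with x hx
    rw [← Finset.mul_sum, ← mul_assoc, ← mul_inv]
    exact hx
  · intro ε hε
    have hA : ∀ᶠ x : ℕ × Ω in inProb μ, ∀ t, ‖(((x.1 : ℝ) * m x.1)⁻¹ •
        ∑ i, ∑ j, h' (X x.1 i j x.2) - D) t‖ ≤ ε / 2 * ‖t‖ := by
      refine eventually_norm_apply_le (fun v t => ?_) (half_pos hε)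
      have := (hX.tendsto_avg (hint v t)).sub_const (⟪v, D t⟫)
      rw [hD, sub_self] at this
      refine this.congr fun x => ?_
      simp [inner_sub_right, real_inner_smul_right, inner_sum]
    have hB : Tendsto (fun x : ℕ × Ω => (((x.1 : ℝ) * m x.1)⁻¹ * ∑ i, ∑ j, H (X x.1 i j x.2)) *
        ((x.1 : ℝ) * m x.1) ^ (-(1 / 3) : ℝ)) (inProb μ) (𝓝 0) := by
      simpa using (hX.tendsto_avg hH).mul hlim
    filter_upwards [hA, hB.eventually_le_const (half_pos hε),
      tendsto_fst_inProb.eventually_gt_atTop 0, hN.eventually_gt_atTop 0,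
      hlim.eventually_le_const hr₀] with x hA hB hn hN0 hr t ht
    have h3 := norm_avg_localIncrement_sub_le (x := fun i j => X x.1 i j x.2) (t := t) hn
      (hX.pos x.1) (fun z => h2 z _ ((hball _ hN0 t ht).trans hr))
    have h4 := hA t
    have h5 : (((x.1 : ℝ) * m x.1)⁻¹ * ∑ i, ∑ j, H (X x.1 i j x.2)) *
        ((√((x.1 : ℝ) * m x.1))⁻¹ * ‖t‖) ≤ ε / 2 := by
      refine (mul_le_mul_of_nonneg_left ?_ (mul_nonneg (by positivity)
        (Finset.sum_nonneg fun i _ => Finset.sum_nonneg fun j _ => hH0 _))).trans hB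
      rw [← hrad _ hN0]
      gcongr
    have h6 := mul_le_mul_of_nonneg_right h5 (norm_nonneg t)
    have h7 : (((x.1 : ℝ) * m x.1)⁻¹ • ∑ i, ∑ j, h' (X x.1 i j x.2) - D) t =
        ((x.1 : ℝ) * m x.1)⁻¹ • ∑ i, ∑ j, h' (X x.1 i j x.2) t - D t := by
      simp
    rw [h7] at h4
    have h8 := norm_sub_le_norm_sub_add_norm_sub
      ((x.1 : ℝ)⁻¹ • ∑ i, localIncrement h θ₀ (fun i j => X x.1 i j x.2) t i)
      (((x.1 : ℝ) * m x.1)⁻¹ • ∑ i, ∑ j, h' (X x.1 i j x.2) t) (D t)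
    linarith
  · exact (tendsto_rpow_atTop (by norm_num)).comp hN

end Perturbation

section Local

variable {𝓧 T V : Type*} [NormedAddCommGroup T] [NormedSpace ℝ T]
  [NormedAddCommGroup V] [InnerProductSpace ℝ V]

lemma elPerturb_localIncrement {n k : ℕ} (hn : 0 < n) (h : 𝓧 → T → V) (θ₀ t : T)
    (x : Fin n → Fin k → 𝓧) :
    elPerturb (fun i => normSum fun j => h (x i j) θ₀) (localIncrement h θ₀ x) t =
      fun i => normSum fun j => h (x i j) (θ₀ + (√((n : ℝ) * k))⁻¹ • t) := by
  have hn' : √(n : ℝ) ≠ 0 := (Real.sqrt_pos.2 (by exact_mod_cast hn)).ne'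
  funext i
  simp only [elPerturb, localIncrement, normSum]
  rw [inv_smul_smul₀ hn', ← smul_add, Finset.sum_sub_distrib, add_sub_cancel]

end Local

/-! ### Reduction of the grouped ratio to an ordinary one -/

section ELRatio

variable {V W : Type*} [NormedAddCommGroup V] [InnerProductSpace ℝ V]
  [NormedAddCommGroup W] [InnerProductSpace ℝ W] {n : ℕ}

lemma elRatio_comp_injective {A : V →ₗ[ℝ] W} (hA : Function.Injective A) (y : Fin n → V) :
    elRatio (fun i => A (y i)) = elRatio y := by
  have h : elWeights (fun i => A (y i)) = elWeights y := by
    ext u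
    have h1 : ∑ i, u i • A (y i) = A (∑ i, u i • y i) := by simp
    simp only [elWeights, Set.mem_ofPred_eq, h1, map_eq_zero_iff A hA]
  rw [elRatio, h, elRatio]

lemma elRatio_smul {c : ℝ} (hc : c ≠ 0) (y : Fin n → V) :
    elRatio (fun i => c • y i) = elRatio y := by
  have hA : Function.Injective (DistribSMul.toLinearMap ℝ V c) := smul_right_injective V hc
  exact elRatio_comp_injective hA y

end ELRatio

section GELRatio

variable {d p r n m : ℕ}
  {g : EuclideanSpace ℝ (Fin d) → EuclideanSpace ℝ (Fin p) → EuclideanSpace ℝ (Fin r)}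

/-- The grouped empirical likelihood ratio is a power of the empirical likelihood ratio of the
group sums. -/
lemma gelRatio_eq_pow (hn : 0 < n) (hm : 0 < m)
    (x : Fin n → Fin m → EuclideanSpace ℝ (Fin d)) (θ : EuclideanSpace ℝ (Fin p)) :
    gelRatio g x θ = elRatio (fun i => ∑ j, g (x i j) θ) ^ m := by
  have hn' : (0 : ℝ) < n := by exact_mod_cast hn
  have hm' : (0 : ℝ) < m := by exact_mod_cast hm
  set y : Fin n → EuclideanSpace ℝ (Fin r) := fun i => ∑ j, g (x i j) θ
  have hset : {L : ℝ | ∃ q : Fin n → ℝ, (∀ i, 0 ≤ q i) ∧ ∑ i, q i = 1 / (m : ℝ) ∧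
      ∑ i, q i • ∑ j, g (x i j) θ = 0 ∧ L = ∏ i, ((n : ℝ) * (m : ℝ) * q i) ^ m} =
      (fun u : Fin n → ℝ => (∏ i, u i) ^ m) '' elWeights y := by
    ext L
    constructor
    · rintro ⟨q, h0, h1, h2, rfl⟩
      refine ⟨fun i => n * m * q i, ⟨fun i => mul_nonneg (by positivity) (h0 i), ?_, ?_⟩, ?_⟩
      · rw [← Finset.mul_sum, h1]; field_simp
      · simp only [mul_smul, ← Finset.smul_sum]
        rw [show ∑ i, q i • y i = 0 from h2]; simp
      · simp only [Finset.prod_pow]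
    · rintro ⟨u, ⟨h0, h1, h2⟩, rfl⟩
      refine ⟨fun i => ((n : ℝ) * m)⁻¹ * u i, fun i => mul_nonneg (by positivity) (h0 i),
        ?_, ?_, ?_⟩
      · rw [← Finset.mul_sum, h1]; field_simp
      · simp only [mul_smul, ← Finset.smul_sum]
        rw [show ∑ i, u i • ∑ j, g (x i j) θ = 0 from h2]; simp
      · rw [Finset.prod_pow]
        simp only [mul_inv_cancel_left₀ (show (n : ℝ) * m ≠ 0 by positivity)]
  rw [gelRatio, hset]
  rcases (elWeights y).eq_empty_or_nonempty with he | hne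
  · simp [elRatio, he, hm.ne']
  · obtain ⟨u, hu, hmax, hue⟩ := exists_isMaxOn_elWeights hne
    refine IsGreatest.csSup_eq ⟨⟨u, hu, by rw [← hue]⟩, ?_⟩
    rintro _ ⟨w, hw, rfl⟩
    exact pow_le_pow_left₀ (Finset.prod_nonneg fun i _ => hw.1 i) (prod_le_elRatio hw) m

lemma gelRatio_eq_elRatio_normSum {V : Type*} [NormedAddCommGroup V] [InnerProductSpace ℝ V]
    {A : EuclideanSpace ℝ (Fin r) →ₗ[ℝ] V} (hA : Function.Injective A) (hn : 0 < n) (hm : 0 < m)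
    (x : Fin n → Fin m → EuclideanSpace ℝ (Fin d)) (θ : EuclideanSpace ℝ (Fin p)) :
    gelRatio g x θ = elRatio (fun i => normSum fun j => A (g (x i j) θ)) ^ m := by
  have hm' : (√(m : ℝ))⁻¹ ≠ 0 := inv_ne_zero (Real.sqrt_pos.2 (by exact_mod_cast hm)).ne'
  rw [gelRatio_eq_pow hn hm, ← elRatio_comp_injective hA, ← elRatio_smul hm']
  simp only [normSum, map_sum]

/-- With no groups the weights cannot sum to `1 / m`. This covers `n = 0`, where the power formula
is not used. -/
lemma gelRatio_zero_left (x : Fin 0 → Fin m → EuclideanSpace ℝ (Fin d)) (hm : 0 < m)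
    (θ : EuclideanSpace ℝ (Fin p)) : gelRatio g x θ = 0 := by
  have hm' : (m : ℝ) ≠ 0 := by exact_mod_cast hm.ne'
  simp [gelRatio, eq_comm, hm']

end GELRatio

/-! ### Existence and measurability of the maximum -/

section Measurability

/-- The set of the parameters `z` for which `F z` has a zero in the compact set `C` is measurable:
for continuous `F z` it suffices that `F z` is arbitrarily small on a countable dense subset. -/
lemma measurableSet_exists_eq_zero {𝓩 S V : Type*} [MeasurableSpace 𝓩] [TopologicalSpace S]
    [SecondCountableTopology S] [NormedAddCommGroup V] [MeasurableSpace V] [BorelSpace V]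
    {C : Set S} (hC : IsCompact C)
    {F : 𝓩 → S → V} (hF : ∀ s ∈ C, Measurable fun z => F z s)
    (hFc : ∀ z, ContinuousOn (F z) C) : MeasurableSet {z | ∃ s ∈ C, F z s = 0} := by
  obtain ⟨D, hDc, hD⟩ := TopologicalSpace.exists_countable_dense C
  have key : {z | ∃ s ∈ C, F z s = 0} =
      ⋂ j : ℕ, ⋃ s ∈ D, {z | ‖F z (s : C)‖ < 1 / ((j : ℝ) + 1)} := by
    ext z
    simp only [Set.mem_ofPred_eq, Set.mem_iInter, Set.mem_iUnion, exists_prop]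
    have hcont : Continuous fun s : C => ‖F z s‖ := (hFc z).domRestrict.norm
    constructor
    · rintro ⟨s, hs, h0⟩ j
      have hopen : IsOpen {s : C | ‖F z s‖ < 1 / ((j : ℝ) + 1)} :=
        isOpen_lt hcont continuous_const
      obtain ⟨t, htD, ht⟩ := hD.exists_mem_open hopen ⟨⟨s, hs⟩, by
        simp only [Set.mem_ofPred_eq, h0, norm_zero]; positivity⟩
      exact ⟨t, htD, ht⟩
    · intro h
      obtain ⟨s0, -, -⟩ := h 0
      have : CompactSpace C := isCompact_iff_compactSpace.1 hC
      obtain ⟨s, -, hs⟩ := isCompact_univ.exists_isMinOn ⟨s0, Set.mem_univ s0⟩ hcont.continuousOn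
      refine ⟨s, s.2, norm_le_zero_iff.1 (le_of_forall_pos_lt_add fun ε hε => ?_)⟩
      obtain ⟨j, hj⟩ := exists_nat_one_div_lt hε
      obtain ⟨t, -, ht⟩ := h j
      rw [zero_add]
      exact ((hs (Set.mem_univ t)).trans_lt ht).trans hj
  rw [key]
  refine MeasurableSet.iInter fun j => MeasurableSet.biUnion hDc fun s _ => ?_
  exact measurableSet_lt (hF s s.2).norm measurable_const

variable {T V : Type*} [NormedAddCommGroup V] [InnerProductSpace ℝ V] {n : ℕ}

lemma isCompact_simplex_prod_ge (n : ℕ) (c : ℝ) :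
    IsCompact {u : Fin n → ℝ | (∀ i, 0 ≤ u i) ∧ ∑ i, u i = n ∧ c ≤ ∏ i, u i} := by
  have h := isCompact_elWeights (fun _ : Fin n => (0 : ℝ))
  have h2 : IsClosed {u : Fin n → ℝ | c ≤ ∏ i, u i} :=
    isClosed_le continuous_const (by fun_prop)
  convert! h.inter_right h2 using 1
  ext u
  simp [elWeights, and_assoc]

lemma le_elRatio_iff {y : Fin n → V} {c : ℝ} (hc : 0 < c) : c ≤ elRatio y ↔
    ∃ u : Fin n → ℝ, ((∀ i, 0 ≤ u i) ∧ ∑ i, u i = n ∧ c ≤ ∏ i, u i) ∧ ∑ i, u i • y i = 0 := by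
  constructor
  · intro h
    obtain ⟨u, hu, hue⟩ := exists_prod_eq_elRatio (hc.trans_le h)
    exact ⟨u, ⟨hu.1, hu.2.1, by rwa [hue]⟩, hu.2.2⟩
  · rintro ⟨u, ⟨h0, h1, h2⟩, h3⟩
    exact h2.trans (prod_le_elRatio ⟨h0, h1, h3⟩)

variable [TopologicalSpace T]

/-- Continuity of the ratio in `θ` is not needed: the product of weights is maximized over the
compact set of feasible pairs `(θ, u)`. If the ratio is nowhere positive, every point is a
maximizer. -/
lemma exists_isMaxOn_elRatio {K : Set T} (hK : IsCompact K) (hne : K.Nonempty) {y : T → Fin n → V}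
    (hy : ∀ i, ContinuousOn (fun θ => y θ i) K) :
    ∃ θ ∈ K, IsMaxOn (fun θ => elRatio (y θ)) K θ := by
  by_cases h : ∃ θ ∈ K, 0 < elRatio (y θ)
  swap
  · push Not at h
    obtain ⟨θ, hθ⟩ := hne
    exact ⟨θ, hθ, fun θ' hθ' => (h θ' hθ').trans (elRatio_nonneg _)⟩
  have hcont : ContinuousOn (fun z : T × (Fin n → ℝ) => ∑ i, z.2 i • y z.1 i)
      (K ×ˢ elWeights (fun _ : Fin n => (0 : ℝ))) := by
    refine continuousOn_finsetSum _ fun i _ => ContinuousOn.smul ?_ ?_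
    · exact ((continuous_apply i).comp continuous_snd).continuousOn
    · exact (hy i).comp continuous_fst.continuousOn fun z hz => hz.1
  set S : Set (T × (Fin n → ℝ)) := {z | z ∈ K ×ˢ elWeights (fun _ : Fin n => (0 : ℝ)) ∧
    ∑ i, z.2 i • y z.1 i = 0}
  have hS : IsCompact S := by
    have hc := hK.prod (isCompact_elWeights (fun _ : Fin n => (0 : ℝ)))
    obtain ⟨C, hC, hCS⟩ := (continuousOn_iff_isClosed.1 hcont) {0} isClosed_singleton
    have : S = (K ×ˢ elWeights (fun _ : Fin n => (0 : ℝ))) ∩ C := by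
      rw [Set.inter_comm, ← hCS]
      ext z; simp only [S, Set.mem_ofPred_eq, Set.mem_inter_iff, Set.mem_preimage,
        Set.mem_singleton_iff]; tauto
    rw [this]
    exact hc.inter_right hC
  have hmem : ∀ θ ∈ K, ∀ u ∈ elWeights (y θ), (θ, u) ∈ S := fun θ hθ u hu =>
    ⟨⟨hθ, hu.1, hu.2.1, by simp⟩, hu.2.2⟩
  obtain ⟨θ₁, hθ₁, hpos⟩ := h
  obtain ⟨u₁, hu₁, -⟩ := exists_prod_eq_elRatio hpos
  obtain ⟨z, hz, hmax⟩ := hS.exists_isMaxOn ⟨_, hmem _ hθ₁ _ hu₁⟩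
    (f := fun z => ∏ i, z.2 i) (by fun_prop)
  refine ⟨z.1, hz.1.1, fun θ hθ => ?_⟩
  have hz' : z.2 ∈ elWeights (y z.1) := ⟨hz.1.2.1, hz.1.2.2.1, hz.2⟩
  rcases (elRatio_nonneg (y θ)).eq_or_lt with h0 | h0
  · change elRatio (y θ) ≤ _
    rw [← h0]; exact elRatio_nonneg _
  · obtain ⟨u, hu, hue⟩ := exists_prod_eq_elRatio h0
    change elRatio (y θ) ≤ _
    rw [← hue]
    exact (hmax (hmem _ hθ _ hu)).trans (prod_le_elRatio hz')

/-- Measurability of the maximal empirical likelihood ratio over a compact parameter set. -/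
lemma measurable_of_isMaxOn_elRatio {𝓩 : Type*} [MeasurableSpace 𝓩] [FiniteDimensional ℝ V]
    [SecondCountableTopology T] {K : Set T}
    (hK : IsCompact K) {y : 𝓩 → T → Fin n → V} [MeasurableSpace V] [BorelSpace V]
    (hm : ∀ θ ∈ K, ∀ i, Measurable fun z => y z θ i)
    (hc : ∀ z i, ContinuousOn (fun θ => y z θ i) K) {θ : 𝓩 → T} (hθ : ∀ z, θ z ∈ K)
    (hmax : ∀ z, IsMaxOn (fun θ => elRatio (y z θ)) K (θ z)) :
    Measurable fun z => elRatio (y z (θ z)) := by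
  refine measurable_of_Ici fun c => ?_
  rcases le_or_gt c 0 with hc0 | hc0
  · convert! MeasurableSet.univ
    ext z
    simpa using hc0.trans (elRatio_nonneg _)
  -- The superlevel set no longer mentions the selection `θ z`, so no measurability of the maximizer
  -- is required.
  have h1 : (fun z => elRatio (y z (θ z))) ⁻¹' Set.Ici c = {z | ∃ s ∈ K ×ˢ
      {u : Fin n → ℝ | (∀ i, 0 ≤ u i) ∧ ∑ i, u i = n ∧ c ≤ ∏ i, u i},
        ∑ i, s.2 i • y z s.1 i = 0} := by
    ext z
    simp only [Set.mem_preimage, Set.mem_Ici, Set.mem_ofPred_eq]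
    constructor
    · intro h
      obtain ⟨u, hu, hu0⟩ := (le_elRatio_iff hc0).1 h
      exact ⟨(θ z, u), ⟨hθ z, hu⟩, hu0⟩
    · rintro ⟨⟨t, u⟩, ⟨ht, hu⟩, h0⟩
      exact ((le_elRatio_iff hc0).2 ⟨u, hu, h0⟩).trans (hmax z ht)
  rw [h1]
  refine measurableSet_exists_eq_zero (hK.prod (isCompact_simplex_prod_ge n c))
    (fun s hs => ?_) fun z => ?_
  · exact Finset.measurable_sum _ fun i _ => (hm s.1 hs.1 i).const_smul (s.2 i)
  · refine continuousOn_finsetSum _ fun i _ => ContinuousOn.smul ?_ ?_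
    · exact ((continuous_apply i).comp continuous_snd).continuousOn
    · exact (hc z i).comp continuous_fst.continuousOn fun s hs => hs.1

end Measurability

/-! ### Whitening -/

section Whitening

-- Factor `M = Bᵀ B`; positive definiteness makes `B` injective, hence invertible.
open scoped MatrixOrder Matrix in
lemma Matrix.PosDef.exists_sum_eq_norm_sq {r : ℕ} {M : Matrix (Fin r) (Fin r) ℝ} (hM : M.PosDef) :
    ∃ L : EuclideanSpace ℝ (Fin r) ≃ₗ[ℝ] EuclideanSpace ℝ (Fin r),
      ∀ v : EuclideanSpace ℝ (Fin r), ∑ a, ∑ b, v a * v b * M a b = ‖L v‖ ^ 2 := by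
  have hM0 : ∀ v : EuclideanSpace ℝ (Fin r),
      ∑ a, ∑ b, v a * v b * M a b = v.ofLp ⬝ᵥ (M *ᵥ v.ofLp) := fun v => by
    simp only [dotProduct, Matrix.mulVec, Finset.mul_sum]
    exact Finset.sum_congr rfl fun a _ => Finset.sum_congr rfl fun b _ => by ring
  obtain ⟨B, hB⟩ := CStarAlgebra.nonneg_iff_eq_star_mul_self.mp hM.posSemidef.nonneg
  have hBv : ∀ v : EuclideanSpace ℝ (Fin r),
      ∑ a, ∑ b, v a * v b * M a b = ‖Matrix.toEuclideanLin B v‖ ^ 2 := fun v => by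
    rw [hM0, hB, EuclideanSpace.norm_sq_eq, ← Matrix.mulVec_mulVec, Matrix.dotProduct_mulVec,
      Matrix.star_eq_conjTranspose, Matrix.vecMul_conjTranspose]
    simp only [dotProduct, star_trivial, Real.norm_eq_abs, sq, abs_mul_abs_self]
    rfl
  have hinj : Function.Injective (Matrix.toEuclideanLin B) := by
    rw [injective_iff_map_eq_zero]
    intro v hv
    by_contra hv0
    have h1 := hM.dotProduct_mulVec_pos (x := v.ofLp) fun h => hv0 (by ext a; simp [h])
    rw [star_trivial, ← hM0, hBv, hv] at h1
    simp at h1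
  exact ⟨LinearEquiv.ofInjectiveEndo _ hinj, hBv⟩

variable {𝓧 : Type*} [MeasurableSpace 𝓧] {P : Measure 𝓧} {r : ℕ}

/-- A centered square integrable random vector with positive definite second moment matrix can be
standardized by an invertible linear map. -/
lemma exists_isStandardized {f : 𝓧 → EuclideanSpace ℝ (Fin r)} (hf : MemLp f 2 P)
    [IsFiniteMeasure P]
    (hf0 : ∫ x, f x ∂P = 0) (hM : (Matrix.of fun a b : Fin r => ∫ x, f x a * f x b ∂P).PosDef) :
    ∃ A : EuclideanSpace ℝ (Fin r) →L[ℝ] EuclideanSpace ℝ (Fin r), Function.Injective A ∧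
      IsStandardized (fun x => A (f x)) P := by
  obtain ⟨L, hL⟩ := hM.exists_sum_eq_norm_sq
  have hint : Integrable f P := hf.integrable one_le_two
  have hcoord : ∀ a, MemLp (fun x => f x a) 2 P := fun a =>
    hf.continuousLinearMap_comp (EuclideanSpace.proj (𝕜 := ℝ) a)
  have hsq : ∀ v : EuclideanSpace ℝ (Fin r), ∫ x, ⟪v, f x⟫ ^ 2 ∂P = ‖L v‖ ^ 2 := fun v => by
    rw [← hL]
    have h1 : ∀ x, ⟪v, f x⟫ ^ 2 = ∑ a, ∑ b, v a * v b * (f x a * f x b) := fun x => by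
      rw [PiLp.inner_apply, sq, Finset.sum_mul_sum]
      exact Finset.sum_congr rfl fun a _ => Finset.sum_congr rfl fun b _ => by
        simp only [RCLike.inner_apply, conj_trivial]; ring
    have h2 : ∀ a b, Integrable (fun x => v a * v b * (f x a * f x b)) P := fun a b =>
      ((hcoord a).integrable_mul (hcoord b)).const_mul _
    simp only [h1]
    rw [integral_finsetSum _ fun a _ => integrable_finsetSum _ fun b _ => h2 a b]
    refine Finset.sum_congr rfl fun a _ => ?_
    rw [integral_finsetSum _ fun b _ => h2 a b]
    exact Finset.sum_congr rfl fun b _ => integral_const_mul _ _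
  -- With the inverse transpose of `L`, the second moment of `A f` in direction `v` is `‖L (L⁻¹ v)‖²
  -- = ‖v‖²`.
  let A := LinearMap.toContinuousLinearMap (LinearMap.adjoint L.symm.toLinearMap)
  have hA : ∀ v w, ⟪v, A w⟫ = ⟪L.symm v, w⟫ := fun v w =>
    LinearMap.adjoint_inner_right L.symm.toLinearMap v w
  refine ⟨A, ?_, ?_, ?_, ?_⟩
  · rw [injective_iff_map_eq_zero]
    intro w hw
    have h := hA (L w) w
    rw [hw, inner_zero_right, L.symm_apply_apply] at h
    exact inner_self_eq_zero.1 h.symm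
  · intro v
    simp only [hA]
    exact hf.const_inner _
  · intro v
    simp only [hA]
    rw [integral_inner hint, hf0, inner_zero_right]
  · intro v
    simp only [hA]
    rw [hsq, L.apply_symm_apply]

end Whitening

/-! ### Taylor bounds and the mean derivative -/

section MeanValue

variable {T V : Type*} [NormedAddCommGroup T] [NormedSpace ℝ T] [NormedAddCommGroup V]
  [NormedSpace ℝ V] {f : T → V} {θ₀ : T} {r₀ C : ℝ}

lemma norm_image_add_sub_le (hf : ∀ θ ∈ Metric.closedBall θ₀ r₀, DifferentiableAt ℝ f θ)
    (hC : ∀ θ ∈ Metric.closedBall θ₀ r₀, ‖fderiv ℝ f θ‖ ≤ C) {s : T} (hs : ‖s‖ ≤ r₀) :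
    ‖f (θ₀ + s) - f θ₀‖ ≤ C * ‖s‖ := by
  have h := (convex_closedBall θ₀ r₀).norm_image_sub_le_of_norm_fderiv_le hf hC
    (x := θ₀) (y := θ₀ + s) (by simpa using (norm_nonneg s).trans hs) (by simpa using hs)
  simpa using h

/-- The mean value inequality is used twice, on the ball of radius `‖s‖`, where the derivative
varies by at most `C ‖s‖`. -/
lemma norm_image_add_sub_sub_le (hf : ∀ θ ∈ Metric.closedBall θ₀ r₀, DifferentiableAt ℝ f θ)
    (hf' : ∀ θ ∈ Metric.closedBall θ₀ r₀, DifferentiableAt ℝ (fderiv ℝ f) θ)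
    (hC : ∀ θ ∈ Metric.closedBall θ₀ r₀, ‖fderiv ℝ (fderiv ℝ f) θ‖ ≤ C) {s : T} (hs : ‖s‖ ≤ r₀) :
    ‖f (θ₀ + s) - f θ₀ - fderiv ℝ f θ₀ s‖ ≤ C * ‖s‖ ^ 2 := by
  have hC0 : 0 ≤ C := le_trans (norm_nonneg (fderiv ℝ (fderiv ℝ f) θ₀))
    (hC θ₀ (by simpa using (norm_nonneg s).trans hs))
  have hsub : Metric.closedBall θ₀ ‖s‖ ⊆ Metric.closedBall θ₀ r₀ :=
    Metric.closedBall_subset_closedBall hs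
  have h := (convex_closedBall θ₀ ‖s‖).norm_image_sub_le_of_norm_fderiv_le'
    (φ := fderiv ℝ f θ₀) (C := C * ‖s‖) (fun θ hθ => hf θ (hsub hθ)) (fun θ hθ => ?_)
    (x := θ₀) (y := θ₀ + s) (by simp) (by simp)
  · simpa [sq, mul_assoc] using h
  · have hθ' : ‖θ - θ₀‖ ≤ ‖s‖ := by simpa [dist_eq_norm] using hθ
    have h1 := norm_image_add_sub_le hf' hC (hθ'.trans hs)
    rw [add_sub_cancel] at h1
    exact h1.trans (mul_le_mul_of_nonneg_left hθ' hC0)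

end MeanValue

section Derivative

variable {𝓧 : Type*} [MeasurableSpace 𝓧] {P : Measure 𝓧}
  {T V : Type*} [NormedAddCommGroup T] [NormedSpace ℝ T] [NormedAddCommGroup V]
  [NormedSpace ℝ V] [MeasurableSpace V] [BorelSpace V] [SecondCountableTopology V]

/-- A pointwise limit of difference quotients along `θ₀ + t / k`, with indices shifted so that all
these points lie where `g` is measurable. -/
lemma measurable_fderiv_apply_of_nhds {g : 𝓧 → T → V} {θ₀ : T}
    (hm : ∀ᶠ θ in 𝓝 θ₀, Measurable fun x => g x θ)
    (hd : ∀ x, DifferentiableAt ℝ (g x) θ₀) (t : T) :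
    Measurable fun x => fderiv ℝ (g x) θ₀ t := by
  have h1 : Tendsto (fun k : ℕ => θ₀ + (k : ℝ)⁻¹ • t) atTop (𝓝 θ₀) := by
    simpa using (tendsto_inv_atTop_nhds_zero_nat (𝕜 := ℝ)).smul_const t |>.const_add θ₀
  obtain ⟨K, hK⟩ := eventually_atTop.1 (h1.eventually hm)
  have h2 : Tendsto (fun k : ℕ => ‖((k + K : ℕ) : ℝ)‖) atTop atTop := by
    simp only [Real.norm_natCast]
    exact tendsto_natCast_atTop_atTop.comp (tendsto_add_atTop_nat K)
  refine measurable_of_tendsto_metrizable (f := fun (k : ℕ) x =>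
    ((k + K : ℕ) : ℝ) • (g x (θ₀ + ((k + K : ℕ) : ℝ)⁻¹ • t) - g x θ₀)) (fun k => ?_) ?_
  · exact ((hK _ (Nat.le_add_left K k)).sub hm.self_of_nhds).const_smul _
  · rw [tendsto_pi_nhds]
    exact fun x => (hd x).hasFDerivAt.lim t h2

end Derivative

section MeanDerivative

variable {𝓧 : Type*} [MeasurableSpace 𝓧] {P : Measure 𝓧} {p r : ℕ}
  {f' : 𝓧 → EuclideanSpace ℝ (Fin p) →L[ℝ] EuclideanSpace ℝ (Fin r)}

/-- The mean is taken vector by vector, which avoids integrating an operator-valued function. Rank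
`p` leaves a trivial kernel by rank-nullity. -/
lemma exists_injective_integral_apply (hint : ∀ t, Integrable (fun x => f' x t) P)
    (hrank : (Matrix.of fun (a : Fin r) (b : Fin p) =>
      ∫ x, f' x (EuclideanSpace.single b 1) a ∂P).rank = p) :
    ∃ D : EuclideanSpace ℝ (Fin p) →L[ℝ] EuclideanSpace ℝ (Fin r), Function.Injective D ∧
      ∀ t, D t = ∫ x, f' x t ∂P := by
  let D₀ : EuclideanSpace ℝ (Fin p) →ₗ[ℝ] EuclideanSpace ℝ (Fin r) :=
    { toFun := fun t => ∫ x, f' x t ∂P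
      map_add' := fun s t => by simp only [map_add]; exact integral_add (hint s) (hint t)
      map_smul' := fun c t => by simp only [map_smul]; exact integral_smul c _ }
  have hD₀ : ∀ t, D₀ t = ∫ x, f' x t ∂P := fun t => rfl
  refine ⟨LinearMap.toContinuousLinearMap D₀, ?_, fun t => rfl⟩
  set M : Matrix (Fin r) (Fin p) ℝ := Matrix.of fun (a : Fin r) (b : Fin p) =>
      ∫ x, f' x (EuclideanSpace.single b 1) a ∂P with hM
  have hker : M.mulVecLin.ker = ⊥ := by
    have h1 := M.mulVecLin.finrank_range_add_finrank_ker
    rw [Module.finrank_fin_fun] at h1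
    have h2 : Module.finrank ℝ M.mulVecLin.range = p := hrank
    exact Submodule.finrank_eq_zero.1 (by omega)
  have hDM : ∀ t a, D₀ t a = M.mulVecLin t.ofLp a := fun t a => by
    have h1 : t = ∑ b, t b • EuclideanSpace.single b (1 : ℝ) := by
      ext b; simp [Finset.sum_apply, Pi.single_apply]
    have h2 : ∀ b, D₀ (EuclideanSpace.single b 1) a = M a b := fun b => by
      rw [hD₀]
      exact ((EuclideanSpace.proj (𝕜 := ℝ) a).integral_comp_comm (hint _)).symm
    conv_lhs => rw [h1]
    simp only [map_sum, map_smul, WithLp.ofLp_sum, Finset.sum_apply, PiLp.smul_apply, smul_eq_mul,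
      h2, Matrix.mulVecLin_apply, Matrix.mulVec, dotProduct]
    exact Finset.sum_congr rfl fun b _ => mul_comm _ _
  rw [injective_iff_map_eq_zero]
  intro t ht
  have h3 : t.ofLp ∈ M.mulVecLin.ker := by
    rw [LinearMap.mem_ker]
    funext a
    rw [← hDM]
    exact congrArg (fun z : EuclideanSpace ℝ (Fin r) => z a) ht
  rw [hker, Submodule.mem_bot] at h3
  ext b
  simp [h3]

end MeanDerivative

/-! ### The regularity conditions in usable form -/

section Conditions

variable {d p r : ℕ} {P : Measure (EuclideanSpace ℝ (Fin d))}
  {g : EuclideanSpace ℝ (Fin d) → EuclideanSpace ℝ (Fin p) → EuclideanSpace ℝ (Fin r)}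
  {θ₀ : EuclideanSpace ℝ (Fin p)}

/-- The form in which the regularity conditions are used: `A` standardizes `g(·, θ₀)`, and `D` is
the derivative at `θ₀` of the mean of the standardized estimating function. -/
structure GELConditions.Local (P : Measure (EuclideanSpace ℝ (Fin d)))
    (g : EuclideanSpace ℝ (Fin d) → EuclideanSpace ℝ (Fin p) → EuclideanSpace ℝ (Fin r))
    (θ₀ : EuclideanSpace ℝ (Fin p)) (r₀ : ℝ)
    (A : EuclideanSpace ℝ (Fin r) →L[ℝ] EuclideanSpace ℝ (Fin r))
    (D : EuclideanSpace ℝ (Fin p) →L[ℝ] EuclideanSpace ℝ (Fin r))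
    (H : EuclideanSpace ℝ (Fin d) → ℝ) : Prop where
  pos : 0 < r₀
  measurable : ∀ θ ∈ Metric.closedBall θ₀ r₀, Measurable fun x => g x θ
  continuousOn : ∀ x, ContinuousOn (g x) (Metric.closedBall θ₀ r₀)
  injective : Function.Injective A
  isStandardized : IsStandardized (fun x => A (g x θ₀)) P
  nonneg : ∀ x, 0 ≤ H x
  integrable : Integrable H P
  norm_sub_le : ∀ x s, ‖s‖ ≤ r₀ → ‖A (g x (θ₀ + s)) - A (g x θ₀)‖ ≤ H x * ‖s‖
  norm_sub_sub_le : ∀ x s, ‖s‖ ≤ r₀ →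
    ‖A (g x (θ₀ + s)) - A (g x θ₀) - (A ∘L fderiv ℝ (g x) θ₀) s‖ ≤ H x * ‖s‖ ^ 2
  integrable_inner : ∀ v t, Integrable (fun x => ⟪v, (A ∘L fderiv ℝ (g x) θ₀) t⟫) P
  integral_inner_eq : ∀ v t, ∫ x, ⟪v, (A ∘L fderiv ℝ (g x) θ₀) t⟫ ∂P = ⟪v, D t⟫
  injective_deriv : Function.Injective D

lemma memLp_two_of_norm_pow_three_le [IsFiniteMeasure P]
    {f : EuclideanSpace ℝ (Fin d) → EuclideanSpace ℝ (Fin r)} (hf : Measurable f)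
    {H : EuclideanSpace ℝ (Fin d) → ℝ} (hH : Integrable H P) (h : ∀ x, ‖f x‖ ^ 3 ≤ H x) :
    MemLp f 2 P := by
  rw [memLp_two_iff_integrable_sq_norm hf.aestronglyMeasurable]
  refine ((integrable_const (1 : ℝ)).add hH).mono' (hf.norm.pow_const 2).aestronglyMeasurable
    (ae_of_all _ fun x => ?_)
  rw [Real.norm_of_nonneg (by positivity), Pi.add_apply]
  have h0 := norm_nonneg (f x)
  have h1 := h x
  rcases le_total ‖f x‖ 1 with h2 | h2
  · have : ‖f x‖ ^ 2 ≤ 1 := pow_le_one₀ h0 h2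
    have : 0 ≤ ‖f x‖ ^ 3 := by positivity
    linarith
  · have : ‖f x‖ ^ 2 ≤ ‖f x‖ ^ 3 := pow_le_pow_right₀ h2 (by norm_num)
    linarith

lemma GELConditions.exists_local [IsProbabilityMeasure P] (hcond : GELConditions P g θ₀)
    (hH₀ : ∫ x, g x θ₀ ∂P = 0) :
    ∃ r₀ A D H, GELConditions.Local P g θ₀ r₀ A D H := by
  obtain ⟨U, hU, hθU, hmeas, hC2, H, hH, hbd⟩ := hcond.smooth_dominated
  obtain ⟨r₀, hr₀, hball⟩ := Metric.nhds_basis_closedBall.mem_iff.1 (hU.mem_nhds hθU)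
  have hsmooth : ∀ x, ∀ θ ∈ U, ContDiffAt ℝ 2 (g x) θ := fun x θ hθ =>
    (hC2 x).contDiffAt (hU.mem_nhds hθ)
  have hdiff : ∀ x, ∀ θ ∈ U, DifferentiableAt ℝ (g x) θ := fun x θ hθ =>
    (hsmooth x θ hθ).differentiableAt two_ne_zero
  have hdiff2 : ∀ x, ∀ θ ∈ U, DifferentiableAt ℝ (fderiv ℝ (g x)) θ := fun x θ hθ =>
    ((hsmooth x θ hθ).fderiv_right (m := 1) (by norm_num)).differentiableAt one_ne_zero
  have hH0 : ∀ x, 0 ≤ H x := fun x => (norm_nonneg (fderiv ℝ (g x) θ₀)).trans (hbd x θ₀ hθU).1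
  have hL2 : MemLp (fun x => g x θ₀) 2 P :=
    memLp_two_of_norm_pow_three_le (hmeas θ₀ hθU) hH fun x => (hbd x θ₀ hθU).2.2
  obtain ⟨A, hA, hstd⟩ := exists_isStandardized hL2 hH₀ hcond.posDef
  have hint : ∀ t, Integrable (fun x => fderiv ℝ (g x) θ₀ t) P := fun t => by
    refine (hH.mul_const ‖t‖).mono' ?_ (ae_of_all _ fun x => ?_)
    · exact (measurable_fderiv_apply_of_nhds
        (eventually_of_mem (hU.mem_nhds hθU) hmeas) (fun x => hdiff x θ₀ hθU)
        t).aestronglyMeasurable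
    · exact ContinuousLinearMap.le_of_opNorm_le _ (hbd x θ₀ hθU).1 t
  obtain ⟨D, hD, hDint⟩ := exists_injective_integral_apply hint hcond.rank_eq
  refine ⟨r₀, A, A ∘L D, fun x => ‖A‖ * H x, hr₀, fun θ hθ => hmeas θ (hball hθ),
    fun x θ hθ => (hdiff x θ (hball hθ)).continuousAt.continuousWithinAt, hA, hstd,
    fun x => mul_nonneg (norm_nonneg _) (hH0 x), hH.const_mul _, fun x s hs => ?_,
    fun x s hs => ?_, fun v t => ?_, fun v t => ?_, hA.comp hD⟩
  · rw [← map_sub, mul_assoc]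
    exact A.le_opNorm_of_le (norm_image_add_sub_le (fun θ hθ => hdiff x θ (hball hθ))
      (fun θ hθ => (hbd x θ (hball hθ)).1) hs)
  · rw [ContinuousLinearMap.comp_apply, ← map_sub, ← map_sub, mul_assoc]
    exact A.le_opNorm_of_le (norm_image_add_sub_sub_le (fun θ hθ => hdiff x θ (hball hθ))
      (fun θ hθ => hdiff2 x θ (hball hθ)) (fun θ hθ => (hbd x θ (hball hθ)).2.1) hs)
  · exact (A.integrable_comp (hint t)).const_inner v
  · simp only [ContinuousLinearMap.comp_apply]
    rw [integral_inner (A.integrable_comp (hint t)), A.integral_comp_comm (hint t), hDint]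

end Conditions

section Measurability

variable {d p r n m : ℕ}
  {g : EuclideanSpace ℝ (Fin d) → EuclideanSpace ℝ (Fin p) → EuclideanSpace ℝ (Fin r)}
  {K : Set (EuclideanSpace ℝ (Fin p))}

lemma continuousOn_sum_apply (hc : ∀ x, ContinuousOn (g x) K)
    (x : Fin n → Fin m → EuclideanSpace ℝ (Fin d)) (i : Fin n) :
    ContinuousOn (fun θ => ∑ j, g (x i j) θ) K :=
  continuousOn_finsetSum _ fun j _ => hc (x i j)

lemma exists_isMaxOn_gelRatio (hn : 0 < n) (hm : 0 < m) (hK : IsCompact K) (hne : K.Nonempty)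
    (hc : ∀ x, ContinuousOn (g x) K) (x : Fin n → Fin m → EuclideanSpace ℝ (Fin d)) :
    ∃ θ ∈ K, IsMaxOn (gelRatio g x) K θ := by
  obtain ⟨θ, hθ, hmax⟩ := exists_isMaxOn_elRatio hK hne (continuousOn_sum_apply hc x)
  refine ⟨θ, hθ, fun θ' hθ' => ?_⟩
  simp only [Set.mem_ofPred_eq, gelRatio_eq_pow hn hm]
  exact pow_le_pow_left₀ (elRatio_nonneg _) (hmax hθ') m

/-- The maximizer `θ` is arbitrary, but the maximal value depends on the data alone; it equals the
value at a maximizer selected on the space of data, where measurability is known. -/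
lemma aemeasurable_gelRatio_of_isMaxOn {Ω : Type*} [MeasurableSpace Ω] {μ : Measure Ω}
    (hn : 0 < n) (hm : 0 < m) (hK : IsCompact K) (hmeas : ∀ θ ∈ K, Measurable fun x => g x θ)
    (hc : ∀ x, ContinuousOn (g x) K) {X : Fin n → Fin m → Ω → EuclideanSpace ℝ (Fin d)}
    (hX : ∀ i j, AEMeasurable (X i j) μ) {θ : Ω → EuclideanSpace ℝ (Fin p)}
    (hθ : ∀ ω, θ ω ∈ K)
    (hmax : ∀ ω, IsMaxOn (gelRatio g fun i j => X i j ω) K (θ ω)) :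
    AEMeasurable (fun ω => gelRatio g (fun i j => X i j ω) (θ ω)) μ := by
  rcases isEmpty_or_nonempty Ω with hΩ | ⟨⟨ω₀⟩⟩
  · exact (measurable_of_empty _).aemeasurable
  choose θs hθs hmaxs using fun x : Fin n → Fin m → EuclideanSpace ℝ (Fin d) =>
    exists_isMaxOn_elRatio hK ⟨θ ω₀, hθ ω₀⟩ (continuousOn_sum_apply hc x)
  have h1 : Measurable fun x : Fin n → Fin m → EuclideanSpace ℝ (Fin d) =>
      elRatio fun i => ∑ j, g (x i j) (θs x) := by
    have hy : ∀ θ ∈ K, ∀ i, Measurable fun x : Fin n → Fin m → EuclideanSpace ℝ (Fin d) =>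
        ∑ j, g (x i j) θ := fun θ hθ i => Finset.measurable_sum _ fun j _ =>
      (hmeas θ hθ).comp ((measurable_pi_apply j).comp (measurable_pi_apply i))
    have h := measurable_of_isMaxOn_elRatio
      (y := fun (x : Fin n → Fin m → EuclideanSpace ℝ (Fin d)) θ i => ∑ j, g (x i j) θ) hK hy
      (continuousOn_sum_apply hc) hθs hmaxs
    exact h
  have h2 : AEMeasurable (fun ω i j => X i j ω) μ :=
    aemeasurable_pi_lambda _ fun i => aemeasurable_pi_lambda _ fun j => hX i j
  refine ((h1.comp_aemeasurable h2).pow_const m).congr (ae_of_all _ fun ω => ?_)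
  have h3 := hmax ω (hθs fun i j => X i j ω)
  have h4 := hmaxs (fun i j => X i j ω) (hθ ω)
  simp only [Set.mem_ofPred_eq, gelRatio_eq_pow hn hm] at h3 h4 ⊢
  exact le_antisymm h3 (pow_le_pow_left₀ (elRatio_nonneg _) h4 m)

end Measurability

/-! ### Transfer to convergence in distribution -/

section Convergence

variable {Ω : Type*} [MeasurableSpace Ω] {μ : Measure Ω} [IsProbabilityMeasure μ]

lemma tendsto_inProb_of_tight {Y : ℕ → Ω → ℝ} {C : ℝ} (hY : ∀ᶠ n in atTop, Integrable (Y n) μ)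
    (hY0 : ∀ n ω, 0 ≤ Y n ω) (hC : ∀ᶠ n in atTop, ∫ ω, Y n ω ∂μ ≤ C) {f : ℕ × Ω → ℝ} {a : ℝ}
    (h : ∀ K, Tendsto f (inProb μ ⊓ 𝓟 {x | Y x.1 x.2 ≤ K}) (𝓝 a)) :
    Tendsto f (inProb μ) (𝓝 a) :=
  fun _ hs => eventually_inProb_of_tight hY hY0 hC fun K => h K hs

/-- Slutsky's lemma. The reindexing `φ` lets measurability of `W` be required only from the first
index where the estimate is known to exist. -/
lemma tendstoInDistribution_of_tendsto_inProb_sub {Ω' : Type*} [MeasurableSpace Ω']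
    {ν : Measure Ω'} [IsProbabilityMeasure ν] {Z : Ω' → ℝ} {Y W : ℕ → Ω → ℝ}
    (hY : TendstoInDistribution Y atTop Z (fun _ => μ) ν)
    (h : Tendsto (fun x : ℕ × Ω => W x.1 x.2 - Y x.1 x.2) (inProb μ) (𝓝 0)) {φ : ℕ → ℕ}
    (hφ : Tendsto φ atTop atTop) (hW : ∀ k, AEMeasurable (W (φ k)) μ) :
    TendstoInDistribution (fun k => W (φ k)) atTop Z (fun _ => μ) ν := by
  have hY' : TendstoInDistribution (fun k => Y (φ k)) atTop Z (fun _ => μ) ν :=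
    ⟨fun k => hY.forall_aemeasurable _, hY.aemeasurable_limit, hY.tendsto.comp hφ⟩
  refine tendstoInDistribution_of_tendstoInMeasure_sub _ Z hY' ?_ hW
  rw [tendstoInMeasure_iff_norm]
  intro ε hε
  have h1 := eventually_inProb.1 ((Metric.tendsto_nhds.1 h) ε hε)
  refine (h1.comp hφ).congr fun k => ?_
  simp

lemma tendsto_measure_of_eventually_inProb {q : ℕ × Ω → Prop} (h : ∀ᶠ x in inProb μ, q x) :
    Tendsto (fun n => μ {ω | q (n, ω)}) atTop (𝓝 1) := by
  have h1 := ENNReal.Tendsto.sub (tendsto_const_nhds (x := (1 : ENNReal))) (eventually_inProb.1 h)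
    (Or.inl ENNReal.one_ne_top)
  rw [tsub_zero] at h1
  refine tendsto_of_tendsto_of_tendsto_of_le_of_le h1 tendsto_const_nhds (fun n => ?_)
    fun n => prob_le_one
  rw [tsub_le_iff_right, ← measure_univ (μ := μ)]
  refine (measure_mono fun ω _ => ?_).trans (measure_union_le _ _)
  exact em (q (n, ω))

end Convergence

/-! ### The two statistics and the theorem -/

section Statistics

variable {d p r : ℕ}
  {g : EuclideanSpace ℝ (Fin d) → EuclideanSpace ℝ (Fin p) → EuclideanSpace ℝ (Fin r)}

lemma neg_two_mul_log_pow_div {m : ℕ} (hm : 0 < m) (a : ℝ) :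
    -2 * Real.log (a ^ m) / m = -2 * Real.log a := by
  have : (m : ℝ) ≠ 0 := by exact_mod_cast hm.ne'
  rw [Real.log_pow]
  field_simp

lemma add_inv_sqrt_smul_mem_gelBall {n m : ℕ} (hn : 0 < n) (hm : 0 < m)
    {θ₀ t : EuclideanSpace ℝ (Fin p)} :
    θ₀ + (√((n : ℝ) * m))⁻¹ • t ∈ gelBall n m θ₀ ↔ ‖t‖ ≤ ((n : ℝ) * m) ^ (1 / 6 : ℝ) := by
  have hN : (0 : ℝ) < (n : ℝ) * m := by positivity
  have hs : 0 < √((n : ℝ) * m) := Real.sqrt_pos.2 hN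
  have h1 : √((n : ℝ) * m) * ((n : ℝ) * m) ^ (-(1 / 3) : ℝ) = ((n : ℝ) * m) ^ (1 / 6 : ℝ) := by
    rw [Real.sqrt_eq_rpow, ← Real.rpow_add hN]
    norm_num
  rw [gelBall, Metric.mem_closedBall, dist_eq_norm, add_sub_cancel_left, norm_smul,
    Real.norm_of_nonneg (inv_nonneg.2 hs.le), inv_mul_le_iff₀ hs, h1]

lemma eventually_gelBall_subset {m : ℕ → ℕ} (hm : ∀ n, 0 < m n) (θ₀ : EuclideanSpace ℝ (Fin p))
    {r₀ : ℝ} (hr₀ : 0 < r₀) :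
    ∀ᶠ n in atTop, gelBall n (m n) θ₀ ⊆ Metric.closedBall θ₀ r₀ := by
  have h : Tendsto (fun n : ℕ => (n : ℝ) ^ (-(1 / 3) : ℝ)) atTop (𝓝 0) :=
    (tendsto_rpow_neg_atTop (by norm_num)).comp tendsto_natCast_atTop_atTop
  filter_upwards [h.eventually_le_const hr₀, eventually_gt_atTop 0] with n h1 hn
  refine Metric.closedBall_subset_closedBall (le_trans ?_ h1)
  refine Real.rpow_le_rpow_of_nonpos (by exact_mod_cast hn) ?_ (by norm_num)
  exact le_mul_of_one_le_right (Nat.cast_nonneg _) (by exact_mod_cast hm n)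

variable {P : Measure (EuclideanSpace ℝ (Fin d))}
  {θ₀ : EuclideanSpace ℝ (Fin p)} {r₀ : ℝ}
  {A : EuclideanSpace ℝ (Fin r) →L[ℝ] EuclideanSpace ℝ (Fin r)}
  {D : EuclideanSpace ℝ (Fin p) →L[ℝ] EuclideanSpace ℝ (Fin r)}
  {H : EuclideanSpace ℝ (Fin d) → ℝ}
  {m : ℕ → ℕ} {Ω : Type*} [MeasurableSpace Ω] {μ : Measure Ω}
  {X : (n : ℕ) → Fin n → Fin (m n) → Ω → EuclideanSpace ℝ (Fin d)}

lemma GELConditions.Local.aemeasurable_gelRatio (hloc : GELConditions.Local P g θ₀ r₀ A D H)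
    (hX : IsIIDArray m X P μ) (n : ℕ) :
    AEMeasurable (fun ω => gelRatio g (fun i j => X n i j ω) θ₀) μ := by
  rcases n.eq_zero_or_pos with rfl | hn
  · simp only [gelRatio_zero_left _ (hX.pos 0)]
    exact aemeasurable_const
  -- A fixed parameter is the maximizer over a singleton.
  · refine aemeasurable_gelRatio_of_isMaxOn hn (hX.pos n) (isCompact_singleton (x := θ₀))
      (fun θ hθ => ?_) (fun x => continuousOn_singleton _ _)
      (fun i j => (hX.hasLaw n i j).aemeasurable) (θ := fun _ => θ₀) (fun _ => rfl)
      (fun ω θ hθ => ?_)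
    · rw [Set.mem_singleton_iff.1 hθ]
      exact hloc.measurable θ₀ (Metric.mem_closedBall_self hloc.pos.le)
    · rw [Set.mem_singleton_iff.1 hθ, Set.mem_ofPred_eq]

lemma GELConditions.Local.aemeasurable_gelRatio_estimate
    (hloc : GELConditions.Local P g θ₀ r₀ A D H)
    (hX : IsIIDArray m X P μ) {n : ℕ} (hn : 0 < n)
    (hball : gelBall n (m n) θ₀ ⊆ Metric.closedBall θ₀ r₀)
    {θhat : Ω → EuclideanSpace ℝ (Fin p)}
    (hθ : ∀ ω, IsGELEstimate g (fun i j => X n i j ω) θ₀ (θhat ω)) :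
    AEMeasurable (fun ω => gelRatio g (fun i j => X n i j ω) (θhat ω)) μ :=
  aemeasurable_gelRatio_of_isMaxOn hn (hX.pos n) (isCompact_closedBall _ _)
    (fun θ h => hloc.measurable θ (hball h)) (fun x => (hloc.continuousOn x).mono hball)
    (fun i j => (hX.hasLaw n i j).aemeasurable) (fun ω => (hθ ω).1) fun ω => (hθ ω).2

variable [IsProbabilityMeasure P] [IsProbabilityMeasure μ]

lemma GELConditions.Local.eventually_gelRatio_pos (hloc : GELConditions.Local P g θ₀ r₀ A D H)
    (hX : IsIIDArray m X P μ) :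
    ∀ᶠ x : ℕ × Ω in inProb μ, 0 < gelRatio g (fun i j => X x.1 i j x.2) θ₀ := by
  have hint := fun (n : ℕ) (hn : 0 < n) => hX.integral_sq_norm_normSum hloc.isStandardized hn
  refine eventually_inProb_of_tight
    (Y := fun n ω => ‖normSum fun i => normSum fun j => A (g (X n i j ω) θ₀)‖ ^ 2)
    ((eventually_gt_atTop 0).mono fun n hn => (hint n hn).1) (fun n ω => by positivity)
    ((eventually_gt_atTop 0).mono fun n hn => (hint n hn).2.le) fun K => ?_
  have hreg := (hX.isELRegular hloc.isStandardized).mono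
    (inf_le_left (b := 𝓟 {x : ℕ × Ω |
      ‖normSum fun i => normSum fun j => A (g (X x.1 i j x.2) θ₀)‖ ^ 2 ≤ K}))
  have h := (hreg.tendsto_elRatio (K := √K) (mem_inf_of_right fun x hx =>
    Real.le_sqrt_of_sq_le hx)).1
  filter_upwards [h, (tendsto_fst_inProb.mono_left inf_le_left).eventually_gt_atTop 0] with x h hn
  rw [gelRatio_eq_elRatio_normSum (A := A.toLinearMap) hloc.injective hn (hX.pos _)]
  exact pow_pos h _

lemma GELConditions.Local.tendsto_log_gelRatio (hloc : GELConditions.Local P g θ₀ r₀ A D H)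
    (hX : IsIIDArray m X P μ) :
    Tendsto (fun x : ℕ × Ω =>
      -2 * Real.log (gelRatio g (fun i j => X x.1 i j x.2) θ₀) / (m x.1 : ℝ) -
        ‖normSum fun i => normSum fun j => A (g (X x.1 i j x.2) θ₀)‖ ^ 2) (inProb μ) (𝓝 0) := by
  have hint := fun (n : ℕ) (hn : 0 < n) => hX.integral_sq_norm_normSum hloc.isStandardized hn
  refine tendsto_inProb_of_tight
    (Y := fun n ω => ‖normSum fun i => normSum fun j => A (g (X n i j ω) θ₀)‖ ^ 2)
    ((eventually_gt_atTop 0).mono fun n hn => (hint n hn).1) (fun n ω => by positivity)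
    ((eventually_gt_atTop 0).mono fun n hn => (hint n hn).2.le) fun K => ?_
  have hreg := (hX.isELRegular hloc.isStandardized).mono
    (inf_le_left (b := 𝓟 {x : ℕ × Ω |
      ‖normSum fun i => normSum fun j => A (g (X x.1 i j x.2) θ₀)‖ ^ 2 ≤ K}))
  have h := (hreg.tendsto_elRatio (K := √K) (mem_inf_of_right fun x hx =>
    Real.le_sqrt_of_sq_le hx)).2
  refine h.congr' ?_
  filter_upwards [(tendsto_fst_inProb.mono_left inf_le_left).eventually_gt_atTop 0] with x hn
  rw [gelRatio_eq_elRatio_normSum (A := A.toLinearMap) hloc.injective hn (hX.pos _),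
    neg_two_mul_log_pow_div (hX.pos _)]
  rfl

lemma GELConditions.Local.tendsto_log_gelRatio_div (hloc : GELConditions.Local P g θ₀ r₀ A D H)
    (hX : IsIIDArray m X P μ) {θhat : ℕ → Ω → EuclideanSpace ℝ (Fin p)}
    (hθ : ∀ᶠ n in atTop, ∀ ω, IsGELEstimate g (fun i j => X n i j ω) θ₀ (θhat n ω)) :
    Tendsto (fun x : ℕ × Ω =>
      -2 * Real.log (gelRatio g (fun i j => X x.1 i j x.2) θ₀ /
        gelRatio g (fun i j => X x.1 i j x.2) (θhat x.1 x.2)) / (m x.1 : ℝ) -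
        ‖D.range.starProjection (normSum fun i => normSum fun j => A (g (X x.1 i j x.2) θ₀))‖ ^ 2)
      (inProb μ) (𝓝 0) := by
  have hint := fun (n : ℕ) (hn : 0 < n) => hX.integral_sq_norm_normSum hloc.isStandardized hn
  refine tendsto_inProb_of_tight
    (Y := fun n ω => ‖normSum fun i => normSum fun j => A (g (X n i j ω) θ₀)‖ ^ 2)
    ((eventually_gt_atTop 0).mono fun n hn => (hint n hn).1) (fun n ω => by positivity)
    ((eventually_gt_atTop 0).mono fun n hn => (hint n hn).2.le) fun K => ?_
  set l := inProb μ ⊓ 𝓟 {x : ℕ × Ω |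
      ‖normSum fun i => normSum fun j => A (g (X x.1 i j x.2) θ₀)‖ ^ 2 ≤ K}
  have hl : l ≤ inProb μ := inf_le_left
  have hreg := (hX.isELRegular hloc.isStandardized).mono hl
  have hpert := (hX.isELPerturbation (h := fun x θ => A (g x θ)) hloc.nonneg hloc.integrable
    hloc.pos hloc.norm_sub_le hloc.norm_sub_sub_le hloc.integrable_inner
    hloc.integral_inner_eq).mono hl
  have hpos : ∀ᶠ x : ℕ × Ω in l, 0 < x.1 :=
    (tendsto_fst_inProb.mono_left hl).eventually_gt_atTop 0
  have hest : ∀ᶠ x : ℕ × Ω in l, IsGELEstimate g (fun i j => X x.1 i j x.2) θ₀ (θhat x.1 x.2) :=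
    ((tendsto_fst_inProb.mono_left hl).eventually hθ).mono fun x hx => hx x.2
  -- The local parameter of the estimate; the ball for `θ` corresponds exactly to `‖t‖ ≤ N^(1/6)`,
  -- so maximality passes to the perturbed array.
  let t : ℕ × Ω → EuclideanSpace ℝ (Fin p) := fun x =>
    √((x.1 : ℝ) * m x.1) • (θhat x.1 x.2 - θ₀)
  have ht : ∀ x : ℕ × Ω, 0 < x.1 → θ₀ + (√((x.1 : ℝ) * m x.1))⁻¹ • t x = θhat x.1 x.2 :=
    fun x hx => by
      have hm := hX.pos x.1
      have hs : √((x.1 : ℝ) * m x.1) ≠ 0 := (Real.sqrt_pos.2 (by positivity)).ne'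
      rw [inv_smul_smul₀ hs, add_sub_cancel]
  have hel : ∀ x : ℕ × Ω, 0 < x.1 → ∀ s,
      gelRatio g (fun i j => X x.1 i j x.2) (θ₀ + (√((x.1 : ℝ) * m x.1))⁻¹ • s) =
      elRatio (elPerturb (fun i => normSum fun j => A (g (X x.1 i j x.2) θ₀))
        (localIncrement (fun x θ => A (g x θ)) θ₀ fun i j => X x.1 i j x.2) s) ^ m x.1 :=
    fun x hx s => by
      rw [gelRatio_eq_elRatio_normSum (A := A.toLinearMap) hloc.injective hx (hX.pos _)]
      exact congrArg (fun y => elRatio y ^ m x.1) (elPerturb_localIncrement hx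
        (fun x θ => A (g x θ)) θ₀ s fun i j => X x.1 i j x.2).symm
  have hmain := hreg.tendsto_log_ratio hpert hloc.injective_deriv (t := t) (K := √K) ?_
    (mem_inf_of_right fun x hx => Real.le_sqrt_of_sq_le hx) ?_
  · refine hmain.congr' ?_
    filter_upwards [hpos] with x hn
    have h1 := hel x hn (t x)
    rw [ht x hn] at h1
    rw [h1, gelRatio_eq_elRatio_normSum (A := A.toLinearMap) hloc.injective hn (hX.pos _),
      ← div_pow, neg_two_mul_log_pow_div (hX.pos _)]
    rfl
  · filter_upwards [hpos, hest] with x hn hx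
    rw [← add_inv_sqrt_smul_mem_gelBall (θ₀ := θ₀) hn (hX.pos _), ht x hn]
    exact hx.1
  · filter_upwards [hpos, hest] with x hn hx s hs
    have h1 := hx.2 ((add_inv_sqrt_smul_mem_gelBall (θ₀ := θ₀) hn (hX.pos _)).2 hs)
    rw [Set.mem_ofPred_eq, ← ht x hn, hel x hn, hel x hn] at h1
    exact (pow_le_pow_iff_left₀ (elRatio_nonneg _) (elRatio_nonneg _) (hX.pos _).ne').1 h1

end Statistics

theorem theorem2
    {d p r : ℕ} (hp : 0 < p) (hpr : p ≤ r)
    -- the law of one observation, the estimating function and the hypothesized parameter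
    (P : Measure (EuclideanSpace ℝ (Fin d))) [IsProbabilityMeasure P]
    (g : EuclideanSpace ℝ (Fin d) → EuclideanSpace ℝ (Fin p) → EuclideanSpace ℝ (Fin r))
    (θ₀ : EuclideanSpace ℝ (Fin p))
    (hcond : GELConditions P g θ₀)
    -- the null hypothesis: `θ₀` solves the estimating equation
    (hH₀ : ∫ x, g x θ₀ ∂P = 0)
    -- the group sizes: an arbitrary sequence of positive integers
    (m : ℕ → ℕ) (hm : ∀ n, 0 < m n)
    -- for every `n`, the `n * m n` observations, in `n` groups of size `m n`, are i.i.d. from `P`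
    {Ω : Type*} [MeasurableSpace Ω] (μ : Measure Ω) [IsProbabilityMeasure μ]
    (X : (n : ℕ) → Fin n → Fin (m n) → Ω → EuclideanSpace ℝ (Fin d))
    (hlaw : ∀ n i j, HasLaw (X n i j) P μ)
    (hindep : ∀ n, iIndepFun (fun ij : Fin n × Fin (m n) => X n ij.1 ij.2) μ) :
    -- with probability tending to one, `R_G(θ₀)` is positive, so that its logarithm is finite
    Tendsto (fun n => μ {ω | 0 < gelRatio g (fun i j => X n i j ω) θ₀}) atTop (𝓝 1) ∧
    -- just-identified case: `-2 log R_G(θ₀) / m` converges in distribution to chi-squared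
    (r = p →
      TendstoInDistribution
        (fun n ω => -2 * Real.log (gelRatio g (fun i j => X n i j ω) θ₀) / (m n : ℝ))
        atTop id (fun _ => μ) (chiSquared p)) ∧
    -- just- or over-identified case: for all large `n` the estimate exists, and the log ratio of
    -- `R_G(θ₀)` to its maximum, divided by `m`, converges in distribution to chi-squared
    ∃ n₀ : ℕ,
      (∀ n, n₀ ≤ n → ∀ ω, ∃ θ, IsGELEstimate g (fun i j => X n i j ω) θ₀ θ) ∧
      ∀ θhat : ℕ → Ω → EuclideanSpace ℝ (Fin p),
        (∀ n, n₀ ≤ n → ∀ ω, IsGELEstimate g (fun i j => X n i j ω) θ₀ (θhat n ω)) →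
        TendstoInDistribution
          (fun k ω => -2 * Real.log (gelRatio g (fun i j => X (n₀ + k) i j ω) θ₀ /
            gelRatio g (fun i j => X (n₀ + k) i j ω) (θhat (n₀ + k) ω)) / (m (n₀ + k) : ℝ))
          atTop id (fun _ => μ) (chiSquared p) := by
  have hX : IsIIDArray m X P μ := ⟨hm, hlaw, hindep⟩
  obtain ⟨r₀, A, D, H, hloc⟩ := hcond.exists_local hH₀
  have hmeas : AEMeasurable (fun x => A (g x θ₀)) P :=
    (A.continuous.measurable.comp
      (hloc.measurable θ₀ (Metric.mem_closedBall_self hloc.pos.le))).aemeasurable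
  refine ⟨tendsto_measure_of_eventually_inProb (hloc.eventually_gelRatio_pos hX), fun hrp => ?_, ?_⟩
  -- When `r = p` the whole space has dimension `p`, and the limit `‖G‖²` is its own projected
  -- length.
  · have hclt := hX.tendstoInDistribution_sq_norm_proj hmeas hloc.isStandardized ⊤ (p := p)
      (by rw [finrank_top, finrank_euclideanSpace_fin, hrp])
    simp only [Submodule.starProjection_top, ContinuousLinearMap.id_apply] at hclt
    exact tendstoInDistribution_of_tendsto_inProb_sub
      (W := fun n ω => -2 * Real.log (gelRatio g (fun i j => X n i j ω) θ₀) / (m n : ℝ))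
      hclt (hloc.tendsto_log_gelRatio hX) tendsto_id fun n =>
        ((hloc.aemeasurable_gelRatio hX n).log.const_mul _).div_const _
  · have hclt := hX.tendstoInDistribution_sq_norm_proj hmeas hloc.isStandardized D.range (p := p)
      ((LinearMap.finrank_range_of_inj hloc.injective_deriv).trans finrank_euclideanSpace_fin)
    -- From `n₀` on the ball lies where `g` is continuous and measurable in the required sense, and
    -- there is at least one group.
    obtain ⟨n₀, hn₀⟩ := eventually_atTop.1
      ((eventually_gelBall_subset hm θ₀ hloc.pos).and (eventually_gt_atTop 0))
    refine ⟨n₀, fun n hn ω => ?_, fun θhat hθ => ?_⟩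
    · exact exists_isMaxOn_gelRatio (hn₀ n hn).2 (hm n) (isCompact_closedBall _ _)
        ⟨θ₀, Metric.mem_closedBall_self (by positivity)⟩
        (fun x => (hloc.continuousOn x).mono (hn₀ n hn).1) _
    · refine tendstoInDistribution_of_tendsto_inProb_sub
        (W := fun n ω => -2 * Real.log (gelRatio g (fun i j => X n i j ω) θ₀ /
          gelRatio g (fun i j => X n i j ω) (θhat n ω)) / (m n : ℝ))
        (φ := fun k => n₀ + k) hclt
        (hloc.tendsto_log_gelRatio_div hX (eventually_atTop.2 ⟨n₀, hθ⟩))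
        (tendsto_atTop_mono (fun k => Nat.le_add_left k n₀) tendsto_id) fun k => ?_
      have hk := Nat.le_add_right n₀ k
      exact (((hloc.aemeasurable_gelRatio hX _).div (hloc.aemeasurable_gelRatio_estimate hX
        (hn₀ _ hk).2 (hn₀ _ hk).1 (hθ _ hk))).log.const_mul _).div_const _
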